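/- Let $n\ge 2$ and $m\ge 1$ be integers, let $\alpha_M>0$, $V,\tilde\kappa\in\mathbb R$, and let $(S,g)$ be a non-empty compact smooth Riemannian manifold of dimension $m$ without boundary, with Laplacian $\varDelta$. Put $$a_0=\frac{2n(n-1)}{\alpha_M},\qquad \bar V=\frac{\alpha_M}{n(n-1)}V,\qquad \bar\mu=\frac4{n^2}a_0\,\mu-\frac{(m-1)^2}4\quad(\mu\in\mathbb R).$$ Let $\mathcal H_0\subset L^2(S,\mathbb C)$ be the (finite dimensional) space spanned by the eigenspaces $E_\mu$ of $-\varDelta$ with $\bar\mu\le 0$, and let $M=-\frac4{n^2}a_0\varDelta-\frac{(m-1)^2}4$ on $\mathcal H_0$, so that $M=\bar\mu$ on $E_\mu$. Let $I_1=(0,r_0)$ with $r_0>0$, and $I_2=(0,\infty)$. Let $\mathcal H(I_i,1)=L^2(I_i,r\,dr)\otimes\mathcal H_0$, and let $\mathcal H_i(I_i)$ be the completion of $C_c^\infty(I_i)\otimes\mathcal H_0$ with respect to the norm $$\|\psi\|^2=\int_{I_i}\Big\{r\,\|\dot\psi\|^2-r^{-1}\langle M\psi,\psi\rangle+\epsilon_i\,r^3\|\psi\|^2\Big\}\,dr,\qquad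 \epsilon_1=0,\ \epsilon_2=1,$$ where $\|\cdot\|$ and $\langle\cdot,\cdot\rangle$ under the integral are those of $L^2(S)$; $\mathcal H_i(I_i)$ is continuously embedded in $\mathcal H(I_i,1)$. Let $$H_1\psi=-r^{-1}(r\dot\psi)'-r^{-2}M\psi-\frac{16}{n^2}\bar V r^2\psi+\frac{16}{n^2}\tilde\kappa\, r^{\frac{2(n-2)}n}\psi,\qquad H_2\psi=-r^{-1}(r\dot\psi)'-r^{-2}M\psi+\frac{16}{n^2}r^2\psi .$$ Consider the eigenvalue problems, for $\psi\in\mathcal H_i(I_i)$ and in the sense of distributions (that is, tested in $\mathcal H(I_i,1)$ against all elements of $C_c^\infty(I_i)\otimes\mathcal H_0$), $$H_1\psi=\bar\varLambda\,\frac{16}{n^2}\,r^2\psi\quad\text{on } I_1,\qquad\text{and, if }\tilde\kappa<0,\qquad H_2\psi=-\lambda\,\tilde\kappa\,\frac{16}{n^2}\,r^{\frac{2(n-2)}n}\psi\quad\text{on } I_2 .$$ Each of them has countably many solutions: there are sequences $(\bar\varLambda_j,\psi_j)_{j\in\mathbb N}$, respectively $(\lambda_j,\psi_j)_{j\in\mathbb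 N}$, of real eigenvalues and linearly independent eigenvectors $\psi_j\in\mathcal H_i(I_i)$ that exhaust all solutions, in the sense that for every real number the solutions of the problem with that number as eigenvalue lie in the (algebraic) span of the $\psi_j$ that belong to it, and $$\bar\varLambda_j\le\bar\varLambda_{j+1},\quad \lim_j\bar\varLambda_j=\infty,\qquad\text{respectively}\qquad \lambda_j\le\lambda_{j+1},\quad \lim_j\lambda_j=\infty .$$ The respective eigenvectors $(\psi_j)$ are complete in $\mathcal H_i(I_i)$ as well as in $\mathcal H(I_i,1)$, that is, their linear span is dense in both spaces. -/

import Mathlib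

open MeasureTheory Set Filter Topology
open scoped Manifold ContDiff ComplexConjugate

noncomputable section

/-! ## The compact Riemannian manifold `S`: volume, gradients, Laplacian, eigenspaces -/

namespace RiemGeom

variable {m : ℕ} {S : Type*} [TopologicalSpace S] [ChartedSpace (EuclideanSpace ℝ (Fin m)) S]
  [IsManifold (𝓡 m) ∞ S]

/-- A smooth Riemannian metric on the `m`-dimensional manifold `S`. -/
abbrev Metric (m : ℕ) (S : Type*) [TopologicalSpace S]
    [ChartedSpace (EuclideanSpace ℝ (Fin m)) S] [IsManifold (𝓡 m) ∞ S] :=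
  Bundle.ContMDiffRiemannianMetric (𝓡 m) ∞ (EuclideanSpace ℝ (Fin m))
    (fun x : S => TangentSpace (𝓡 m) x)

/-- The `i`-th standard basis vector of `ℝ^m`. -/
def basisVec (m : ℕ) (i : Fin m) : EuclideanSpace ℝ (Fin m) := EuclideanSpace.single i 1

/-- The coefficients `g_ij` of the metric in the chart around `x`, at the point with
coordinates `z`. -/
def chartGram (g : Metric m S) (x : S) (z : EuclideanSpace ℝ (Fin m)) :
    Matrix (Fin m) (Fin m) ℝ :=
  Matrix.of fun i j =>
    g.inner ((chartAt (EuclideanSpace ℝ (Fin m)) x).symm z)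
      (mfderiv (𝓡 m) (𝓡 m) (chartAt (EuclideanSpace ℝ (Fin m)) x).symm z (basisVec m i))
      (mfderiv (𝓡 m) (𝓡 m) (chartAt (EuclideanSpace ℝ (Fin m)) x).symm z (basisVec m j))

/-- The measure `√(det g_ij) dz` of the chart around `x`, carried over to `S`. -/
def chartVolume [MeasurableSpace S] (g : Metric m S) (x : S) : Measure S :=
  Measure.map (chartAt (EuclideanSpace ℝ (Fin m)) x).symm
    ((volume.restrict (chartAt (EuclideanSpace ℝ (Fin m)) x).target).withDensity
      fun z => ENNReal.ofReal (Real.sqrt (chartGram g x z).det))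

/-- The Riemannian volume. The chart measures agree on overlaps of charts, so that their supremum
is the measure which restricts to each of them on the domain of the chart. -/
def riemVolume [MeasurableSpace S] (g : Metric m S) : Measure S := ⨆ x : S, chartVolume g x

/-- The coefficients `g_ij` at `x` in the basis of `T_x S` that is given by the preferred chart
at `x`. -/
def gram (g : Metric m S) (x : S) : Matrix (Fin m) (Fin m) ℝ :=
  Matrix.of fun i j =>
    g.inner x (show TangentSpace (𝓡 m) x from basisVec m i)
      (show TangentSpace (𝓡 m) x from basisVec m j)

/-- The partial derivative `∂_i f` at `x` in the same basis. -/
def partialDeriv (f : S → ℂ) (x : S) (i : Fin m) : ℂ :=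
  mfderiv (𝓡 m) 𝓘(ℝ, ℂ) f x (show TangentSpace (𝓡 m) x from basisVec m i)

/-- `⟨Df, Dh⟩ = g^{ij} ∂_i f conj(∂_j h)`, the pairing of the gradients of two complex valued
functions. -/
def gradInner (g : Metric m S) (f h : S → ℂ) (x : S) : ℂ :=
  ∑ i, ∑ j, (((gram g x)⁻¹ i j : ℝ) : ℂ) * partialDeriv f x i * conj (partialDeriv h x j)

/-- `l` is the Laplacian `Δ f = div (grad f)` of `f`: the divergence being minus the adjoint of the
gradient, `∫ ⟨Df, Dh⟩ = - ∫ l conj(h)` for all smooth `h` (`S` is compact without boundary). -/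
def IsLaplacian [MeasurableSpace S] (g : Metric m S) (f l : S → ℂ) : Prop :=
  ∀ h : S → ℂ, ContMDiff (𝓡 m) 𝓘(ℝ, ℂ) ∞ h →
    ∫ x, gradInner g f h x ∂(riemVolume g) = - ∫ x, l x * conj (h x) ∂(riemVolume g)

/-- `L²(S, ℂ)`. -/
abbrev L2 [MeasurableSpace S] (g : Metric m S) := Lp ℂ 2 (riemVolume g)

/-- The eigenspace `E_μ ⊂ L²(S, ℂ)` of `-Δ`: all (classes of) smooth functions `f` such that
`-Δ f = μ f`. -/
def eigenspace [MeasurableSpace S] (g : Metric m S) (μ : ℝ) : Submodule ℂ (L2 g) :=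
  Submodule.span ℂ {η | ∃ f : S → ℂ, ContMDiff (𝓡 m) 𝓘(ℝ, ℂ) ∞ f ∧
    (η : S → ℂ) =ᵐ[riemVolume g] f ∧ IsLaplacian g f fun x => -(μ : ℂ) * f x}

lemma conj_gradInner (g : Metric m S) (f h : S → ℂ) (x : S) :
    conj (gradInner g f h x) = gradInner g h f x := by
  have hs : (gram g x).IsSymm := by
    ext i j
    exact g.symm x _ _
  have hs' : ((gram g x)⁻¹).IsSymm := by
    rw [Matrix.IsSymm, Matrix.transpose_nonsing_inv, hs]
  unfold gradInner
  simp only [map_sum, map_mul, Complex.conj_conj, Complex.conj_ofReal]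
  rw [Finset.sum_comm]
  refine Finset.sum_congr rfl fun i _ => Finset.sum_congr rfl fun j _ => ?_
  rw [hs'.apply i j]
  ring

/-- Eigenspaces for different eigenvalues are orthogonal. -/
lemma eigenspace_ortho [MeasurableSpace S] (g : Metric m S) {μ ν : ℝ} (hμν : μ ≠ ν)
    {η ζ : L2 g} (hη : η ∈ eigenspace g μ) (hζ : ζ ∈ eigenspace g ν) :
    inner ℂ η ζ = 0 := by
  have key : eigenspace g μ ⟂ eigenspace g ν := by
    unfold eigenspace
    rw [Submodule.isOrtho_span]
    rintro η ⟨f, hf, hηf, hμ⟩ ζ ⟨h, hh, hζh, hν⟩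
    rw [L2.inner_def]
    have e1 : ∫ x, inner ℂ (η x) (ζ x) ∂(riemVolume g)
        = ∫ x, h x * conj (f x) ∂(riemVolume g) := by
      refine integral_congr_ae ?_
      filter_upwards [hηf, hζh] with x h1 h2
      simp [h1, h2]
    rw [e1]
    have a := hμ h hh
    have b := hν f hf
    have c : conj (∫ x, gradInner g f h x ∂(riemVolume g))
        = ∫ x, gradInner g h f x ∂(riemVolume g) := by
      rw [← integral_conj]
      exact integral_congr_ae (Eventually.of_forall fun x => conj_gradInner g f h x)
    rw [← c, a] at b
    simp only [mul_assoc, integral_const_mul, map_neg, map_mul, Complex.conj_ofReal,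
      ← integral_conj, Complex.conj_conj] at b
    have d : ∫ x, conj (f x) * h x ∂(riemVolume g) = ∫ x, h x * conj (f x) ∂(riemVolume g) :=
      integral_congr_ae (Eventually.of_forall fun x => mul_comm _ _)
    rw [d] at b
    have e : ((μ : ℂ) - ν) * ∫ x, h x * conj (f x) ∂(riemVolume g) = 0 := by
      linear_combination b
    rcases mul_eq_zero.mp e with e | e
    · exact absurd (by exact_mod_cast sub_eq_zero.mp e) hμν
    · exact e
  exact Submodule.isOrtho_iff_inner_eq.mp key η hη ζ hζ

end RiemGeom

/-! ## A linear operator that is a given scalar on each member of an orthogonal family -/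

namespace SpectralOp

variable {F ι : Type*} [NormedAddCommGroup F] [InnerProductSpace ℂ F] [DecidableEq ι]
  (E : ι → Submodule ℂ F)

/-- The algebraic sum of a family of pairwise orthogonal subspaces is direct. -/
def decomp (hE : ∀ i j, i ≠ j → E i ⟂ E j) :
    (Π₀ i, E i) ≃ₗ[ℂ] (⨆ i, E i : Submodule ℂ F) :=
  (LinearEquiv.ofInjective (DFinsupp.lsum ℕ fun i => (E i).subtype)
    (iSupIndep.dfinsupp_lsum_injective
      (OrthogonalFamily.independent (OrthogonalFamily.of_pairwise fun i j h => hE i j h)))).trans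
    (LinearEquiv.ofEq _ _ (Submodule.iSup_eq_range_dfinsupp_lsum E).symm)

/-- The operator on `⨆ i, E i` that multiplies the elements of `E i` by `a i`. -/
def linOp (hE : ∀ i j, i ≠ j → E i ⟂ E j) (a : ι → ℝ) :
    (⨆ i, E i : Submodule ℂ F) →ₗ[ℂ] (⨆ i, E i : Submodule ℂ F) :=
  (decomp E hE).toLinearMap ∘ₗ
    (DFinsupp.mapRange.linearMap fun i => (a i : ℂ) • (LinearMap.id : E i →ₗ[ℂ] E i)) ∘ₗ
    (decomp E hE).symm.toLinearMap

lemma decomp_single (hE : ∀ i j, i ≠ j → E i ⟂ E j) (i : ι) (x : E i) :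
    ((decomp E hE (DFinsupp.single i x) : (⨆ i, E i : Submodule ℂ F)) : F) = x := by
  simp [decomp]

lemma linOp_apply_mem (hE : ∀ i j, i ≠ j → E i ⟂ E j) (a : ι → ℝ) (i : ι)
    (x : (⨆ i, E i : Submodule ℂ F)) (hx : (x : F) ∈ E i) :
    linOp E hE a x = (a i : ℂ) • x := by
  have h : x = decomp E hE (DFinsupp.single i ⟨x, hx⟩) := by
    apply Subtype.ext
    rw [decomp_single]
  have h2 : (decomp E hE).symm x = DFinsupp.single i ⟨x, hx⟩ := by
    rw [LinearEquiv.symm_apply_eq]; exact h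
  apply Subtype.ext
  simp only [linOp, LinearMap.comp_apply, LinearEquiv.coe_coe, h2]
  simp [decomp_single]

lemma exists_sum (hE : ∀ i j, i ≠ j → E i ⟂ E j) (a : ι → ℝ) (x : (⨆ i, E i : Submodule ℂ F)) :
    ∃ (s : Finset ι) (v : ∀ i, E i), (x : F) = ∑ i ∈ s, (v i : F) ∧
      ((linOp E hE a x : (⨆ i, E i : Submodule ℂ F)) : F) = ∑ i ∈ s, (a i : ℂ) • (v i : F) := by
  classical
  obtain ⟨f, rfl⟩ := (decomp E hE).surjective x
  refine ⟨f.support, fun i => f i, ?_, ?_⟩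
  · simp [decomp, DFinsupp.sumAddHom_apply, DFinsupp.sum]
  · have hf : decomp E hE f = ∑ i ∈ f.support, decomp E hE (DFinsupp.single i (f i)) := by
      rw [← map_sum]
      congr 1
      exact (DFinsupp.sum_single (f := f)).symm
    rw [hf, map_sum, AddSubmonoidClass.coe_finsetSum]
    refine Finset.sum_congr rfl fun i _ => ?_
    rw [linOp_apply_mem E hE a i _ (by rw [decomp_single]; exact (f i).2)]
    simp [decomp_single]

lemma linOp_bound (hE : ∀ i j, i ≠ j → E i ⟂ E j) (a : ι → ℝ) (c : ℝ) (hc : 0 ≤ c)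
    (ha : ∀ i, |a i| ≤ c) (x : (⨆ i, E i : Submodule ℂ F)) :
    ‖linOp E hE a x‖ ≤ c * ‖x‖ := by
  obtain ⟨s, v, h1, h2⟩ := exists_sum E hE a x
  have hO : OrthogonalFamily ℂ (fun i => E i) fun i => (E i).subtypeₗᵢ :=
    OrthogonalFamily.of_pairwise fun i j h => hE i j h
  have n1 : ‖∑ i ∈ s, (v i : F)‖ ^ 2 = ∑ i ∈ s, ‖(v i : F)‖ ^ 2 := hO.norm_sum v s
  have n2 : ‖∑ i ∈ s, (a i : ℂ) • (v i : F)‖ ^ 2 = ∑ i ∈ s, ‖(a i : ℂ) • (v i : F)‖ ^ 2 :=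
    hO.norm_sum (fun i => (a i : ℂ) • v i) s
  simp only [norm_smul] at n2
  have : ‖(linOp E hE a x : F)‖ ^ 2 ≤ (c * ‖(x : F)‖) ^ 2 := by
    rw [h1, h2, n2, mul_pow, n1, Finset.mul_sum]
    refine Finset.sum_le_sum fun i _ => ?_
    rw [mul_pow]
    gcongr
    simpa using ha i
  exact le_of_sq_le_sq this (by positivity)

lemma linOp_symm (hE : ∀ i j, i ≠ j → E i ⟂ E j) (a : ι → ℝ) (x y : (⨆ i, E i : Submodule ℂ F)) :
    inner ℂ (linOp E hE a x) y = inner ℂ x (linOp E hE a y) := by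
  obtain ⟨s, v, h1, h2⟩ := exists_sum E hE a x
  obtain ⟨t, w, k1, k2⟩ := exists_sum E hE a y
  rw [Submodule.coe_inner, Submodule.coe_inner, h1, h2, k1, k2]
  simp only [sum_inner, inner_sum]
  refine Finset.sum_congr rfl fun i _ => Finset.sum_congr rfl fun j _ => ?_
  rw [inner_smul_left, inner_smul_right, Complex.conj_ofReal]
  by_cases h : i = j
  · rw [h]
  · rw [Submodule.isOrtho_iff_inner_eq.mp (hE j i (Ne.symm h)) _ (v j).2 _ (w i).2]
    simp

lemma linOp_re_inner (hE : ∀ i j, i ≠ j → E i ⟂ E j) (a : ι → ℝ) (c : ℝ)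
    (ha : ∀ i, a i ≤ c) (x : (⨆ i, E i : Submodule ℂ F)) :
    (inner ℂ (linOp E hE a x) x).re ≤ c * ‖x‖ ^ 2 := by
  obtain ⟨s, v, h1, h2⟩ := exists_sum E hE a x
  have hO : OrthogonalFamily ℂ (fun i => E i) fun i => (E i).subtypeₗᵢ :=
    OrthogonalFamily.of_pairwise fun i j h => hE i j h
  have n1 : ‖∑ i ∈ s, (v i : F)‖ ^ 2 = ∑ i ∈ s, ‖(v i : F)‖ ^ 2 := hO.norm_sum v s
  have n2 : inner ℂ (∑ i ∈ s, (a i : ℂ) • (v i : F)) (∑ i ∈ s, (v i : F))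
      = ∑ i ∈ s, inner ℂ ((a i : ℂ) • (v i : F)) (v i : F) :=
    hO.inner_sum (fun i => (a i : ℂ) • v i) v s
  rw [Submodule.coe_inner, Submodule.coe_norm, h2]
  rw [h1, n1, n2, Finset.mul_sum, Complex.re_sum]
  refine Finset.sum_le_sum fun i _ => ?_
  rw [inner_smul_left, inner_self_eq_norm_sq_to_K]
  have := ha i
  have h3 : ((starRingEnd ℂ) (a i : ℂ) * (‖(v i : F)‖ : ℂ) ^ 2).re = a i * ‖(v i : F)‖ ^ 2 := by
    rw [Complex.conj_ofReal]; norm_cast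
  refine (le_of_eq h3).trans ?_
  gcongr

end SpectralOp

/-! ## Radial function spaces with values in a space `F` of functions on `S` -/

namespace Radial

variable {F : Type*} [NormedAddCommGroup F] [InnerProductSpace ℂ F]

/-- A bounded, symmetric, nonpositive operator. -/
structure AngularOp (F : Type*) [NormedAddCommGroup F] [InnerProductSpace ℂ F] where
  op : F →L[ℂ] F
  symm : ∀ x y : F, inner ℂ (op x) y = inner ℂ x (op y)
  nonpos : ∀ x : F, (inner ℂ (op x) x).re ≤ 0

/-- The operator `a A - b` as an `AngularOp`. -/
def AngularOp.affine (A : F →L[ℂ] F) (a b : ℝ) (hs : ∀ x y : F, inner ℂ (A x) y = inner ℂ x (A y))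
    (hn : ∀ x : F, a * (inner ℂ (A x) x).re ≤ b * ‖x‖ ^ 2) : AngularOp F where
  op := (a : ℂ) • A - (b : ℂ) • ContinuousLinearMap.id ℂ F
  symm x y := by
    simp only [sub_apply, smul_apply, ContinuousLinearMap.id_apply, inner_sub_left,
      inner_sub_right, inner_smul_left, inner_smul_right, Complex.conj_ofReal, hs]
  nonpos x := by
    have e : (inner ℂ x x : ℂ).re = ‖x‖ ^ 2 := by
      rw [inner_self_eq_norm_sq_to_K]; norm_cast
    have h := hn x
    simp only [sub_apply, smul_apply, ContinuousLinearMap.id_apply, inner_sub_left,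
      inner_smul_left, Complex.conj_ofReal, Complex.sub_re, Complex.re_ofReal_mul, e]
    linarith

/-- The two models: `I_1 = (0, r₀)` and `I_2 = (0, ∞)`. -/
inductive Model where
  | bounded (r₀ : ℝ) : Model
  | unbounded : Model

/-- The interval of the model. -/
def Model.interval : Model → Set ℝ
  | .bounded r₀ => Ioo 0 r₀
  | .unbounded => Ioi 0

/-- The coefficient of `∫ r³ |u|²` in the scalar product of the model. -/
def Model.weight : Model → ℝ
  | .bounded _ => 0
  | .unbounded => 1

lemma Model.interval_subset (M : Model) : M.interval ⊆ Ioi 0 := by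
  cases M with
  | bounded r₀ => exact Ioo_subset_Ioi_self
  | unbounded => exact subset_rfl

lemma Model.measurableSet_interval (M : Model) : MeasurableSet M.interval := by
  cases M with
  | bounded r₀ => exact measurableSet_Ioo
  | unbounded => exact measurableSet_Ioi

lemma Model.weight_nonneg (M : Model) : 0 ≤ M.weight := by
  cases M <;> simp [Model.weight]

/-- `C_c^∞(I, F)`, which is `C_c^∞(I) ⊗ F` when `F` is finite dimensional. -/
def testSubmodule (F : Type*) [NormedAddCommGroup F] [InnerProductSpace ℂ F] (M : Model) :
    Submodule ℂ (ℝ → F) where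
  carrier := {φ | ContDiff ℝ ∞ φ ∧ HasCompactSupport φ ∧ tsupport φ ⊆ M.interval}
  add_mem' := by
    rintro φ χ ⟨h1, h2, h3⟩ ⟨k1, k2, k3⟩
    exact ⟨h1.add k1, h2.add k2, (tsupport_add φ χ).trans (union_subset h3 k3)⟩
  zero_mem' := ⟨contDiff_const, HasCompactSupport.zero, by simp [tsupport]⟩
  smul_mem' := by
    rintro c φ ⟨h1, h2, h3⟩
    exact ⟨contDiff_const.smul h1, h2.smul_left (f := fun _ => c),
      (tsupport_smul_subset_right (fun _ => c) φ).trans h3⟩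

/-- `C_c^∞(I) ⊗ F` as a type that will carry the scalar product below. -/
def TestSpace (_T : AngularOp F) (M : Model) : Type _ := testSubmodule F M

variable {T : AngularOp F} {M : Model}

instance : AddCommGroup (TestSpace T M) := inferInstanceAs (AddCommGroup (testSubmodule F M))
instance : Module ℂ (TestSpace T M) := inferInstanceAs (Module ℂ (testSubmodule F M))

/-- The function underlying a test function. -/
def TestSpace.fn (φ : TestSpace T M) : ℝ → F := φ.1

@[simp] lemma TestSpace.fn_add (φ χ : TestSpace T M) (r : ℝ) :
    (φ + χ).fn r = φ.fn r + χ.fn r := rfl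

@[simp] lemma TestSpace.fn_smul (c : ℂ) (φ : TestSpace T M) (r : ℝ) :
    (c • φ).fn r = c • φ.fn r := rfl

lemma TestSpace.contDiff (φ : TestSpace T M) : ContDiff ℝ ∞ φ.fn := φ.2.1

lemma TestSpace.compact (φ : TestSpace T M) : HasCompactSupport φ.fn := φ.2.2.1

lemma TestSpace.tsupport_subset (φ : TestSpace T M) : tsupport φ.fn ⊆ M.interval := φ.2.2.2

lemma TestSpace.diff (φ : TestSpace T M) (r : ℝ) : DifferentiableAt ℝ φ.fn r :=
  (φ.contDiff.differentiable (by simp)) r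

lemma TestSpace.continuous_deriv (φ : TestSpace T M) : Continuous (deriv φ.fn) :=
  φ.contDiff.continuous_deriv (by simp)

lemma TestSpace.fn_zero_of (φ : TestSpace T M) {r : ℝ} (h : r ∉ tsupport φ.fn) : φ.fn r = 0 :=
  image_eq_zero_of_notMem_tsupport h

lemma TestSpace.deriv_zero_of (φ : TestSpace T M) {r : ℝ} (h : r ∉ tsupport φ.fn) :
    deriv φ.fn r = 0 := by
  by_contra hne
  exact h (support_deriv_subset hne)

lemma TestSpace.deriv_add (φ χ : TestSpace T M) (r : ℝ) :
    deriv (φ + χ).fn r = deriv φ.fn r + deriv χ.fn r :=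
  _root_.deriv_add (φ.diff r) (χ.diff r)

lemma TestSpace.deriv_smul (c : ℂ) (φ : TestSpace T M) (r : ℝ) :
    deriv (c • φ).fn r = c • deriv φ.fn r :=
  deriv_const_smul c (φ.diff r)

/-- A function that is continuous on `(0, ∞)` and vanishes outside of the support of a test
function is integrable. -/
lemma integrable_of_support {G : Type*} [NormedAddCommGroup G] (φ : TestSpace T M) (h : ℝ → G)
    (hc : ContinuousOn h (Ioi 0)) (h0 : ∀ r, r ∉ tsupport φ.fn → h r = 0) : Integrable h := by
  have h1 : IntegrableOn h (tsupport φ.fn) :=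
    (hc.mono (φ.tsupport_subset.trans M.interval_subset)).integrableOn_compact φ.compact
  refine (integrableOn_iff_integrable_of_support_subset ?_).mp h1
  intro r hr
  by_contra hne
  exact hr (h0 r hne)

/-- The density of the scalar product: `r ⟨φ', χ'⟩ - r⁻¹ ⟨T φ, χ⟩ [+ r³ ⟨φ, χ⟩]`. -/
def formDensity (φ χ : TestSpace T M) (r : ℝ) : ℂ :=
  (r : ℂ) * inner ℂ (deriv φ.fn r) (deriv χ.fn r)
    - ((r⁻¹ : ℝ) : ℂ) * inner ℂ (T.op (φ.fn r)) (χ.fn r)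
    + ((M.weight * r ^ 3 : ℝ) : ℂ) * inner ℂ (φ.fn r) (χ.fn r)

lemma integrable_formDensity (φ χ : TestSpace T M) : Integrable (formDensity φ χ) := by
  refine integrable_of_support φ _ ?_ ?_
  · have c1 := φ.continuous_deriv
    have c2 := χ.continuous_deriv
    have c3 : Continuous φ.fn := φ.contDiff.continuous
    have c4 : Continuous χ.fn := χ.contDiff.continuous
    have c5 : Continuous fun r => T.op (φ.fn r) := T.op.continuous.comp c3
    have c6 : ContinuousOn (fun r : ℝ => ((r⁻¹ : ℝ) : ℂ)) (Ioi 0) :=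
      Complex.continuous_ofReal.comp_continuousOn
        (continuousOn_inv₀.mono fun r hr => ne_of_gt hr)
    unfold formDensity
    refine ContinuousOn.add (ContinuousOn.sub ?_ (c6.mul ?_)) ?_
    · exact (Complex.continuous_ofReal.mul (c1.inner c2)).continuousOn
    · exact (c5.inner c4).continuousOn
    · exact ((Complex.continuous_ofReal.comp (by fun_prop)).mul (c3.inner c4)).continuousOn
  · intro r hr
    simp [formDensity, φ.fn_zero_of hr, φ.deriv_zero_of hr]

/-- The scalar product of `H_i(I_i)` on test functions (linear in the second entry). -/
abbrev testCore (T : AngularOp F) (M : Model) : PreInnerProductSpace.Core ℂ (TestSpace T M) where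
  inner φ χ := ∫ r in M.interval, formDensity φ χ r
  conj_inner_symm φ χ := by
    rw [← integral_conj]
    refine integral_congr_ae (Eventually.of_forall fun r => ?_)
    simp only [formDensity, map_add, map_sub, map_mul, Complex.conj_ofReal, inner_conj_symm]
    rw [T.symm]
  re_inner_nonneg φ := by
    rw [← integral_re (integrable_formDensity φ φ).integrableOn]
    refine setIntegral_nonneg M.measurableSet_interval fun r hr => ?_
    have hr0 : 0 < r := M.interval_subset hr
    simp only [formDensity, inner_self_eq_norm_sq_to_K, map_add, map_sub, RCLike.re_to_complex,
      Complex.re_ofReal_mul]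
    have e1 : (((‖deriv φ.fn r‖ : ℝ) : ℂ) ^ 2).re = ‖deriv φ.fn r‖ ^ 2 := by norm_cast
    have e2 : (((‖φ.fn r‖ : ℝ) : ℂ) ^ 2).re = ‖φ.fn r‖ ^ 2 := by norm_cast
    have e3 := mul_nonneg (inv_nonneg.mpr hr0.le) (neg_nonneg.mpr (T.nonpos (φ.fn r)))
    have e4 := M.weight_nonneg
    have e5 : 0 ≤ r * ‖deriv φ.fn r‖ ^ 2 := by positivity
    have e6 : 0 ≤ M.weight * r ^ 3 * ‖φ.fn r‖ ^ 2 := by positivity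
    erw [e1, e2]
    linarith
  add_left φ χ ξ := by
    rw [← integral_add (integrable_formDensity φ ξ).integrableOn
      (integrable_formDensity χ ξ).integrableOn]
    refine integral_congr_ae (Eventually.of_forall fun r => ?_)
    simp only [formDensity, TestSpace.fn_add, TestSpace.deriv_add, map_add, inner_add_left]
    ring
  smul_left φ χ c := by
    rw [← integral_const_mul]
    refine integral_congr_ae (Eventually.of_forall fun r => ?_)
    simp only [formDensity, TestSpace.fn_smul, TestSpace.deriv_smul, map_smul, inner_smul_left]
    ring

instance : SeminormedAddCommGroup (TestSpace T M) :=
  InnerProductSpace.Core.toSeminormedAddCommGroup (c := testCore T M)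
instance : InnerProductSpace ℂ (TestSpace T M) := InnerProductSpace.ofCore (testCore T M)

lemma TestSpace.inner_def (φ χ : TestSpace T M) :
    inner ℂ φ χ = ∫ r in M.interval, formDensity φ χ r := rfl

/-- The Hilbert space `H_i(I_i)`: the completion of `C_c^∞(I_i) ⊗ F`. -/
abbrev FormSpace (T : AngularOp F) (M : Model) := UniformSpace.Completion (TestSpace T M)

/-- The measure `r dr` on the interval. -/
def radialMeasure (M : Model) : Measure ℝ :=
  (volume.restrict M.interval).withDensity fun r => ENNReal.ofReal r

/-- The Hilbert space `H(I, 1) = L²(I, r dr) ⊗ F`, realized as the space of (classes of)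
`F`-valued square integrable functions. -/
abbrev WaveSpace (F : Type*) [NormedAddCommGroup F] [InnerProductSpace ℂ F] (M : Model) :=
  Lp F 2 (radialMeasure M)

lemma radialMeasure_eq (M : Model) : radialMeasure M
    = (volume.restrict M.interval).withDensity fun r => ((Real.toNNReal r : NNReal) : ENNReal) :=
  rfl

instance (M : Model) : IsFiniteMeasureOnCompacts (radialMeasure M) := by
  rw [radialMeasure_eq]
  have : IsLocallyFiniteMeasure ((volume.restrict M.interval).withDensity
      fun r => ((Real.toNNReal r : NNReal) : ENNReal)) :=
    IsLocallyFiniteMeasure.withDensity_coe continuous_real_toNNReal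
  infer_instance

lemma integral_radialMeasure {G : Type*} [NormedAddCommGroup G] [NormedSpace ℝ G] (M : Model)
    (f : ℝ → G) : ∫ r, f r ∂(radialMeasure M) = ∫ r in M.interval, r • f r := by
  rw [radialMeasure_eq, integral_withDensity_eq_integral_smul continuous_real_toNNReal.measurable]
  refine setIntegral_congr_fun M.measurableSet_interval fun r hr => ?_
  have hr0 : 0 < r := M.interval_subset hr
  simp [NNReal.smul_def, hr0.le]

lemma TestSpace.memLp (φ : TestSpace T M) : MemLp φ.fn 2 (radialMeasure M) :=
  φ.contDiff.continuous.memLp_of_hasCompactSupport φ.compact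

/-- The inclusion of the test functions into `H(I, 1)`. -/
def testIncl (T : AngularOp F) (M : Model) : TestSpace T M →ₗ[ℂ] WaveSpace F M where
  toFun φ := φ.memLp.toLp φ.fn
  map_add' _ _ := rfl
  map_smul' _ _ := rfl

lemma norm_sq_testIncl (φ : TestSpace T M) :
    ‖testIncl T M φ‖ ^ 2 = ∫ r in M.interval, r * ‖φ.fn r‖ ^ 2 := by
  have h1 : ‖testIncl T M φ‖ ^ 2 = ∫ r, ‖φ.fn r‖ ^ 2 ∂(radialMeasure M) := by
    have h := L2.inner_def (𝕜 := ℂ) (testIncl T M φ) (testIncl T M φ)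
    have h2 : ∫ r, inner ℂ (testIncl T M φ r) (testIncl T M φ r) ∂(radialMeasure M)
        = ∫ r, ((‖φ.fn r‖ ^ 2 : ℝ) : ℂ) ∂(radialMeasure M) := by
      refine integral_congr_ae ?_
      filter_upwards [φ.memLp.coeFn_toLp] with r hr
      have : testIncl T M φ r = φ.fn r := hr
      rw [this, inner_self_eq_norm_sq_to_K]
      norm_cast
    rw [h2, inner_self_eq_norm_sq_to_K] at h
    have h3 : ∫ r, ((‖φ.fn r‖ ^ 2 : ℝ) : ℂ) ∂(radialMeasure M)
        = ((∫ r, ‖φ.fn r‖ ^ 2 ∂(radialMeasure M) : ℝ) : ℂ) := integral_ofReal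
    rw [h3] at h
    refine Complex.ofReal_injective ?_
    rw [← h]
    norm_cast
  rw [h1, integral_radialMeasure]
  simp

lemma integrable_weight (φ : TestSpace T M) (w : ℝ → ℝ) (hw : Continuous w) :
    Integrable fun r => w r * ‖φ.fn r‖ ^ 2 := by
  refine integrable_of_support φ _ ?_ ?_
  · have := φ.contDiff.continuous
    exact (by fun_prop : Continuous fun r => w r * ‖φ.fn r‖ ^ 2).continuousOn
  · intro r hr
    simp [φ.fn_zero_of hr]

lemma integrable_deriv (φ : TestSpace T M) : Integrable fun r => r * ‖deriv φ.fn r‖ ^ 2 := by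
  refine integrable_of_support φ _ ?_ ?_
  · have := φ.continuous_deriv
    exact (by fun_prop : Continuous fun r => r * ‖deriv φ.fn r‖ ^ 2).continuousOn
  · intro r hr
    simp [φ.deriv_zero_of hr]

lemma norm_sq_ge (φ : TestSpace T M) :
    ∫ r in M.interval, (r * ‖deriv φ.fn r‖ ^ 2 + M.weight * r ^ 3 * ‖φ.fn r‖ ^ 2) ≤ ‖φ‖ ^ 2 := by
  have h : ‖φ‖ ^ 2 = ∫ r in M.interval, (formDensity φ φ r).re := by
    rw [← inner_self_eq_norm_sq (𝕜 := ℂ), TestSpace.inner_def,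
      ← integral_re (integrable_formDensity φ φ).integrableOn]
    rfl
  rw [h]
  refine setIntegral_mono_on ?_ ?_ M.measurableSet_interval fun r hr => ?_
  · refine ((integrable_deriv φ).add (integrable_weight φ _ ?_)).integrableOn
    fun_prop
  · exact (integrable_formDensity φ φ).re.integrableOn
  · have hr0 : 0 < r := M.interval_subset hr
    have e3 := mul_nonneg (inv_nonneg.mpr hr0.le) (neg_nonneg.mpr (T.nonpos (φ.fn r)))
    have e1 : (inner ℂ (deriv φ.fn r) (deriv φ.fn r) : ℂ).re = ‖deriv φ.fn r‖ ^ 2 := by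
      rw [inner_self_eq_norm_sq_to_K]; norm_cast
    have e2 : (inner ℂ (φ.fn r) (φ.fn r) : ℂ).re = ‖φ.fn r‖ ^ 2 := by
      rw [inner_self_eq_norm_sq_to_K]; norm_cast
    simp only [formDensity, Complex.add_re, Complex.sub_re, Complex.re_ofReal_mul, e1, e2]
    linarith

lemma integral_by_parts (φ : TestSpace T M) :
    ∫ r in M.interval, (r * ‖φ.fn r‖ ^ 2 + r ^ 2 * (inner ℂ (φ.fn r) (deriv φ.fn r)).re) = 0 := by
  rw [setIntegral_eq_integral_of_forall_compl_eq_zero]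
  · refine integral_eq_zero_of_hasDerivAt_of_integrable
      (f := fun r => r ^ 2 / 2 * ‖φ.fn r‖ ^ 2) ?_ ?_ (integrable_weight φ _ (by fun_prop))
    · intro r
      have h1 : HasDerivAt (fun r => inner ℂ (φ.fn r) (φ.fn r))
          (inner ℂ (φ.fn r) (deriv φ.fn r) + inner ℂ (deriv φ.fn r) (φ.fn r)) r :=
        (φ.diff r).hasDerivAt.inner ℂ (φ.diff r).hasDerivAt
      have h2 : HasDerivAt (fun r => ‖φ.fn r‖ ^ 2)
          (2 * (inner ℂ (φ.fn r) (deriv φ.fn r)).re) r := by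
        have h3 := Complex.reCLM.hasFDerivAt.comp_hasDerivAt r h1
        have h4 : (Complex.reCLM ∘ fun r => inner ℂ (φ.fn r) (φ.fn r))
            = fun r => ‖φ.fn r‖ ^ 2 := by
          funext r
          simp only [Function.comp_apply, Complex.reCLM_apply]
          rw [inner_self_eq_norm_sq_to_K]; norm_cast
        rw [h4] at h3
        have h5 : Complex.reCLM (inner ℂ (φ.fn r) (deriv φ.fn r) + inner ℂ (deriv φ.fn r) (φ.fn r))
            = 2 * (inner ℂ (φ.fn r) (deriv φ.fn r)).re := by
          rw [Complex.reCLM_apply, Complex.add_re, ← inner_conj_symm (deriv φ.fn r) (φ.fn r),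
            Complex.conj_re]
          ring
        rw [h5] at h3
        exact h3
      have h5 : HasDerivAt (fun r : ℝ => r ^ 2 / 2) r r := by
        have := (hasDerivAt_pow 2 r).div_const 2
        have e : ((2 : ℕ) : ℝ) * r ^ (2 - 1) / 2 = r := by norm_num
        rwa [e] at this
      have h6 := h5.mul h2
      have e : r * ‖φ.fn r‖ ^ 2 + r ^ 2 / 2 * (2 * (inner ℂ (φ.fn r) (deriv φ.fn r)).re)
          = r * ‖φ.fn r‖ ^ 2 + r ^ 2 * (inner ℂ (φ.fn r) (deriv φ.fn r)).re := by ring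
      rw [e] at h6
      exact h6
    · refine (integrable_weight φ _ continuous_id).add (integrable_of_support φ _ ?_ ?_)
      · have c1 := φ.continuous_deriv
        have c2 := φ.contDiff.continuous
        exact ((continuous_id.pow 2).mul
          (Complex.continuous_re.comp (c2.inner c1))).continuousOn
      · intro r hr
        simp [φ.fn_zero_of hr]
  · intro r hr
    have : φ.fn r = 0 := φ.fn_zero_of fun h => hr (φ.tsupport_subset h)
    simp [this]

lemma young_bound (M : Model) : ∃ K : ℝ, 0 ≤ K ∧ ∀ r ∈ M.interval, ∀ a b : ℝ, 0 ≤ a → 0 ≤ b →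
    r ^ 2 * (a * b) ≤ 1 / 2 * (r * a ^ 2) + K * (r * b ^ 2 + M.weight * r ^ 3 * a ^ 2) := by
  cases M with
  | bounded r₀ =>
    refine ⟨r₀ ^ 2 / 2, by positivity, ?_⟩
    rintro r ⟨h0, h1⟩ a b ha hb
    simp only [Model.weight]
    have h2 : r ^ 2 ≤ r₀ ^ 2 := by gcongr
    have h3 := mul_nonneg (mul_nonneg h0.le (sq_nonneg b)) (sub_nonneg.mpr h2)
    have h4 := mul_nonneg h0.le (sq_nonneg (a - r * b))
    nlinarith
  | unbounded =>
    refine ⟨1 / 2, by positivity, ?_⟩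
    intro r h0 a b ha hb
    have h0' : 0 < r := h0
    simp only [Model.weight]
    have h4 := mul_nonneg h0'.le (sq_nonneg (r * a - b))
    have h5 := mul_nonneg h0'.le (sq_nonneg a)
    nlinarith

lemma testIncl_bound (T : AngularOp F) (M : Model) :
    ∃ C : ℝ, ∀ φ : TestSpace T M, ‖testIncl T M φ‖ ≤ C * ‖φ‖ := by
  obtain ⟨K, hK, h⟩ := young_bound M
  refine ⟨Real.sqrt (2 * K), fun φ => ?_⟩
  have i1 : IntegrableOn (fun r => r * ‖φ.fn r‖ ^ 2) M.interval :=
    (integrable_weight φ _ continuous_id).integrableOn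
  have i2 : IntegrableOn (fun r => r * ‖deriv φ.fn r‖ ^ 2 + M.weight * r ^ 3 * ‖φ.fn r‖ ^ 2)
      M.interval :=
    ((integrable_deriv φ).add (integrable_weight φ _ (by fun_prop))).integrableOn
  have key : ∫ r in M.interval, (1 / 2 * (r * ‖φ.fn r‖ ^ 2)
      - K * (r * ‖deriv φ.fn r‖ ^ 2 + M.weight * r ^ 3 * ‖φ.fn r‖ ^ 2)) ≤ 0 := by
    rw [← integral_by_parts φ]
    refine setIntegral_mono_on ((i1.const_mul _).sub (i2.const_mul _)) ?_
      M.measurableSet_interval fun r hr => ?_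
    · refine i1.add (Integrable.integrableOn (integrable_of_support φ _ ?_ ?_))
      · have c1 := φ.continuous_deriv
        have c2 := φ.contDiff.continuous
        exact ((continuous_id.pow 2).mul
          (Complex.continuous_re.comp (c2.inner c1))).continuousOn
      · intro r hr
        simp [φ.fn_zero_of hr]
    · have h1 := h r hr ‖φ.fn r‖ ‖deriv φ.fn r‖ (norm_nonneg _) (norm_nonneg _)
      have h2 : -(‖φ.fn r‖ * ‖deriv φ.fn r‖) ≤ (inner ℂ (φ.fn r) (deriv φ.fn r)).re :=
        (abs_le.mp ((Complex.abs_re_le_norm _).trans (norm_inner_le_norm _ _))).1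
      have h3 := mul_le_mul_of_nonneg_left h2 (sq_nonneg r)
      linarith
  rw [integral_sub (i1.const_mul _) (i2.const_mul _), integral_const_mul, integral_const_mul,
    ← norm_sq_testIncl] at key
  have h1 := mul_le_mul_of_nonneg_left (norm_sq_ge φ) hK
  have h2 : ‖testIncl T M φ‖ ^ 2 ≤ (Real.sqrt (2 * K) * ‖φ‖) ^ 2 := by
    rw [mul_pow, Real.sq_sqrt (by positivity)]
    linarith
  exact le_of_sq_le_sq h2 (by positivity)

lemma uniformContinuous_testIncl (T : AngularOp F) (M : Model) :
    UniformContinuous (testIncl T M) := by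
  obtain ⟨C, hC⟩ := testIncl_bound T M
  exact ((testIncl T M).mkContinuous C hC).uniformContinuous

/-- The embedding of `H_i(I_i)` into `H(I_i, 1)`: the continuous extension of the inclusion of the
test functions. -/
def embed (T : AngularOp F) (M : Model) : FormSpace T M → WaveSpace F M :=
  UniformSpace.Completion.extension (testIncl T M)

lemma embed_coe (T : AngularOp F) (M : Model) (φ : TestSpace T M) :
    embed T M (φ : FormSpace T M) = testIncl T M φ :=
  UniformSpace.Completion.extension_coe (uniformContinuous_testIncl T M) φ

/-- The operator `-r⁻¹ (r φ')' - r⁻² T φ + q φ` on test functions. -/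
def hamiltonian (q : ℝ → ℝ) (φ : TestSpace T M) (r : ℝ) : F :=
  -(r⁻¹ • deriv (fun s => s • deriv φ.fn s) r) - (r ^ 2)⁻¹ • T.op (φ.fn r) + q r • φ.fn r

/-- `ψ ∈ H_i(I_i)` solves `H ψ = Λ w ψ` in the sense of distributions, `H` being the operator
`hamiltonian q`: `⟨H φ, ψ⟩ = Λ ⟨w φ, ψ⟩` in `H(I_i, 1)` for all test functions `φ`. -/
def IsEigenpair (q w : ℝ → ℝ) (Λ : ℝ) (ψ : FormSpace T M) : Prop :=
  ∀ φ : TestSpace T M,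
    ∫ r, inner ℂ (hamiltonian q φ r) (embed T M ψ r) ∂(radialMeasure M)
      = (Λ : ℂ) * ∫ r, inner ℂ (w r • φ.fn r) (embed T M ψ r) ∂(radialMeasure M)

end Radial

/-! ## The Hamiltonians -/

namespace Cosmo

open RiemGeom Radial

/-- The data of the model: the dimension `n ≥ 2` of space, the coupling constant `α_M > 0`, the
constant potential `V` and the curvature `κ` of the spatial cross-sections. -/
structure Params where
  n : ℕ
  two_le_n : 2 ≤ n
  αM : ℝ
  αM_pos : 0 < αM
  V : ℝ
  κ : ℝ

/-- `a_0 = 2 n (n - 1) / α_M`. -/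
def Params.a0 (P : Params) : ℝ := 2 * P.n * (P.n - 1) / P.αM

/-- `V̄ = α_M V / (n (n - 1))`. -/
def Params.Vbar (P : Params) : ℝ := P.αM / (P.n * (P.n - 1)) * P.V

/-- `μ̄ = (4 / n²) a_0 μ - (m - 1)² / 4`. -/
def Params.muBar (P : Params) (m : ℕ) (μ : ℝ) : ℝ :=
  4 / (P.n : ℝ) ^ 2 * P.a0 * μ - ((m : ℝ) - 1) ^ 2 / 4

lemma Params.a0_pos (P : Params) : 0 < P.a0 := by
  have h : (2 : ℝ) ≤ P.n := by exact_mod_cast P.two_le_n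
  have := P.αM_pos
  have h2 : 0 < (P.n : ℝ) - 1 := by linarith
  unfold Params.a0
  positivity

/-- `4 a_0 / n²`. -/
def Params.k (P : Params) : ℝ := 4 / (P.n : ℝ) ^ 2 * P.a0

lemma Params.k_pos (P : Params) : 0 < P.k := by
  have h : (2 : ℝ) ≤ P.n := by exact_mod_cast P.two_le_n
  have := P.a0_pos
  unfold Params.k
  positivity

/-- The numbers `μ ≥ 0` with `μ̄ ≤ 0` (the eigenvalues of `-Δ` are nonnegative). -/
abbrev LowEig (P : Params) (m : ℕ) := {μ : ℝ // 0 ≤ μ ∧ P.muBar m μ ≤ 0}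

variable {m : ℕ} {S : Type*} [TopologicalSpace S] [ChartedSpace (EuclideanSpace ℝ (Fin m)) S]
  [IsManifold (𝓡 m) ∞ S] [MeasurableSpace S]

/-- The subspace `H_0 ⊂ L²(S, ℂ)` that is spanned by the eigenspaces `E_μ` of `-Δ` with
`μ̄ ≤ 0`. -/
abbrev H0 (P : Params) (g : Metric m S) : Submodule ℂ (L2 g) :=
  ⨆ μ : LowEig P m, eigenspace g μ.1

lemma ortho (P : Params) (g : Metric m S) (μ ν : LowEig P m) (h : μ ≠ ν) :
    eigenspace g μ.1 ⟂ eigenspace g ν.1 :=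
  Submodule.isOrtho_iff_inner_eq.mpr fun _ hη _ hζ =>
    eigenspace_ortho g (fun e => h (Subtype.ext e)) hη hζ

lemma LowEig.le {P : Params} {m : ℕ} (μ : LowEig P m) :
    μ.1 ≤ ((m : ℝ) - 1) ^ 2 / 4 / P.k := by
  rw [le_div_iff₀ P.k_pos]
  have := μ.2.2
  unfold Params.muBar at this
  unfold Params.k
  linarith

/-- The operator `-Δ` on `H_0`: it is multiplication by `μ` on each `E_μ`. -/
def negLaplacian (P : Params) (g : Metric m S) : H0 P g →L[ℂ] H0 P g :=
  (SpectralOp.linOp (fun μ : LowEig P m => eigenspace g μ.1) (ortho P g) fun μ => μ.1).mkContinuous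
    (((m : ℝ) - 1) ^ 2 / 4 / P.k)
    (SpectralOp.linOp_bound _ _ _ _ (by have := P.k_pos; positivity)
      fun μ => by rw [abs_of_nonneg μ.2.1]; exact μ.le)

lemma negLaplacian_apply (P : Params) (g : Metric m S) (μ : LowEig P m) (η : H0 P g)
    (hη : (η : L2 g) ∈ eigenspace g μ.1) : negLaplacian P g η = (μ.1 : ℂ) • η :=
  SpectralOp.linOp_apply_mem (fun μ : LowEig P m => eigenspace g μ.1) (ortho P g) _ μ η hη

/-- The operator `-(4 / n²) a_0 Δ - (m - 1)² / 4` on `H_0`: it is multiplication by `μ̄ ≤ 0` on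
each `E_μ`. -/
def angularOp (P : Params) (g : Metric m S) : AngularOp (H0 P g) :=
  AngularOp.affine (negLaplacian P g) (4 / (P.n : ℝ) ^ 2 * P.a0) (((m : ℝ) - 1) ^ 2 / 4)
    (fun x y => SpectralOp.linOp_symm _ (ortho P g) _ x y)
    (fun x => by
      have h : (inner ℂ (negLaplacian P g x) x).re ≤ ((m : ℝ) - 1) ^ 2 / 4 / P.k * ‖x‖ ^ 2 :=
        SpectralOp.linOp_re_inner _ (ortho P g) _ _ (fun μ => μ.le) x
      have hk := P.k_pos
      have h2 := mul_le_mul_of_nonneg_left h hk.le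
      have h3 : P.k * (((m : ℝ) - 1) ^ 2 / 4 / P.k * ‖x‖ ^ 2)
          = ((m : ℝ) - 1) ^ 2 / 4 * ‖x‖ ^ 2 := by
        field_simp
      rw [h3] at h2
      exact h2)

/-- The potential of `H_1`: `-(16 / n²) V̄ r² + (16 / n²) κ r^(2(n-2)/n)`. -/
def Params.q1 (P : Params) (r : ℝ) : ℝ :=
  -(16 / (P.n : ℝ) ^ 2 * P.Vbar * r ^ 2)
    + 16 / (P.n : ℝ) ^ 2 * P.κ * r ^ (2 * ((P.n : ℝ) - 2) / P.n)

/-- The right-hand side of the first eigenvalue problem: `(16 / n²) r²`. -/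
def Params.w1 (P : Params) (r : ℝ) : ℝ := 16 / (P.n : ℝ) ^ 2 * r ^ 2

/-- The potential of `H_2`: `(16 / n²) r²`. -/
def Params.q2 (P : Params) (r : ℝ) : ℝ := 16 / (P.n : ℝ) ^ 2 * r ^ 2

/-- The right-hand side of the second eigenvalue problem: `-κ (16 / n²) r^(2(n-2)/n)`. -/
def Params.w2 (P : Params) (r : ℝ) : ℝ :=
  -P.κ * (16 / (P.n : ℝ) ^ 2) * r ^ (2 * ((P.n : ℝ) - 2) / P.n)

end Cosmo
end

/-!
Divided by the scalar product of `H_i(I_i)`, each eigenvalue problem becomes a pencil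
`S ψ = Λ K ψ` of bounded self-adjoint operators, where `K` represents the quadratic form of the
right-hand side. After a shift of `Λ` by a multiple of `K` the operator `S` is coercive (on `I₁`
because `∫ r ‖ψ‖²` interpolates between the norm and `∫ r³ ‖ψ‖²`), and `K` is injective, positive
and compact. Hence `S^(-1/2) K S^(-1/2)` is an injective positive compact operator, and the
inverses of its eigenvalues, in increasing order, are the `Λ_j`.

Compactness of `K` comes from the one-dimensional estimate
`∫ₓʸ r ‖ψ‖² ≤ 4 (y - x)² ∫ₓʸ r ‖ψ'‖² + (y² - x²) ‖ψ(y)‖²`: summed over a fine partition it makes the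
form of `K` small on the subspace of finite codimension where `ψ` vanishes at the partition points,
the tail on `I₂` being controlled by the term `r³ ‖ψ‖²`. This needs `dim H₀ < ∞`: by the Poincaré
inequality on small cubes of charts, `∫ ‖u‖² ≤ ε ∫ ‖∇u‖²` as soon as finitely many averages of `u`
vanish, whereas `∫ ‖∇u‖² ≤ C ∫ ‖u‖²` for the `u` in `H₀`; so with `ε < C⁻¹` these averages determine
`u`.
-/

noncomputable section

/-! ## Complete systems of eigenvectors -/

lemma nonempty_orderIso_nat {ι : Type*} [LinearOrder ι] [Infinite ι]
    (h : ∀ i : ι, (Iic i).Finite) : Nonempty (ι ≃o ℕ) := by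
  let _ : LocallyFiniteOrder ι :=
    LocallyFiniteOrder.ofFiniteIcc fun a b => (h b).subset fun _ hx => hx.2
  have _ : NoMaxOrder ι := ⟨fun a => by simpa using (h a).infinite_compl.nonempty⟩
  have _ : WellFoundedLT ι := WellFounded.wellFoundedLT_iff_exists_minimal.mpr fun s ⟨i, hi⟩ => by
    obtain ⟨j, hj, hmin⟩ := ((h i).inter_of_right s).exists_minimal ⟨i, hi, le_rfl⟩
    exact ⟨j, hj.1, fun k hk hkj => hmin ⟨hk, hkj.trans hj.2⟩ hkj⟩
  let _ : OrderBot ι := WellFoundedLT.toOrderBot ι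
  let _ : SuccOrder ι := LinearLocallyFiniteOrder.succOrder ι
  let _ : PredOrder ι := LinearLocallyFiniteOrder.predOrder ι
  exact ⟨orderIsoNatOfLinearSuccPredArch⟩

lemma exists_equiv_nat_monotone_comp {ι : Type*} [Infinite ι] {f : ι → ℝ}
    (hf : Tendsto f cofinite atTop) : ∃ e : ℕ ≃ ι, Monotone (f ∘ e) := by
  have hfin (c : ℝ) : {i | f i ≤ c}.Finite := by
    simpa [Filter.Eventually, mem_cofinite, compl_ofPred] using hf.eventually_gt_atTop c
  have hcover : (⋃ n : ℕ, {i | f i ≤ n}) = univ := by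
    ext i
    simpa using exists_nat_ge (f i)
  have _ : Countable ι :=
    countable_univ_iff.mp (hcover ▸ countable_iUnion fun n => (hfin n).countable)
  obtain ⟨g, hg⟩ := exists_injective_nat ι
  -- Ties between equal values of `f` are broken by an injection into `ℕ`.
  let _ : LinearOrder ι := LinearOrder.lift' (fun i => toLex (f i, g i)) fun i j h =>
    hg (congrArg (fun p => (ofLex p).2) h)
  have hmono : Monotone f := fun i j h => by
    rcases Prod.Lex.toLex_le_toLex.mp (show toLex (f i, g i) ≤ toLex (f j, g j) from h) with h | h
    exacts [h.le, h.1.le]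
  obtain ⟨e⟩ := nonempty_orderIso_nat fun j : ι => (hfin (f j)).subset fun i hi => hmono hi
  exact ⟨e.symm.toEquiv, hmono.comp e.symm.monotone⟩

/-- A sequence of linearly independent solutions `ψ j` of a linear eigenvalue problem, whose
eigenvalues `Λ j` increase to `∞`, which exhausts the solutions and spans a dense subspace. Here
`IsSol l v` says that `v` solves the problem with the eigenvalue `l`. -/
structure IsCompleteEigensystem (𝕜 : Type*) {V : Type*} [NormedField 𝕜] [AddCommGroup V]
    [Module 𝕜 V] [TopologicalSpace V] [ContinuousAdd V] [ContinuousSMul 𝕜 V]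
    (IsSol : ℝ → V → Prop) (Λ : ℕ → ℝ) (ψ : ℕ → V) : Prop where
  isSol : ∀ j, IsSol (Λ j) (ψ j)
  linearIndependent : LinearIndependent 𝕜 ψ
  mem_span : ∀ l χ, IsSol l χ → χ ∈ Submodule.span 𝕜 (ψ '' {j | Λ j = l})
  monotone : Monotone Λ
  tendsto : Tendsto Λ atTop atTop
  dense : (Submodule.span 𝕜 (range ψ)).topologicalClosure = ⊤

namespace IsCompleteEigensystem

variable {𝕜 V W : Type*} [NormedField 𝕜] [AddCommGroup V] [Module 𝕜 V] [TopologicalSpace V]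
  [ContinuousAdd V] [ContinuousSMul 𝕜 V] [AddCommGroup W] [Module 𝕜 W] [TopologicalSpace W]
  [ContinuousAdd W] [ContinuousSMul 𝕜 W] {P : ℝ → V → Prop} {Λ : ℕ → ℝ} {ψ : ℕ → V}

lemma map {Q : ℝ → W → Prop} (h : IsCompleteEigensystem 𝕜 P Λ ψ) (e : V ≃L[𝕜] W)
    (hPQ : ∀ l v, P l v ↔ Q l (e v)) : IsCompleteEigensystem 𝕜 Q Λ (e ∘ ψ) where
  isSol j := (hPQ _ _).mp (h.isSol j)
  linearIndependent := h.linearIndependent.map' e.toLinearMap e.toLinearEquiv.ker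
  mem_span l χ hχ := by
    have hmem := h.mem_span l (e.symm χ) ((hPQ _ _).mpr (by rwa [e.apply_symm_apply]))
    rw [image_comp]
    have := Submodule.mem_map_of_mem (f := e.toLinearMap) hmem
    rw [Submodule.map_span] at this
    simpa using this
  monotone := h.monotone
  tendsto := h.tendsto
  dense := by
    rw [range_comp]
    have := e.surjective.denseRange.topologicalClosure_map_submodule
      (f := (e : V →L[𝕜] W)) h.dense
    rwa [Submodule.map_span] at this

lemma congr_shift {Q : ℝ → V → Prop} (h : IsCompleteEigensystem 𝕜 P Λ ψ) (c : ℝ)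
    (hPQ : ∀ l v, Q l v ↔ P (l + c) v) : IsCompleteEigensystem 𝕜 Q (fun j => Λ j - c) ψ where
  isSol j := (hPQ _ _).mpr (by simpa using h.isSol j)
  linearIndependent := h.linearIndependent
  mem_span l χ hχ := by simpa only [sub_eq_iff_eq_add] using h.mem_span _ χ ((hPQ _ _).mp hχ)
  monotone _ _ hij := sub_le_sub_right (h.monotone hij) c
  tendsto := tendsto_atTop_add_const_right _ (-c) h.tendsto
  dense := h.dense

end IsCompleteEigensystem

/-! ## Compact operators and compact pencils -/

section Compact

variable {𝕜 V W : Type*} [RCLike 𝕜] [NormedAddCommGroup V] [InnerProductSpace 𝕜 V]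
  [NormedAddCommGroup W] [NormedSpace 𝕜 W]

lemma isCompactOperator_of_forall_small_on_finite_codim [CompleteSpace V] [CompleteSpace W]
    (J : V →L[𝕜] W)
    (h : ∀ ε > 0, ∃ U : Submodule 𝕜 V, IsClosed (U : Set V) ∧ FiniteDimensional 𝕜 (V ⧸ U) ∧
      ∀ v ∈ U, ‖J v‖ ≤ ε * ‖v‖) :
    IsCompactOperator J := by
  suffices J ∈ closure {f : V →L[𝕜] W | IsCompactOperator f} by
    rwa [isClosed_setOfPred_isCompactOperator.closure_eq] at this
  rw [Metric.mem_closure_iff]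
  intro ε hε
  obtain ⟨U, hUc, hUf, hU⟩ := h (ε / 2) (half_pos hε)
  have _ : CompleteSpace U := hUc.completeSpace_coe
  have _ : FiniteDimensional 𝕜 Uᗮ :=
    U.quotientEquivOrthogonal.toLinearEquiv.finiteDimensional
  have _ : ProperSpace Uᗮ := FiniteDimensional.proper 𝕜 _
  refine ⟨(J ∘L Uᗮ.subtypeL) ∘L Uᗮ.orthogonalProjectionOnto,
    (isCompactOperator_of_locallyCompactSpace_rng (J ∘L Uᗮ.subtypeL)).comp_clm _, ?_⟩
  rw [dist_eq_norm]
  refine (ContinuousLinearMap.opNorm_le_bound _ (by positivity) fun v => ?_).trans_lt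
    (half_lt_self hε)
  have hdiff : (J - (J ∘L Uᗮ.subtypeL) ∘L Uᗮ.orthogonalProjectionOnto) v
      = J (U.orthogonalProjectionOnto v) := by
    have hsplit := congrArg J (U.starProjection_add_starProjection_orthogonal v)
    rw [map_add] at hsplit
    exact sub_eq_iff_eq_add.mpr hsplit.symm
  rw [hdiff]
  exact (hU _ (Subtype.mem _)).trans
    (mul_le_mul_of_nonneg_left (U.norm_orthogonalProjectionOnto_apply_le v) (by positivity))

lemma infinite_of_dense_span_range {ι : Type*} {b : ι → W} (hW : ¬ FiniteDimensional 𝕜 W)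
    (hb : (Submodule.span 𝕜 (range b)).topologicalClosure = ⊤) : Infinite ι := by
  by_contra hfin
  have _ : Finite ι := not_infinite_iff_finite.mp hfin
  have _ := FiniteDimensional.span_of_finite 𝕜 (finite_range b)
  rw [(Submodule.closed_of_finiteDimensional _).submodule_topologicalClosure_eq] at hb
  exact hW (Module.finite_def.mpr (hb ▸ Submodule.fg_span (finite_range b)))

lemma tendsto_eigenvalue_cofinite_zero {ι : Type*} {T : V →L[𝕜] V} (hT : IsCompactOperator T)
    {b : ι → V} (hb : Orthonormal 𝕜 b) {μ : ι → 𝕜} (hμ : ∀ i, T (b i) = μ i • b i) :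
    Tendsto μ cofinite (𝓝 0) := by
  rw [tendsto_zero_iff_norm_tendsto_zero]
  have hdist {i j : ι} (hij : i ≠ j) : ‖μ i‖ ^ 2 ≤ dist (T (b i)) (T (b j)) ^ 2 := by
    rw [dist_eq_norm, hμ, hμ, @norm_sub_sq 𝕜, inner_smul_left, inner_smul_right, hb.2 hij]
    simp only [norm_smul, hb.1, mul_one, mul_zero, map_zero, sub_zero]
    exact le_add_of_nonneg_right (sq_nonneg _)
  refine tendsto_order.mpr ⟨fun a ha => .of_forall fun i => ha.trans_le (norm_nonneg _),
    fun ε hε => ?_⟩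
  -- Otherwise the orthogonal vectors `T (b i)` contain an `ε`-separated sequence in a compact set.
  by_contra hinf
  let s := Set.Infinite.natEmbedding {i | ¬ ‖μ i‖ < ε} hinf
  obtain ⟨a, -, φ, hφ, ha⟩ := (hT.isCompact_closure_image_closedBall 1).tendsto_subseq
    (x := fun n => T (b (s n))) fun n => subset_closure ⟨b (s n), by simp [hb.1], rfl⟩
  obtain ⟨N, hN⟩ := Metric.cauchySeq_iff'.mp ha.cauchySeq ε hε
  have hne : (s (φ (N + 1)) : ι) ≠ s (φ N) := fun h =>
    N.succ_ne_self (hφ.injective (s.injective (Subtype.ext h)))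
  have hlarge : ε ≤ ‖μ (s (φ (N + 1)))‖ := not_lt.mp (s (φ (N + 1))).2
  exact (hN (N + 1) N.le_succ).not_ge
    (hlarge.trans (le_of_pow_le_pow_left₀ two_ne_zero dist_nonneg (hdist hne)))

open Module.End in
lemma exists_orthonormal_eigenvectors [CompleteSpace V] {T : V →L[𝕜] V}
    (hT : T.IsSymmetric) (hTc : IsCompactOperator T) :
    ∃ (ι : Type) (b : ι → V) (μ : ι → ℝ), Orthonormal 𝕜 b ∧ (∀ i, μ i ≠ 0) ∧
      (∀ i, T (b i) = (μ i : 𝕜) • b i) ∧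
      ∀ ν : ℝ, ν ≠ 0 →
        eigenspace (T : Module.End 𝕜 V) (ν : 𝕜) ≤ Submodule.span 𝕜 (b '' {i | μ i = ν}) := by
  let E (ν : {ν : ℝ // ν ≠ 0}) : Submodule 𝕜 V :=
    eigenspace (T : Module.End 𝕜 V) ((ν : ℝ) : 𝕜)
  have hfin (ν) : FiniteDimensional 𝕜 (E ν) :=
    ContinuousLinearMap.finite_dimensional_eigenspace hTc _ (RCLike.ofReal_ne_zero.mpr ν.2)
  let β (ν) : OrthonormalBasis (Fin (Module.finrank 𝕜 (E ν))) 𝕜 (E ν) :=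
    stdOrthonormalBasis 𝕜 (E ν)
  have hE : OrthogonalFamily 𝕜 (fun ν => E ν) fun ν => (E ν).subtypeₗᵢ :=
    hT.orthogonalFamily_eigenspaces.comp (RCLike.ofReal_injective.comp Subtype.val_injective)
  refine ⟨Σ ν, Fin (Module.finrank 𝕜 (E ν)), fun i => β i.1 i.2, fun i => i.1,
    hE.orthonormal_sigma_orthonormal fun ν => (β ν).orthonormal, fun i => i.1.2,
    fun i => mem_eigenspace_iff.mp (β i.1 i.2).2, fun ν hν v hv => ?_⟩
  have hspan : (⟨v, hv⟩ : E ⟨ν, hν⟩) ∈ Submodule.span 𝕜 (range (β ⟨ν, hν⟩)) := by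
    rw [← OrthonormalBasis.coe_toBasis, (β ⟨ν, hν⟩).toBasis.span_eq]
    exact Submodule.mem_top
  have hmap := Submodule.mem_map_of_mem (f := (E ⟨ν, hν⟩).subtype) hspan
  rw [Submodule.map_span, ← range_comp] at hmap
  refine Submodule.span_mono ?_ hmap
  rintro _ ⟨k, rfl⟩
  exact ⟨⟨⟨ν, hν⟩, k⟩, rfl, rfl⟩

open Module.End in
lemma topologicalClosure_eq_top_of_eigenspace_le [CompleteSpace V] {T : V →L[𝕜] V}
    (hT : T.IsSymmetric) (hTc : IsCompactOperator T) (hTi : Function.Injective T)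
    {U : Submodule 𝕜 V}
    (hU : ∀ ν : ℝ, ν ≠ 0 → eigenspace (T : Module.End 𝕜 V) (ν : 𝕜) ≤ U) :
    U.topologicalClosure = ⊤ := by
  rw [Submodule.topologicalClosure_eq_top_iff, eq_bot_iff,
    ← ContinuousLinearMap.orthogonalComplement_iSup_eigenspaces_eq_bot hTc hT]
  refine Submodule.orthogonal_le (iSup_le fun μ v hv => ?_)
  rcases eq_or_ne v 0 with rfl | hv0
  · exact U.zero_mem
  have hTv : T v = μ • v := mem_eigenspace_iff.mp hv
  have hμ : ((RCLike.re μ : ℝ) : 𝕜) = μ := RCLike.conj_eq_iff_re.mp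
    (hT.conj_eigenvalue_eq_self (hasEigenvalue_of_hasEigenvector ⟨hv, hv0⟩))
  refine hU (RCLike.re μ) (fun h0 => hv0 (hTi ?_)) (hμ.symm ▸ hv)
  rw [hTv, ← hμ, h0, RCLike.ofReal_zero, zero_smul, map_zero]

lemma eigenvalue_nonneg_of_isPositive {T : V →L[𝕜] V} (hT : T.IsPositive) {μ : ℝ} {v : V}
    (hv : ‖v‖ = 1) (hTv : T v = (μ : 𝕜) • v) : 0 ≤ μ := by
  simpa [hTv, inner_smul_right, inner_self_eq_norm_sq_to_K, hv] using hT.re_inner_nonneg_right v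

theorem exists_isCompleteEigensystem_of_isPositive [CompleteSpace V]
    (hV : ¬ FiniteDimensional 𝕜 V) {T : V →L[𝕜] V} (hT : T.IsPositive)
    (hTc : IsCompactOperator T) (hTi : Function.Injective T) :
    ∃ (Λ : ℕ → ℝ) (ψ : ℕ → V),
      IsCompleteEigensystem 𝕜 (fun l v => v = (l : 𝕜) • T v) Λ ψ := by
  obtain ⟨ι, b, μ, hb, hμ, hTb, hspan⟩ := exists_orthonormal_eigenvectors hT.isSymmetric hTc
  have hdense : (Submodule.span 𝕜 (range b)).topologicalClosure = ⊤ :=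
    topologicalClosure_eq_top_of_eigenspace_le hT.isSymmetric hTc hTi fun ν hν =>
      (hspan ν hν).trans (Submodule.span_mono (image_subset_range _ _))
  have _ : Infinite ι := infinite_of_dense_span_range hV hdense
  have hpos (i) : 0 < μ i :=
    (eigenvalue_nonneg_of_isPositive hT (hb.1 i) (hTb i)).lt_of_ne' (hμ i)
  have hzero : Tendsto μ cofinite (𝓝 0) := by
    rw [tendsto_zero_iff_norm_tendsto_zero]
    simpa only [RCLike.norm_ofReal, Real.norm_eq_abs, norm_zero]
      using (tendsto_eigenvalue_cofinite_zero hTc hb hTb).norm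
  have hinv : Tendsto μ⁻¹ cofinite atTop :=
    (tendsto_nhdsWithin_iff.mpr ⟨hzero, .of_forall hpos⟩).inv_tendsto_nhdsGT_zero
  obtain ⟨e, he⟩ := exists_equiv_nat_monotone_comp hinv
  refine ⟨μ⁻¹ ∘ e, b ∘ e, fun j => ?_, hb.linearIndependent.comp e e.injective, fun l v hv => ?_,
    he, hinv.comp (Nat.cofinite_eq_atTop ▸ e.injective.tendsto_cofinite), ?_⟩
  · simp [hTb, smul_smul, hμ]
  · rcases eq_or_ne l 0 with rfl | hl
    · simp [show v = 0 by simpa using hv]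
    have hl' : (l : 𝕜) ≠ 0 := RCLike.ofReal_ne_zero.mpr hl
    have hmem := hspan l⁻¹ (inv_ne_zero hl) <| Module.End.mem_eigenspace_iff.mpr <| by
      rw [RCLike.ofReal_inv, ContinuousLinearMap.coe_coe, eq_inv_smul_iff₀ hl', ← hv]
    refine Submodule.span_mono ?_ hmem
    rintro _ ⟨i, hi, rfl⟩
    exact ⟨e.symm i, by simp [show μ i = l⁻¹ from hi], by simp⟩
  · rwa [range_comp, e.range_eq_univ, image_univ]

end Compact

section Pencil

variable {V : Type*} [NormedAddCommGroup V] [InnerProductSpace ℂ V] [CompleteSpace V]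

lemma isStrictlyPositive_of_coercive {S : V →L[ℂ] V} (hS : IsSelfAdjoint S) {c : ℝ} (hc : 0 < c)
    (hSc : ∀ v, c * ‖v‖ ^ 2 ≤ (inner ℂ (S v) v).re) : IsStrictlyPositive S := by
  have hle : algebraMap ℝ (V →L[ℂ] V) c ≤ S := by
    rw [ContinuousLinearMap.le_def, ContinuousLinearMap.isPositive_def]
    refine ⟨ContinuousLinearMap.isSelfAdjoint_iff_isSymmetric.mp
      (hS.sub (.algebraMap _ (.all c))), fun v => ?_⟩
    have hnorm : (inner ℂ v v).re = ‖v‖ ^ 2 := inner_self_eq_norm_sq (𝕜 := ℂ) v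
    have hsmul : algebraMap ℝ (V →L[ℂ] V) c v = (c : ℂ) • v := by
      simp [Algebra.algebraMap_eq_smul_one]
    rw [ContinuousLinearMap.reApplyInnerSelf_apply, sub_apply, hsmul, inner_sub_left,
      inner_smul_left, Complex.conj_ofReal, map_sub, RCLike.re_to_complex, RCLike.re_to_complex,
      Complex.re_ofReal_mul, hnorm]
    exact sub_nonneg.mpr (hSc v)
  refine .of_le (IsStrictlyPositive.iff_of_unital.mpr ⟨?_, (IsUnit.mk0 c hc.ne').map _⟩) hle
  rw [Algebra.algebraMap_eq_smul_one]
  exact smul_nonneg hc.le zero_le_one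

lemma exists_continuousLinearEquiv_isSelfAdjoint_comp_self {S : V →L[ℂ] V}
    (hS : IsStrictlyPositive S) :
    ∃ e : V ≃L[ℂ] V, IsSelfAdjoint (e.symm : V →L[ℂ] V) ∧ ∀ v, e (e v) = S v := by
  obtain ⟨u, hu⟩ := hS.isUnit_cfcSqrt
  have hsa : star u = u := Units.ext (by
    rw [Units.coe_star, hu]
    exact (CFC.sqrt_nonneg S).isSelfAdjoint)
  refine ⟨.unitsEquiv ℂ V u, ?_, fun v => ?_⟩
  · exact congrArg Units.val (show star u⁻¹ = u⁻¹ by rw [star_inv, hsa])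
  · exact congrArg (fun A : V →L[ℂ] V => A v) (hu ▸ CFC.sqrt_mul_sqrt_self S hS.nonneg)

/- With `R = S ^ (-1/2)`, the problem `S v = Λ K v` becomes `w = Λ R K R w` for `v = R w`. -/
theorem exists_isCompleteEigensystem_pencil (hV : ¬ FiniteDimensional ℂ V) {S K : V →L[ℂ] V}
    (hS : IsStrictlyPositive S) (hK : K.IsPositive) (hKc : IsCompactOperator K)
    (hKi : Function.Injective K) :
    ∃ (Λ : ℕ → ℝ) (ψ : ℕ → V),
      IsCompleteEigensystem ℂ (fun l v => S v = (l : ℂ) • K v) Λ ψ := by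
  obtain ⟨e, hsa, hee⟩ := exists_continuousLinearEquiv_isSelfAdjoint_comp_self hS
  let R : V →L[ℂ] V := e.symm
  have hpos : (R ∘L K ∘L R).IsPositive := by
    have := hK.conj_adjoint R
    rwa [ContinuousLinearMap.isSelfAdjoint_iff'.mp hsa] at this
  obtain ⟨Λ, b, hb⟩ := exists_isCompleteEigensystem_of_isPositive hV hpos
    ((hKc.comp_clm R).clm_comp R) (e.symm.injective.comp (hKi.comp e.symm.injective))
  refine ⟨Λ, e.symm ∘ b, hb.map e.symm fun l v => ?_⟩
  rw [← hee, e.apply_symm_apply, ← e.eq_symm_apply, map_smul]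
  rfl

end Pencil

/-! ## The metric and the gradient in charts -/

section SesqForm

open Matrix

variable {n : Type*} [Fintype n]

/-- The sesquilinear form `∑ N i j * p i * conj (q j)` on `ℂⁿ` of a real matrix `N`. -/
def sesqForm (N : Matrix n n ℝ) (p q : n → ℂ) : ℂ := p ⬝ᵥ N.map Complex.ofReal *ᵥ star q

lemma sesqForm_eq_sum (N : Matrix n n ℝ) (p q : n → ℂ) :
    sesqForm N p q = ∑ i, ∑ j, (N i j : ℂ) * p i * conj (q j) := by
  simp only [sesqForm, dotProduct, mulVec, map_apply, Finset.mul_sum]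
  exact Finset.sum_congr rfl fun i _ => Finset.sum_congr rfl fun j _ => mul_left_comm .. |>.trans
    (mul_assoc ..).symm

lemma sesqForm_vecMul (N J : Matrix n n ℝ) (p q : n → ℂ) :
    sesqForm N (p ᵥ* J.map Complex.ofReal) (q ᵥ* J.map Complex.ofReal)
      = sesqForm (J * N * Jᵀ) p q := by
  have hstar : (J.map Complex.ofReal)ᴴ = Jᵀ.map Complex.ofReal := by
    ext i j
    simp
  have hmap (A B : Matrix n n ℝ) : (A * B).map Complex.ofReal
      = A.map Complex.ofReal * B.map Complex.ofReal := Matrix.map_mul (f := Complex.ofRealHom)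
  rw [sesqForm, sesqForm, star_vecMul, hstar, hmap, hmap, ← dotProduct_mulVec, mulVec_mulVec,
    mulVec_mulVec, Matrix.mul_assoc]

lemma re_sesqForm_self (N : Matrix n n ℝ) (p : n → ℂ) :
    (sesqForm N p p).re = (fun i => (p i).re) ⬝ᵥ N *ᵥ (fun i => (p i).re)
      + (fun i => (p i).im) ⬝ᵥ N *ᵥ fun i => (p i).im := by
  simp only [sesqForm_eq_sum, Complex.re_sum, dotProduct, mulVec, Finset.mul_sum,
    ← Finset.sum_add_distrib]
  refine Finset.sum_congr rfl fun i _ => Finset.sum_congr rfl fun k _ => ?_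
  simp
  ring

lemma re_sesqForm_self_nonneg {N : Matrix n n ℝ} (hN : N.PosSemidef) (p : n → ℂ) :
    0 ≤ (sesqForm N p p).re := by
  rw [re_sesqForm_self]
  exact add_nonneg (hN.dotProduct_mulVec_nonneg _) (hN.dotProduct_mulVec_nonneg _)

lemma continuousOn_sesqForm {X : Type*} [TopologicalSpace X] {s : Set X} {N : X → Matrix n n ℝ}
    {p q : X → n → ℂ} (hN : ContinuousOn N s) (hp : ContinuousOn p s) (hq : ContinuousOn q s) :
    ContinuousOn (fun x => sesqForm (N x) (p x) (q x)) s := by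
  rw [continuousOn_iff_continuous_domRestrict] at *
  exact hp.dotProduct ((hN.matrix_map Complex.continuous_ofReal).matrix_mulVec hq.star)

variable [DecidableEq n]

lemma sq_apply_le_dotProduct_inv_mulVec_mul_apply {G : Matrix n n ℝ} (hG : G.PosDef)
    (a : n → ℝ) (j : n) : a j ^ 2 ≤ a ⬝ᵥ G⁻¹ *ᵥ a * G j j := by
  have hinv : G⁻¹ *ᵥ (G *ᵥ Pi.single j 1) = Pi.single j 1 := by
    rw [mulVec_mulVec, nonsing_inv_mul _ hG.det_pos.ne'.isUnit, one_mulVec]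
  have hsymm : (G⁻¹)ᵀ = G⁻¹ := by
    simpa only [conjTranspose_eq_transpose_of_trivial] using hG.inv.isHermitian.eq
  have hcs := LinearMap.BilinForm.apply_mul_apply_le_of_forall_zero_le (toBilin' G⁻¹)
    (fun v => by simpa [toBilin'_apply'] using hG.inv.posSemidef.dotProduct_mulVec_nonneg v)
    a (G *ᵥ Pi.single j 1)
  have hleft : (G *ᵥ Pi.single j 1) ⬝ᵥ G⁻¹ *ᵥ a = a j := by
    rw [dotProduct_mulVec, ← mulVec_transpose, hsymm, hinv, single_one_dotProduct]
  have hdiag : (G *ᵥ Pi.single j 1) ⬝ᵥ Pi.single j 1 = G j j := by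
    rw [dotProduct_single_one, mulVec_single_one, col_apply]
  rwa [toBilin'_apply', toBilin'_apply', toBilin'_apply', toBilin'_apply', hinv, hleft, hdiag,
    dotProduct_single_one, ← sq] at hcs

lemma norm_sq_apply_le_re_sesqForm_inv_mul_apply {G : Matrix n n ℝ} (hG : G.PosDef) (p : n → ℂ)
    (j : n) : ‖p j‖ ^ 2 ≤ (sesqForm G⁻¹ p p).re * G j j := by
  rw [re_sesqForm_self, add_mul, ← Complex.normSq_eq_norm_sq, Complex.normSq_apply, ← sq, ← sq]
  exact add_le_add (sq_apply_le_dotProduct_inv_mulVec_mul_apply hG (fun i => (p i).re) j)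
    (sq_apply_le_dotProduct_inv_mulVec_mul_apply hG (fun i => (p i).im) j)

lemma mul_inv_transpose_mul_mul_mul_transpose {J : Matrix n n ℝ} (hJ : IsUnit J.det)
    (G : Matrix n n ℝ) : J * (Jᵀ * G * J)⁻¹ * Jᵀ = G⁻¹ := by
  rw [Matrix.mul_inv_rev, Matrix.mul_inv_rev, ← Matrix.mul_assoc, ← Matrix.mul_assoc,
    mul_nonsing_inv _ hJ, Matrix.one_mul, Matrix.mul_assoc,
    nonsing_inv_mul _ (by rwa [det_transpose]), Matrix.mul_one]

end SesqForm

namespace RiemGeom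

variable {m : ℕ} {S : Type*} [TopologicalSpace S] [ChartedSpace (EuclideanSpace ℝ (Fin m)) S]

lemma contMDiff_const_smul {f : S → ℂ} (hf : ContMDiff (𝓡 m) 𝓘(ℝ, ℂ) ∞ f) (c : ℂ) :
    ContMDiff (𝓡 m) 𝓘(ℝ, ℂ) ∞ (c • f) :=
  (ContinuousLinearMap.mul ℝ ℂ c).contMDiff.comp hf

/-- The model space `ℝ^m` of the charts. -/
abbrev Coord (m : ℕ) := EuclideanSpace ℝ (Fin m)

/-- The standard basis of the model space. -/
abbrev stdBasis (m : ℕ) : Module.Basis (Fin m) ℝ (Coord m) :=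
  (EuclideanSpace.basisFun (Fin m) ℝ).toBasis

lemma stdBasis_apply (i : Fin m) : stdBasis m i = basisVec m i := by
  simp [stdBasis, basisVec]

lemma partialDeriv_add {f f' : S → ℂ} {y : S} (hf : MDifferentiableAt (𝓡 m) 𝓘(ℝ, ℂ) f y)
    (hf' : MDifferentiableAt (𝓡 m) 𝓘(ℝ, ℂ) f' y) :
    partialDeriv (f + f') y = partialDeriv (m := m) f y + partialDeriv f' y :=
  funext fun i => congrArg (fun L => L (basisVec m i)) (mfderiv_add hf hf')

lemma partialDeriv_smul {f : S → ℂ} {y : S} (hf : MDifferentiableAt (𝓡 m) 𝓘(ℝ, ℂ) f y) (c : ℂ) :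
    partialDeriv (c • f) y = c • partialDeriv (m := m) f y :=
  funext fun i => congrArg (fun L => L (basisVec m i))
    ((ContinuousLinearMap.mul ℝ ℂ c).hasMFDerivAt.comp y hf.hasMFDerivAt).mfderiv

lemma partialDeriv_const (c : ℂ) (y : S) : partialDeriv (m := m) (fun _ : S => c) y = 0 :=
  funext fun i => by rw [partialDeriv, mfderiv_const]; rfl

/-- The differential of the inverse of the chart around `x`. -/
def chartDeriv (x : S) (z : Coord m) : Coord m →L[ℝ] Coord m :=
  mfderiv (𝓡 m) (𝓡 m) (chartAt (Coord m) x).symm z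

/-- The matrix of the differential of the inverse of the chart. -/
def chartJac (x : S) (z : Coord m) : Matrix (Fin m) (Fin m) ℝ :=
  LinearMap.toMatrix (stdBasis m) (stdBasis m) (chartDeriv x z : Coord m →ₗ[ℝ] Coord m)

lemma chartDeriv_basisVec (x : S) (z : Coord m) (i : Fin m) :
    chartDeriv x z (basisVec m i) = ∑ k, chartJac x z k i • basisVec m k := by
  rw [← (stdBasis m).sum_repr (chartDeriv x z (basisVec m i))]
  simp only [chartJac, LinearMap.toMatrix_apply, stdBasis_apply, ContinuousLinearMap.coe_coe]

/-- The partial derivatives of a function in the chart around `x`. -/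
def chartPartial (f : S → ℂ) (x : S) (z : Coord m) (i : Fin m) : ℂ :=
  fderiv ℝ (f ∘ (chartAt (Coord m) x).symm) z (basisVec m i)

variable [IsManifold (𝓡 m) ∞ S]

lemma gradInner_eq_sesqForm (g : Metric m S) (f h : S → ℂ) (y : S) :
    gradInner g f h y = sesqForm (gram g y)⁻¹ (partialDeriv f y) (partialDeriv h y) :=
  (sesqForm_eq_sum ..).symm

lemma gradInner_add_left (g : Metric m S) {f f' : S → ℂ} (h : S → ℂ) {y : S}
    (hf : MDifferentiableAt (𝓡 m) 𝓘(ℝ, ℂ) f y) (hf' : MDifferentiableAt (𝓡 m) 𝓘(ℝ, ℂ) f' y) :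
    gradInner g (f + f') h y = gradInner g f h y + gradInner g f' h y := by
  simp only [gradInner_eq_sesqForm, partialDeriv_add hf hf', sesqForm, add_dotProduct]

lemma gradInner_smul_left (g : Metric m S) {f : S → ℂ} (h : S → ℂ) {y : S}
    (hf : MDifferentiableAt (𝓡 m) 𝓘(ℝ, ℂ) f y) (c : ℂ) :
    gradInner g (c • f) h y = c * gradInner g f h y := by
  simp only [gradInner_eq_sesqForm, partialDeriv_smul hf, sesqForm, smul_dotProduct, smul_eq_mul]

lemma gradInner_const_left (g : Metric m S) (c : ℂ) (h : S → ℂ) (y : S) :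
    gradInner g (fun _ => c) h y = 0 := by
  rw [gradInner_eq_sesqForm, partialDeriv_const, sesqForm, zero_dotProduct]

/-- The metric at `y` as a bilinear form on `ℝ^m`. -/
def metricForm (g : Metric m S) (y : S) : LinearMap.BilinForm ℝ (Coord m) :=
  LinearMap.mk₂ ℝ (fun v w : Coord m => g.inner y (show TangentSpace (𝓡 m) y from v)
      (show TangentSpace (𝓡 m) y from w))
    (fun u v w => congrArg (fun L => L w) ((g.inner y).map_add u v))
    (fun c v w => congrArg (fun L => L w) ((g.inner y).map_smul c v))
    (fun u v w => (g.inner y u).map_add v w)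
    (fun c v w => (g.inner y v).map_smul c w)

lemma gram_eq_toMatrix (g : Metric m S) (y : S) :
    gram g y = LinearMap.BilinForm.toMatrix (stdBasis m) (metricForm g y) := by
  ext i j
  rw [LinearMap.BilinForm.toMatrix_apply, stdBasis_apply, stdBasis_apply]
  rfl

lemma mdifferentiableAt_chartAt_symm (x : S) {z : Coord m}
    (hz : z ∈ (chartAt (Coord m) x).target) :
    MDifferentiableAt (𝓡 m) (𝓡 m) (chartAt (Coord m) x).symm z :=
  (mdifferentiable_chart (I := 𝓡 m) x).mdifferentiableAt_symm hz

lemma chartDeriv_injective (x : S) {z : Coord m} (hz : z ∈ (chartAt (Coord m) x).target) :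
    Function.Injective (chartDeriv x z) :=
  (mdifferentiable_chart (I := 𝓡 m) x).symm.mfderiv_injective hz

lemma isUnit_det_chartJac (x : S) {z : Coord m} (hz : z ∈ (chartAt (Coord m) x).target) :
    IsUnit (chartJac x z).det := by
  rw [chartJac, LinearMap.det_toMatrix]
  exact LinearMap.isUnit_iff_isUnit_det _ |>.mp <|
    (LinearMap.isUnit_iff_ker_eq_bot _).mpr (LinearMap.ker_eq_bot.mpr (chartDeriv_injective x hz))

lemma chartGram_eq_toMatrix (g : Metric m S) (x : S) (z : Coord m) :
    chartGram g x z = LinearMap.BilinForm.toMatrix (stdBasis m)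
      ((metricForm g ((chartAt (Coord m) x).symm z)).comp (chartDeriv x z : Coord m →ₗ[ℝ] Coord m)
        (chartDeriv x z : Coord m →ₗ[ℝ] Coord m)) := by
  ext i j
  rw [LinearMap.BilinForm.toMatrix_apply, stdBasis_apply, stdBasis_apply]
  rfl

lemma chartGram_eq_transpose_mul_gram_mul (g : Metric m S) (x : S) (z : Coord m) :
    chartGram g x z
      = (chartJac x z).transpose * gram g ((chartAt (Coord m) x).symm z) * chartJac x z := by
  rw [chartGram_eq_toMatrix, LinearMap.BilinForm.toMatrix_comp (stdBasis m) (stdBasis m),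
    gram_eq_toMatrix]
  rfl

lemma posDef_gram (g : Metric m S) (y : S) : (gram g y).PosDef := by
  rw [gram_eq_toMatrix,
    ← LinearMap.BilinForm.posDef_toQuadraticMap_iff_matrix (hB_symm := ⟨g.symm y⟩)]
  exact fun v hv => g.pos y v hv

lemma posDef_chartGram (g : Metric m S) (x : S) {z : Coord m}
    (hz : z ∈ (chartAt (Coord m) x).target) : (chartGram g x z).PosDef := by
  rw [chartGram_eq_transpose_mul_gram_mul]
  exact (posDef_gram g _).conjTranspose_mul_mul_same
    (Matrix.mulVec_injective_of_isUnit ((Matrix.isUnit_iff_isUnit_det _).mpr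
      (isUnit_det_chartJac x hz)))

lemma re_gradInner_self_nonneg (g : Metric m S) (f : S → ℂ) (y : S) :
    0 ≤ (gradInner g f f y).re :=
  gradInner_eq_sesqForm g f f y ▸ re_sesqForm_self_nonneg (posDef_gram g y).inv.posSemidef _

lemma chartPartial_eq_vecMul {f : S → ℂ} (x : S) {z : Coord m}
    (hz : z ∈ (chartAt (Coord m) x).target)
    (hf : MDifferentiableAt (𝓡 m) 𝓘(ℝ, ℂ) f ((chartAt (Coord m) x).symm z)) :
    chartPartial f x z = Matrix.vecMul (partialDeriv f ((chartAt (Coord m) x).symm z))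
      ((chartJac x z).map Complex.ofReal) := by
  let L : Coord m →L[ℝ] ℂ := mfderiv (𝓡 m) 𝓘(ℝ, ℂ) f ((chartAt (Coord m) x).symm z)
  have hchain : fderiv ℝ (f ∘ (chartAt (Coord m) x).symm) z = L ∘L chartDeriv x z :=
    mfderiv_eq_fderiv.symm.trans (mfderiv_comp z hf (mdifferentiableAt_chartAt_symm x hz))
  funext i
  rw [chartPartial, hchain, ContinuousLinearMap.comp_apply, chartDeriv_basisVec, map_sum]
  refine Finset.sum_congr rfl fun k _ => ?_
  rw [map_smul, Complex.real_smul, mul_comm]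
  rfl

lemma gradInner_chart (g : Metric m S) {f h : S → ℂ} (x : S) {z : Coord m}
    (hz : z ∈ (chartAt (Coord m) x).target)
    (hf : MDifferentiableAt (𝓡 m) 𝓘(ℝ, ℂ) f ((chartAt (Coord m) x).symm z))
    (hh : MDifferentiableAt (𝓡 m) 𝓘(ℝ, ℂ) h ((chartAt (Coord m) x).symm z)) :
    gradInner g f h ((chartAt (Coord m) x).symm z)
      = sesqForm (chartGram g x z)⁻¹ (chartPartial f x z) (chartPartial h x z) := by
  rw [chartPartial_eq_vecMul x hz hf, chartPartial_eq_vecMul x hz hh, sesqForm_vecMul,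
    chartGram_eq_transpose_mul_gram_mul,
    mul_inv_transpose_mul_mul_mul_transpose (isUnit_det_chartJac x hz), gradInner_eq_sesqForm]

lemma norm_sq_chartPartial_le (g : Metric m S) {f : S → ℂ} (x : S) {z : Coord m}
    (hz : z ∈ (chartAt (Coord m) x).target)
    (hf : MDifferentiableAt (𝓡 m) 𝓘(ℝ, ℂ) f ((chartAt (Coord m) x).symm z)) (j : Fin m) :
    ‖chartPartial f x z j‖ ^ 2
      ≤ (gradInner g f f ((chartAt (Coord m) x).symm z)).re * chartGram g x z j j := by
  rw [gradInner_chart g x hz hf hf]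
  exact norm_sq_apply_le_re_sesqForm_inv_mul_apply (posDef_chartGram g x hz) _ j

lemma contMDiffOn_chartDeriv (x : S) (v : Coord m) :
    ContMDiffOn (𝓡 m) (𝓡 m).tangent 0
      (fun z : Coord m => (⟨(chartAt (Coord m) x).symm z, chartDeriv x z v⟩ :
        TangentBundle (𝓡 m) S)) (chartAt (Coord m) x).target := by
  have hopen : IsOpen (chartAt (Coord m) x).target := (chartAt (Coord m) x).open_target
  have hconst : ContMDiff (𝓡 m) (𝓡 m).tangent 0
      (fun z : Coord m => (⟨z, v⟩ : TangentBundle (𝓡 m) (Coord m))) := fun z =>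
    contMDiffAt_vectorSpace_iff_contDiffAt.mpr contDiffAt_const
  have htangent :=
    (contMDiffOn_chart_symm (I := 𝓡 m) (x := x) (n := ∞)).contMDiffOn_tangentMapWithin (m := 0)
      (by simp) hopen.uniqueMDiffOn
  refine (htangent.comp hconst.contMDiffOn (s := (chartAt (Coord m) x).target)
    fun z hz => hz).congr fun z hz => ?_
  simp only [Function.comp_apply, tangentMapWithin]
  rw [mfderivWithin_of_isOpen hopen hz]
  rfl

lemma continuousOn_chartGram (g : Metric m S) (x : S) :
    ContinuousOn (chartGram g x) (chartAt (Coord m) x).target := by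
  refine continuousOn_pi.mpr fun i => continuousOn_pi.mpr fun j => ?_
  have hbundle : ContMDiffOn (𝓡 m) ((𝓡 m).prod 𝓘(ℝ)) 0
      (fun z : Coord m => Bundle.TotalSpace.mk' ℝ (E := Bundle.Trivial S ℝ)
        ((chartAt (Coord m) x).symm z) (g.inner ((chartAt (Coord m) x).symm z)
          (chartDeriv x z (basisVec m i)) (chartDeriv x z (basisVec m j))))
      (chartAt (Coord m) x).target := by
    refine ContMDiffOn.clm_bundle_apply₂ (F₁ := Coord m) (F₂ := Coord m) ?_
      (contMDiffOn_chartDeriv x _) (contMDiffOn_chartDeriv x _)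
    exact (g.contMDiff.of_le (by simp)).comp_contMDiffOn
      ((contMDiffOn_chart_symm (I := 𝓡 m) (n := ∞)).of_le (by simp))
  exact fun z hz =>
    ((Bundle.contMDiffWithinAt_totalSpace.mp (hbundle z hz)).2).continuousWithinAt

lemma continuousOn_det_chartGram (g : Metric m S) (x : S) :
    ContinuousOn (fun z => (chartGram g x z).det) (chartAt (Coord m) x).target :=
  (continuous_id.matrix_det).comp_continuousOn (continuousOn_chartGram g x)

lemma continuousOn_inv_chartGram (g : Metric m S) (x : S) :
    ContinuousOn (fun z => (chartGram g x z)⁻¹) (chartAt (Coord m) x).target := by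
  simp only [Matrix.inv_def, Ring.inverse_eq_inv']
  exact ((continuousOn_det_chartGram g x).inv₀ fun z hz =>
    (posDef_chartGram g x hz).det_pos.ne').smul
      (continuous_id.matrix_adjugate.comp_continuousOn (continuousOn_chartGram g x))

lemma contDiffOn_comp_chartAt_symm {f : S → ℂ} (hf : ContMDiff (𝓡 m) 𝓘(ℝ, ℂ) ∞ f) (x : S) :
    ContDiffOn ℝ ∞ (f ∘ (chartAt (Coord m) x).symm) (chartAt (Coord m) x).target :=
  contMDiffOn_iff_contDiffOn.mp
    (hf.comp_contMDiffOn (contMDiffOn_chart_symm (I := 𝓡 m) (n := ∞) (x := x)))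

lemma continuousOn_chartPartial {f : S → ℂ} (hf : ContMDiff (𝓡 m) 𝓘(ℝ, ℂ) ∞ f) (x : S) :
    ContinuousOn (chartPartial f x) (chartAt (Coord m) x).target :=
  continuousOn_pi.mpr fun _ => ((contDiffOn_comp_chartAt_symm hf x).continuousOn_fderiv_of_isOpen
    (chartAt (Coord m) x).open_target (by simp)).clm_apply continuousOn_const

lemma continuous_gradInner (g : Metric m S) {f h : S → ℂ} (hf : ContMDiff (𝓡 m) 𝓘(ℝ, ℂ) ∞ f)
    (hh : ContMDiff (𝓡 m) 𝓘(ℝ, ℂ) ∞ h) : Continuous (gradInner g f h) := by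
  rw [continuous_iff_continuousAt]
  intro x
  have hchart : ContinuousOn (fun z => sesqForm (chartGram g x z)⁻¹ (chartPartial f x z)
      (chartPartial h x z)) (chartAt (Coord m) x).target :=
    continuousOn_sesqForm (continuousOn_inv_chartGram g x) (continuousOn_chartPartial hf x)
      (continuousOn_chartPartial hh x)
  have hsource : ContinuousOn (gradInner g f h) (chartAt (Coord m) x).source := by
    refine (hchart.comp (chartAt (Coord m) x).continuousOn (chartAt (Coord m) x).mapsTo).congr
      fun y hy => ?_
    have hy' := gradInner_chart g x ((chartAt (Coord m) x).map_source hy)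
      ((hf _).mdifferentiableAt (by simp)) ((hh _).mdifferentiableAt (by simp))
    rwa [(chartAt (Coord m) x).left_inv hy] at hy'
  exact hsource.continuousAt ((chartAt (Coord m) x).open_source.mem_nhds (mem_chart_source _ x))

end RiemGeom

/-! ## The Riemannian volume -/

lemma exists_compact_chart_cover (H : Type*) [TopologicalSpace H] [LocallyCompactSpace H]
    (X : Type*) [TopologicalSpace X] [ChartedSpace H X] [CompactSpace X] :
    ∃ (t : Finset X) (K : X → Set X), (∀ y, IsCompact (K y)) ∧
      (∀ y, K y ⊆ (chartAt H y).source) ∧ ⋃ y ∈ t, K y = univ := by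
  have _ : LocallyCompactSpace X := ChartedSpace.locallyCompactSpace H X
  choose K hK hmem hsub using fun y : X =>
    exists_compact_subset (chartAt H y).open_source (mem_chart_source H y)
  obtain ⟨t, ht⟩ := CompactSpace.elim_nhds_subcover (fun y => interior (K y))
    fun y => isOpen_interior.mem_nhds (hmem y)
  exact ⟨t, K, hK, hsub, eq_univ_of_univ_subset
    (ht.ge.trans (iUnion₂_mono fun _ _ => interior_subset))⟩

lemma measurableSet_source_inter_preimage {X Y : Type*} [TopologicalSpace X] [MeasurableSpace X]
    [OpensMeasurableSpace X] [TopologicalSpace Y] [MeasurableSpace Y] [BorelSpace Y]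
    (e : OpenPartialHomeomorph X Y) {A : Set Y} (hA : MeasurableSet A) :
    MeasurableSet (e.source ∩ e ⁻¹' A) := by
  have hrestrict := e.open_source.measurableSet.subtype_image
    ((continuousOn_iff_continuous_domRestrict.mp e.continuousOn).measurable hA)
  rwa [domRestrict_eq, preimage_comp, Subtype.image_preimage_coe] at hrestrict

namespace RiemGeom

variable {m : ℕ} {S : Type*} [TopologicalSpace S] [ChartedSpace (EuclideanSpace ℝ (Fin m)) S]
  [IsManifold (𝓡 m) ∞ S]

lemma det_chartGram (g : Metric m S) (x : S) (z : Coord m) :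
    (chartGram g x z).det
      = (chartDeriv x z).det ^ 2 * (gram g ((chartAt (Coord m) x).symm z)).det := by
  rw [chartGram_eq_transpose_mul_gram_mul, Matrix.det_mul, Matrix.det_mul, Matrix.det_transpose,
    chartJac, LinearMap.det_toMatrix, ContinuousLinearMap.det]
  ring

/-- The density `√(det g_ij)` of the Riemannian volume in the chart around `x`. -/
def density (g : Metric m S) (x : S) (z : Coord m) : ℝ := √(chartGram g x z).det

lemma continuousOn_density (g : Metric m S) (x : S) :
    ContinuousOn (density g x) (chartAt (Coord m) x).target :=
  (continuousOn_det_chartGram g x).sqrt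

lemma density_pos (g : Metric m S) (x : S) {z : Coord m} (hz : z ∈ (chartAt (Coord m) x).target) :
    0 < density g x z := Real.sqrt_pos.mpr (posDef_chartGram g x hz).det_pos

lemma aemeasurable_density (g : Metric m S) (x : S) :
    AEMeasurable (fun z => ENNReal.ofReal (density g x z))
      (volume.restrict (chartAt (Coord m) x).target) :=
  ((continuousOn_density g x).aemeasurable
    (chartAt (Coord m) x).open_target.measurableSet).ennreal_ofReal

section Transition

variable {x x' : S} {z : Coord m}
  (hz : z ∈ ((chartAt (Coord m) x).symm.trans (chartAt (Coord m) x')).source)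

include hz

lemma mdifferentiableAt_transition :
    MDifferentiableAt (𝓡 m) (𝓡 m) (chartAt (Coord m) x' ∘ (chartAt (Coord m) x).symm) z :=
  ((mdifferentiable_chart (I := 𝓡 m) x').mdifferentiableAt hz.2).comp z
    (mdifferentiableAt_chartAt_symm x hz.1)

lemma chartDeriv_eq_comp_fderiv_transition :
    chartDeriv x z = (chartDeriv x' (chartAt (Coord m) x' ((chartAt (Coord m) x).symm z))).comp
      (fderiv ℝ (chartAt (Coord m) x' ∘ (chartAt (Coord m) x).symm) z) := by
  have hsymm : (chartAt (Coord m) x).symm =ᶠ[𝓝 z]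
      (chartAt (Coord m) x').symm ∘ (chartAt (Coord m) x' ∘ (chartAt (Coord m) x).symm) := by
    filter_upwards [((chartAt (Coord m) x).symm.trans (chartAt (Coord m) x')).open_source.mem_nhds
      hz] with w hw
    exact ((chartAt (Coord m) x').left_inv hw.2).symm
  rw [← mfderiv_eq_fderiv]
  exact hsymm.mfderiv_eq.trans (mfderiv_comp z (mdifferentiableAt_chartAt_symm x'
    ((chartAt (Coord m) x').map_source hz.2)) (mdifferentiableAt_transition hz))

lemma density_eq_abs_det_fderiv_transition_mul (g : Metric m S) :
    density g x z = |(fderiv ℝ (chartAt (Coord m) x' ∘ (chartAt (Coord m) x).symm) z).det| *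
      density g x' (chartAt (Coord m) x' ((chartAt (Coord m) x).symm z)) := by
  have hdet : (chartDeriv x z).det
      = (chartDeriv x' (chartAt (Coord m) x' ((chartAt (Coord m) x).symm z))).det
        * (fderiv ℝ (chartAt (Coord m) x' ∘ (chartAt (Coord m) x).symm) z).det := by
    rw [chartDeriv_eq_comp_fderiv_transition hz]
    exact LinearMap.det_comp _ _
  have hz' : (chartAt (Coord m) x).symm z ∈ (chartAt (Coord m) x').source := hz.2
  rw [density, density, det_chartGram, det_chartGram, (chartAt (Coord m) x').left_inv hz', hdet,
    ← Real.sqrt_sq_eq_abs, ← Real.sqrt_mul (sq_nonneg _)]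
  ring_nf

end Transition

variable [MeasurableSpace S]

lemma chartVolume_le_riemVolume (g : Metric m S) (x : S) : chartVolume g x ≤ riemVolume g :=
  le_iSup (chartVolume g) x

variable [BorelSpace S]

lemma lintegral_chartVolume (g : Metric m S) (x : S) {f : S → ENNReal} (hf : Measurable f) :
    ∫⁻ y, f y ∂(chartVolume g x) = ∫⁻ z in (chartAt (Coord m) x).target,
      ENNReal.ofReal (density g x z) * f ((chartAt (Coord m) x).symm z) := by
  have hsymm : AEMeasurable (chartAt (Coord m) x).symm
      (volume.restrict (chartAt (Coord m) x).target) :=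
    (chartAt (Coord m) x).continuousOn_symm.aemeasurable
      (chartAt (Coord m) x).open_target.measurableSet
  rw [chartVolume, lintegral_map' hf.aemeasurable
    (hsymm.mono_ac (withDensity_absolutelyContinuous _ _))]
  exact lintegral_withDensity_eq_lintegral_mul₀ (aemeasurable_density g x)
    (hf.comp_aemeasurable hsymm)

lemma chartVolume_apply (g : Metric m S) (x : S) {A : Set S} (hA : MeasurableSet A) :
    chartVolume g x A = ∫⁻ z in (chartAt (Coord m) x).target ∩ (chartAt (Coord m) x).symm ⁻¹' A,
      ENNReal.ofReal (density g x z) := by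
  have hpre : MeasurableSet
      ((chartAt (Coord m) x).target ∩ (chartAt (Coord m) x).symm ⁻¹' A) :=
    measurableSet_source_inter_preimage (chartAt (Coord m) x).symm hA
  rw [← lintegral_indicator_one hA, lintegral_chartVolume g x (measurable_one.indicator hA),
    ← lintegral_indicator (chartAt (Coord m) x).open_target.measurableSet,
    ← lintegral_indicator hpre]
  congr 1 with z
  by_cases hz : z ∈ (chartAt (Coord m) x).target <;>
    by_cases hzA : (chartAt (Coord m) x).symm z ∈ A <;> simp [indicator, hz, hzA]

lemma chartVolume_apply_of_subset_source (g : Metric m S) (x : S) {A : Set S}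
    (hA : MeasurableSet A) (h : A ⊆ (chartAt (Coord m) x).source) :
    chartVolume g x A = ∫⁻ z in chartAt (Coord m) x '' A, ENNReal.ofReal (density g x z) := by
  rw [chartVolume_apply g x hA, (chartAt (Coord m) x).image_eq_target_inter_inv_preimage h]

lemma chartVolume_inter_source (g : Metric m S) (x : S) {A : Set S} (hA : MeasurableSet A) :
    chartVolume g x (A ∩ (chartAt (Coord m) x).source) = chartVolume g x A := by
  have hsource : (chartAt (Coord m) x).target ∩ (chartAt (Coord m) x).symm ⁻¹' A
      ⊆ (chartAt (Coord m) x).symm ⁻¹' (chartAt (Coord m) x).source :=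
    fun z hz => (chartAt (Coord m) x).map_target hz.1
  rw [chartVolume_apply g x hA,
    chartVolume_apply g x (hA.inter (chartAt (Coord m) x).open_source.measurableSet),
    preimage_inter, ← inter_assoc, inter_eq_left.mpr hsource]

lemma chartVolume_congr (g : Metric m S) {x x' : S} {A : Set S} (hA : MeasurableSet A)
    (h : A ⊆ (chartAt (Coord m) x).source) (h' : A ⊆ (chartAt (Coord m) x').source) :
    chartVolume g x A = chartVolume g x' A := by
  set c := chartAt (Coord m) x
  set c' := chartAt (Coord m) x'
  have himage : (c' ∘ c.symm) '' (c '' A) = c' '' A := by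
    rw [image_comp, c.leftInvOn.mono h |>.image_image]
  have hsource : ∀ z ∈ c '' A, z ∈ (c.symm.trans c').source := by
    rintro _ ⟨y, hy, rfl⟩
    exact ⟨c.map_source (h hy), show c.symm (c y) ∈ c'.source from (c.left_inv (h hy)).symm ▸ h' hy⟩
  have hmeas : MeasurableSet (c '' A) := by
    rw [c.image_eq_target_inter_inv_preimage h]
    exact measurableSet_source_inter_preimage c.symm hA
  rw [chartVolume_apply_of_subset_source g x hA h, chartVolume_apply_of_subset_source g x' hA h',
    ← himage, lintegral_image_eq_lintegral_abs_det_fderiv_mul volume hmeas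
      (fun z hz => (mdifferentiableAt_transition
        (hsource z hz)).differentiableAt.hasFDerivAt.hasFDerivWithinAt)
      ((c.symm.trans c').injOn.mono hsource)]
  refine setLIntegral_congr_fun hmeas fun z hz => ?_
  rw [density_eq_abs_det_fderiv_transition_mul (hsource z hz), ENNReal.ofReal_mul (abs_nonneg _)]
  rfl

lemma chartVolume_le_sum_restrict (g : Metric m S) (x : S) {t : Finset S} {K : S → Set S}
    (hK : ∀ y ∈ t, MeasurableSet (K y)) (hsub : ∀ y ∈ t, K y ⊆ (chartAt (Coord m) y).source)
    (hcov : ⋃ y ∈ t, K y = univ) :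
    chartVolume g x ≤ ∑ y ∈ t, (chartVolume g y).restrict (K y) := by
  refine Measure.le_iff.mpr fun A hA => ?_
  set B := A ∩ (chartAt (Coord m) x).source
  have hBmeas : MeasurableSet B := hA.inter (chartAt (Coord m) x).open_source.measurableSet
  calc chartVolume g x A = chartVolume g x (⋃ y ∈ t, B ∩ K y) := by
        rw [← inter_iUnion₂, hcov, inter_univ, chartVolume_inter_source g x hA]
    _ ≤ ∑ y ∈ t, chartVolume g x (B ∩ K y) := measure_biUnion_finset_le t _
    _ ≤ ∑ y ∈ t, (chartVolume g y).restrict (K y) A := Finset.sum_le_sum fun y hy => by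
        rw [chartVolume_congr g (hBmeas.inter (hK y hy))
          (inter_subset_left.trans inter_subset_right) (inter_subset_right.trans (hsub y hy)),
          Measure.restrict_apply hA]
        exact measure_mono (inter_subset_inter_left _ inter_subset_left)
    _ = (∑ y ∈ t, (chartVolume g y).restrict (K y)) A := by rw [Measure.finsetSum_apply]

lemma riemVolume_le_sum_restrict (g : Metric m S) {t : Finset S} {K : S → Set S}
    (hK : ∀ y ∈ t, MeasurableSet (K y)) (hsub : ∀ y ∈ t, K y ⊆ (chartAt (Coord m) y).source)
    (hcov : ⋃ y ∈ t, K y = univ) :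
    riemVolume g ≤ ∑ y ∈ t, (chartVolume g y).restrict (K y) :=
  iSup_le fun x => chartVolume_le_sum_restrict g x hK hsub hcov

lemma chartVolume_lt_top_of_isCompact [T2Space S] (g : Metric m S) (x : S) {K : Set S}
    (hK : IsCompact K) (hsub : K ⊆ (chartAt (Coord m) x).source) : chartVolume g x K < ⊤ := by
  have himage : IsCompact (chartAt (Coord m) x '' K) :=
    hK.image_of_continuousOn ((chartAt (Coord m) x).continuousOn.mono hsub)
  obtain ⟨C, hC⟩ := himage.exists_bound_of_continuousOn <| (continuousOn_density g x).mono <|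
    (image_mono hsub).trans (chartAt (Coord m) x).image_source_eq_target.subset
  calc chartVolume g x K
      = ∫⁻ z in chartAt (Coord m) x '' K, ENNReal.ofReal (density g x z) :=
        chartVolume_apply_of_subset_source g x hK.measurableSet hsub
    _ ≤ ∫⁻ _ in chartAt (Coord m) x '' K, ENNReal.ofReal C :=
        setLIntegral_mono measurable_const fun z hz =>
          ENNReal.ofReal_le_ofReal ((le_abs_self _).trans (hC z hz))
    _ = ENNReal.ofReal C * volume (chartAt (Coord m) x '' K) := setLIntegral_const _ _
    _ < ⊤ := ENNReal.mul_lt_top ENNReal.ofReal_lt_top himage.measure_lt_top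

lemma isFiniteMeasure_riemVolume [CompactSpace S] [T2Space S] (g : Metric m S) :
    IsFiniteMeasure (riemVolume g) := by
  obtain ⟨t, K, hK, hsub, hcov⟩ := exists_compact_chart_cover (Coord m) S
  refine ⟨(riemVolume_le_sum_restrict g (fun y _ => (hK y).measurableSet) (fun y _ => hsub y) hcov
    univ).trans_lt ?_⟩
  rw [Measure.finsetSum_apply]
  exact ENNReal.sum_lt_top.mpr fun y _ =>
    (Measure.restrict_apply_univ _).trans_lt (chartVolume_lt_top_of_isCompact g y (hK y) (hsub y))

lemma riemVolume_ne_zero [Nonempty S] (g : Metric m S) : riemVolume g ≠ 0 := by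
  obtain ⟨x⟩ := ‹Nonempty S›
  suffices hpos : 0 < chartVolume g x univ from fun h =>
    (hpos.trans_le (chartVolume_le_riemVolume g x univ)).ne' (by rw [h, Measure.coe_zero]; rfl)
  rw [chartVolume_apply g x MeasurableSet.univ, preimage_univ, inter_univ,
    pos_iff_ne_zero, Ne, setLIntegral_eq_zero_iff' (chartAt (Coord m) x).open_target.measurableSet
      (aemeasurable_density g x)]
  intro hzero
  refine ((chartAt (Coord m) x).open_target.measure_pos volume
    ⟨_, mem_chart_target (Coord m) x⟩).ne' (measure_eq_zero_iff_ae_notMem.mpr ?_)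
  filter_upwards [hzero] with z hz hmem
  exact (ENNReal.ofReal_pos.mpr (density_pos g x hmem)).ne' (hz hmem)

end RiemGeom

/-! ## The Poincaré inequality on convex sets -/

section Average

variable {α : Type*} [MeasurableSpace α] {ν : Measure α}

lemma sq_lintegral_le_measure_univ_mul {f : α → ENNReal} (hf : AEMeasurable f ν) :
    (∫⁻ a, f a ∂ν) ^ 2 ≤ ν univ * ∫⁻ a, f a ^ 2 ∂ν := by
  have hsq (a : ENNReal) : (a ^ (1 / 2 : ℝ)) ^ 2 = a := by
    rw [← ENNReal.rpow_natCast, ← ENNReal.rpow_mul]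
    simp
  have hcs := pow_le_pow_left' (ENNReal.lintegral_mul_le_Lp_mul_Lq ν Real.HolderConjugate.two_two
    (aemeasurable_const (b := (1 : ENNReal))) hf) 2
  rw [mul_pow, hsq, hsq] at hcs
  simpa using hcs

variable {F : Type*} [NormedAddCommGroup F] [NormedSpace ℝ F] [CompleteSpace F]

lemma measure_univ_mul_enorm_sq_le_of_integral_eq_zero [IsFiniteMeasure ν] {u : α → F}
    (hu : Integrable u ν) (hzero : ∫ y, u y ∂ν = 0) (v : F) :
    ν univ * ‖v‖ₑ ^ 2 ≤ ∫⁻ y, ‖v - u y‖ₑ ^ 2 ∂ν := by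
  rcases eq_or_ne (ν univ) 0 with hν | hν
  · simp [hν]
  have hmean : ∫ y, (v - u y) ∂ν = ν.real univ • v := by
    rw [integral_sub (integrable_const v) hu, hzero, sub_zero, integral_const]
  have hle : ν univ * ‖v‖ₑ ≤ ∫⁻ y, ‖v - u y‖ₑ ∂ν := by
    refine le_of_eq_of_le ?_ (hmean ▸ enorm_integral_le_lintegral_enorm _)
    rw [enorm_smul, Real.enorm_of_nonneg measureReal_nonneg, ofReal_measureReal]
  refine (ENNReal.mul_le_mul_iff_right hν (measure_ne_top ν _)).mp ?_
  calc ν univ * (ν univ * ‖v‖ₑ ^ 2) = (ν univ * ‖v‖ₑ) ^ 2 := by ring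
    _ ≤ (∫⁻ y, ‖v - u y‖ₑ ∂ν) ^ 2 := pow_le_pow_left' hle 2
    _ ≤ ν univ * ∫⁻ y, ‖v - u y‖ₑ ^ 2 ∂ν :=
        sq_lintegral_le_measure_univ_mul (aestronglyMeasurable_const.sub hu.1).enorm

end Average

section Convex

variable {E F : Type*} [NormedAddCommGroup E] [NormedSpace ℝ E] [NormedAddCommGroup F]
  [NormedSpace ℝ F] [CompleteSpace F] {u : E → F} {U Q : Set E}

open AffineMap (lineMap)

lemma enorm_sub_le_lintegral_fderiv_lineMap (hU : IsOpen U) (hu : ContDiffOn ℝ 1 u U) {x y : E}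
    (hxy : ∀ t ∈ Icc (0 : ℝ) 1, lineMap x y t ∈ U) :
    ‖u y - u x‖ₑ ≤ ∫⁻ t in Icc (0 : ℝ) 1, ‖fderiv ℝ u (lineMap x y t) (y - x)‖ₑ := by
  have hderiv : ∀ t ∈ uIcc (0 : ℝ) 1,
      HasDerivAt (fun t => u (lineMap x y t)) (fderiv ℝ u (lineMap x y t) (y - x)) t := by
    intro t ht
    rw [uIcc_of_le zero_le_one] at ht
    exact ((hu.contDiffAt (hU.mem_nhds (hxy t ht))).differentiableAt
      one_ne_zero).hasFDerivAt.comp_hasDerivAt t AffineMap.hasDerivAt_lineMap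
  have hcont : ContinuousOn (fun t : ℝ => fderiv ℝ u (lineMap x y t) (y - x)) (Icc 0 1) :=
    ((hu.continuousOn_fderiv_of_isOpen hU le_rfl).comp AffineMap.lineMap_continuous.continuousOn
      hxy).clm_apply continuousOn_const
  have hftc := intervalIntegral.integral_eq_sub_of_hasDerivAt hderiv
    (hcont.intervalIntegrable_of_Icc zero_le_one)
  rw [AffineMap.lineMap_apply_one, AffineMap.lineMap_apply_zero] at hftc
  rw [← hftc, intervalIntegral.integral_of_le zero_le_one, ← integral_Icc_eq_integral_Ioc]
  exact enorm_integral_le_lintegral_enorm _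

lemma enorm_sub_sq_le_mul_lintegral_fderiv_lineMap (hU : IsOpen U) (hu : ContDiffOn ℝ 1 u U)
    {x y : E} (hxy : ∀ t ∈ Icc (0 : ℝ) 1, lineMap x y t ∈ U) :
    ‖u y - u x‖ₑ ^ 2
      ≤ ‖y - x‖ₑ ^ 2 * ∫⁻ t in Icc (0 : ℝ) 1, ‖fderiv ℝ u (lineMap x y t)‖ₑ ^ 2 := by
  have hcont : ContinuousOn (fun t : ℝ => ‖fderiv ℝ u (lineMap x y t)‖ₑ) (Icc 0 1) :=
    ((hu.continuousOn_fderiv_of_isOpen hU le_rfl).comp AffineMap.lineMap_continuous.continuousOn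
      hxy).enorm
  calc ‖u y - u x‖ₑ ^ 2
      ≤ (∫⁻ t in Icc (0 : ℝ) 1, ‖y - x‖ₑ * ‖fderiv ℝ u (lineMap x y t)‖ₑ) ^ 2 := by
        refine pow_le_pow_left' ((enorm_sub_le_lintegral_fderiv_lineMap hU hu hxy).trans
          (lintegral_mono fun t => ?_)) 2
        rw [mul_comm]
        exact (fderiv ℝ u (lineMap x y t)).le_opENorm (y - x)
    _ = ‖y - x‖ₑ ^ 2 * (∫⁻ t in Icc (0 : ℝ) 1, ‖fderiv ℝ u (lineMap x y t)‖ₑ) ^ 2 := by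
        rw [lintegral_const_mul' _ _ enorm_ne_top, mul_pow]
    _ ≤ ‖y - x‖ₑ ^ 2 * ∫⁻ t in Icc (0 : ℝ) 1, ‖fderiv ℝ u (lineMap x y t)‖ₑ ^ 2 := by
        gcongr
        refine (sq_lintegral_le_measure_univ_mul (hcont.aemeasurable measurableSet_Icc)).trans ?_
        simp

variable [FiniteDimensional ℝ E] [MeasurableSpace E] [BorelSpace E] (μ : Measure E)
  [μ.IsAddHaarMeasure]

lemma setLIntegral_comp_lineMap_le {h : E → ENNReal} (hh : Measurable h) (hQ : Convex ℝ Q)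
    (hQm : MeasurableSet Q) {x : E} (hx : x ∈ Q) {t : ℝ} (ht : 1 / 2 ≤ t) (ht₁ : t ≤ 1) :
    ∫⁻ y in Q, h (lineMap x y t) ∂μ ≤ 2 ^ Module.finrank ℝ E * ∫⁻ y in Q, h y ∂μ := by
  have ht₀ : 0 < t := one_half_pos.trans_le ht
  have hscale : ENNReal.ofReal |(t ^ Module.finrank ℝ E)⁻¹| ≤ 2 ^ Module.finrank ℝ E := by
    rw [abs_of_nonneg (by positivity), ← inv_pow, ENNReal.ofReal_pow (by positivity),
      ← ENNReal.ofReal_ofNat]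
    exact pow_le_pow_left' (ENNReal.ofReal_le_ofReal
      ((inv_le_comm₀ ht₀ two_pos).mpr (one_div (2 : ℝ) ▸ ht))) _
  calc ∫⁻ y in Q, h (lineMap x y t) ∂μ
      ≤ ∫⁻ y, Q.indicator h (lineMap x y t) ∂μ := by
        rw [← lintegral_indicator hQm]
        refine lintegral_mono fun y => ?_
        by_cases hy : y ∈ Q
        · rw [indicator_of_mem hy, indicator_of_mem (hQ.lineMap_mem hx hy ⟨ht₀.le, ht₁⟩)]
        · rw [indicator_of_notMem hy]
          exact zero_le
    _ = ∫⁻ w, Q.indicator h ((1 - t) • x + w) ∂(Measure.map (t • ·) μ) := by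
        simp only [AffineMap.lineMap_apply_module]
        exact (lintegral_map (f := fun w => Q.indicator h ((1 - t) • x + w))
          ((hh.indicator hQm).comp (measurable_const_add _)) (measurable_const_smul t)).symm
    _ = ENNReal.ofReal |(t ^ Module.finrank ℝ E)⁻¹| * ∫⁻ y in Q, h y ∂μ := by
        rw [Measure.map_addHaar_smul μ ht₀.ne', lintegral_smul_measure,
          lintegral_add_left_eq_self (Q.indicator h), lintegral_indicator hQm, smul_eq_mul]
    _ ≤ 2 ^ Module.finrank ℝ E * ∫⁻ y in Q, h y ∂μ := mul_le_mul_left hscale _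

/- By symmetry one may let the end point vary whose weight is at least `1 / 2`. -/
lemma setLIntegral_setLIntegral_comp_lineMap_le {h : E → ENNReal} (hh : Measurable h)
    (hQ : Convex ℝ Q) (hQm : MeasurableSet Q) {t : ℝ} (ht : t ∈ Icc (0 : ℝ) 1) :
    ∫⁻ x in Q, ∫⁻ y in Q, h (lineMap x y t) ∂μ ∂μ
      ≤ 2 ^ Module.finrank ℝ E * (∫⁻ y in Q, h y ∂μ) * μ Q := by
  rw [← setLIntegral_const]
  rcases le_total (1 / 2) t with hle | hle
  · exact setLIntegral_mono measurable_const fun x hx =>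
      setLIntegral_comp_lineMap_le μ hh hQ hQm hx hle ht.2
  · rw [lintegral_lintegral_swap (f := fun x y => h (lineMap x y t))
      (hh.comp (by simp only [AffineMap.lineMap_apply_module]; fun_prop)).aemeasurable]
    refine setLIntegral_mono measurable_const fun y hy => ?_
    simp only [← AffineMap.lineMap_apply_one_sub y]
    exact setLIntegral_comp_lineMap_le μ hh hQ hQm hy (by linarith) (by linarith [ht.1])

lemma lintegral_lintegral_lintegral_lineMap_le {h : E → ENNReal} (hh : Measurable h)
    (hQ : Convex ℝ Q) (hQm : MeasurableSet Q) :
    ∫⁻ x in Q, ∫⁻ y in Q, (∫⁻ t in Icc (0 : ℝ) 1, h (lineMap x y t)) ∂μ ∂μ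
      ≤ 2 ^ Module.finrank ℝ E * (∫⁻ y in Q, h y ∂μ) * μ Q := by
  have hmeas : Measurable fun p : (E × ℝ) × E => h (lineMap p.1.1 p.2 p.1.2) :=
    hh.comp (by simp only [AffineMap.lineMap_apply_module]; fun_prop)
  have hswap (x : E) : ∫⁻ y in Q, (∫⁻ t in Icc (0 : ℝ) 1, h (lineMap x y t)) ∂μ
      = ∫⁻ t in Icc (0 : ℝ) 1, ∫⁻ y in Q, h (lineMap x y t) ∂μ :=
    lintegral_lintegral_swap (f := fun y t => h (lineMap x y t))
      (hmeas.comp (by fun_prop : Measurable fun p : E × ℝ => ((x, p.2), p.1))).aemeasurable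
  calc ∫⁻ x in Q, ∫⁻ y in Q, (∫⁻ t in Icc (0 : ℝ) 1, h (lineMap x y t)) ∂μ ∂μ
      = ∫⁻ t in Icc (0 : ℝ) 1, ∫⁻ x in Q, ∫⁻ y in Q, h (lineMap x y t) ∂μ ∂μ := by
        simp only [hswap]
        exact lintegral_lintegral_swap (f := fun x t => ∫⁻ y in Q, h (lineMap x y t) ∂μ)
          hmeas.lintegral_prod_right'.aemeasurable
    _ ≤ ∫⁻ _ in Icc (0 : ℝ) 1, 2 ^ Module.finrank ℝ E * (∫⁻ y in Q, h y ∂μ) * μ Q :=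
        setLIntegral_mono measurable_const fun t ht =>
          setLIntegral_setLIntegral_comp_lineMap_le μ hh hQ hQm ht
    _ = 2 ^ Module.finrank ℝ E * (∫⁻ y in Q, h y ∂μ) * μ Q := by simp

lemma lintegral_enorm_sq_le_lintegral_enorm_fderiv_sq_of_convex (hU : IsOpen U)
    (hu : ContDiffOn ℝ 1 u U) (hQ : Convex ℝ Q) (hQm : MeasurableSet Q)
    (hQb : Bornology.IsBounded Q) (hQU : Q ⊆ U) (hint : IntegrableOn u Q μ)
    (hzero : ∫ z in Q, u z ∂μ = 0) :
    ∫⁻ z in Q, ‖u z‖ₑ ^ 2 ∂μ ≤ Metric.ediam Q ^ 2 * 2 ^ Module.finrank ℝ E *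
      ∫⁻ z in Q, ‖fderiv ℝ u z‖ₑ ^ 2 ∂μ := by
  have hμQ : μ Q ≠ ⊤ := hQb.measure_lt_top.ne
  have hdiam : Metric.ediam Q ^ 2 ≠ ⊤ := ENNReal.pow_ne_top hQb.ediam_ne_top
  have _ : IsFiniteMeasure (μ.restrict Q) := isFiniteMeasure_restrict.mpr hμQ
  rcases eq_or_ne (μ Q) 0 with hz | hz
  · simp [setLIntegral_measure_zero _ _ hz]
  refine (ENNReal.mul_le_mul_iff_right hz hμQ).mp ?_
  calc μ Q * ∫⁻ x in Q, ‖u x‖ₑ ^ 2 ∂μ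
      ≤ ∫⁻ x in Q, ∫⁻ y in Q, ‖u x - u y‖ₑ ^ 2 ∂μ ∂μ := by
        rw [← lintegral_const_mul' _ _ hμQ, ← Measure.restrict_apply_univ]
        exact lintegral_mono fun x =>
          measure_univ_mul_enorm_sq_le_of_integral_eq_zero hint hzero (u x)
    _ ≤ ∫⁻ x in Q, ∫⁻ y in Q, Metric.ediam Q ^ 2 *
          (∫⁻ t in Icc (0 : ℝ) 1, ‖fderiv ℝ u (lineMap x y t)‖ₑ ^ 2) ∂μ ∂μ := by
        refine setLIntegral_mono' hQm fun x hx => setLIntegral_mono' hQm fun y hy => ?_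
        rw [← enorm_neg, neg_sub]
        refine (enorm_sub_sq_le_mul_lintegral_fderiv_lineMap hU hu fun t ht =>
          hQU (hQ.lineMap_mem hx hy ht)).trans ?_
        gcongr
        rw [← edist_eq_enorm_sub]
        exact Metric.edist_le_ediam_of_mem hy hx
    _ = Metric.ediam Q ^ 2 * ∫⁻ x in Q, ∫⁻ y in Q,
          (∫⁻ t in Icc (0 : ℝ) 1, ‖fderiv ℝ u (lineMap x y t)‖ₑ ^ 2) ∂μ ∂μ := by
        simp only [lintegral_const_mul' _ _ hdiam]
    _ ≤ Metric.ediam Q ^ 2 *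
          (2 ^ Module.finrank ℝ E * (∫⁻ z in Q, ‖fderiv ℝ u z‖ₑ ^ 2 ∂μ) * μ Q) := by
        gcongr
        exact lintegral_lintegral_lintegral_lineMap_le μ
          ((measurable_fderiv ℝ u).enorm.pow_const 2) hQ hQm
    _ = μ Q * (Metric.ediam Q ^ 2 * 2 ^ Module.finrank ℝ E *
          ∫⁻ z in Q, ‖fderiv ℝ u z‖ₑ ^ 2 ∂μ) := by ring

end Convex

/-! ## A Poincaré inequality with finitely many constraints -/

namespace RiemGeom

section Cube

variable {m : ℕ} {δ : ℝ} {k l : Fin m → ℤ}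

/-- The half-open cube of side `δ` with index `k` in the grid `δ ℤ^m`. -/
def cube (δ : ℝ) (k : Fin m → ℤ) : Set (Coord m) := {z | ∀ j, ⌊z j / δ⌋ = k j}

lemma mem_cube_iff (hδ : 0 < δ) {z : Coord m} :
    z ∈ cube δ k ↔ ∀ j, z j ∈ Ico (k j * δ) ((k j + 1) * δ) := by
  simp only [cube, mem_ofPred_eq, Int.floor_eq_iff, le_div_iff₀ hδ, div_lt_iff₀ hδ, mem_Ico]

lemma convex_cube (hδ : 0 < δ) (k : Fin m → ℤ) : Convex ℝ (cube δ k) := by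
  intro z hz w hw a b ha hb hab
  rw [mem_cube_iff hδ] at *
  exact fun j => by simpa using convex_Ico _ _ (hz j) (hw j) ha hb hab

lemma measurableSet_cube (δ : ℝ) (k : Fin m → ℤ) : MeasurableSet (cube δ k) :=
  MeasurableSet.congr (MeasurableSet.iInter fun j =>
    (show Measurable fun z : Coord m => ⌊z j / δ⌋ by fun_prop) (measurableSet_singleton (k j)))
    (by ext; simp [cube])

lemma disjoint_cube (δ : ℝ) (h : k ≠ l) : Disjoint (cube δ k) (cube δ l) :=
  Set.disjoint_left.mpr fun _ hz hw => h (funext fun j => (hz j).symm.trans (hw j))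

lemma ediam_cube_le (hδ : 0 < δ) (k : Fin m → ℤ) :
    Metric.ediam (cube δ k) ≤ ENNReal.ofReal (√m * δ) := by
  refine Metric.ediam_le fun z hz w hw => ?_
  rw [mem_cube_iff hδ] at hz hw
  have hcoord (j : Fin m) : dist (z j) (w j) ≤ δ := by
    have h := Real.dist_le_of_mem_Icc (Ico_subset_Icc_self (hz j)) (Ico_subset_Icc_self (hw j))
    linarith
  rw [edist_dist, EuclideanSpace.dist_eq]
  refine ENNReal.ofReal_le_ofReal ((Real.sqrt_le_sqrt (Finset.sum_le_sum fun j _ =>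
    pow_le_pow_left₀ dist_nonneg (hcoord j) 2)).trans_eq ?_)
  simp [hδ.le]

lemma finite_setOf_cube_inter_nonempty (hδ : 0 < δ) {P : Set (Coord m)}
    (hP : Bornology.IsBounded P) : {k | (cube δ k ∩ P).Nonempty}.Finite := by
  obtain ⟨R, hR⟩ := hP.exists_norm_le
  refine (finite_Icc (fun _ => ⌊-R / δ⌋) (fun _ => ⌊R / δ⌋)).subset ?_
  rintro k ⟨z, hz, hzP⟩
  have habs (j : Fin m) : |z j| ≤ R := (PiLp.norm_apply_le z j).trans (hR z hzP)
  refine ⟨fun j => ?_, fun j => ?_⟩ <;> rw [← hz j] <;> refine Int.floor_mono ?_ <;> gcongr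
  exacts [(abs_le.mp (habs j)).1, (abs_le.mp (habs j)).2]

lemma exists_disjoint_convex_cover {P : Set (Coord m)} (hP : Bornology.IsBounded P) {η : ENNReal}
    (hη : η ≠ 0) :
    ∃ 𝒬 : Finset (Set (Coord m)), P ⊆ ⋃ Q ∈ 𝒬, Q ∧ (𝒬 : Set (Set (Coord m))).PairwiseDisjoint id ∧
      ∀ Q ∈ 𝒬, Convex ℝ Q ∧ MeasurableSet Q ∧ Metric.ediam Q ≤ η ∧ (Q ∩ P).Nonempty := by
  classical
  have hlim : Tendsto (fun δ : ℝ => ENNReal.ofReal (√m * δ)) (𝓝[>] 0) (𝓝 0) := by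
    have hcont : Continuous fun δ : ℝ => ENNReal.ofReal (√m * δ) :=
      ENNReal.continuous_ofReal.comp (continuous_const_mul √m)
    simpa using (hcont.tendsto 0).mono_left nhdsWithin_le_nhds
  obtain ⟨δ, hδη, hδ⟩ := ((hlim.eventually_le_const (pos_iff_ne_zero.mpr hη)).and
    eventually_mem_nhdsWithin).exists
  have hfin := finite_setOf_cube_inter_nonempty hδ hP
  refine ⟨hfin.toFinset.image (cube δ), fun z hz => ?_, ?_, ?_⟩
  · have hzc : z ∈ cube δ fun j => ⌊z j / δ⌋ := fun _ => rfl
    exact mem_iUnion₂.mpr ⟨_, Finset.mem_image_of_mem _ (hfin.mem_toFinset.mpr ⟨z, hzc, hz⟩), hzc⟩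
  · simp only [Finset.coe_image]
    rintro _ ⟨k, -, rfl⟩ _ ⟨l, -, rfl⟩ hkl
    exact disjoint_cube δ fun h => hkl (congrArg _ h)
  · simp only [Finset.forall_mem_image, Finite.mem_toFinset]
    exact fun k hk => ⟨convex_cube hδ k, measurableSet_cube δ k, (ediam_cube_le hδ k).trans hδη, hk⟩

lemma exists_forall_lintegral_enorm_sq_le_of_isCompact {P U : Set (Coord m)} (hP : IsCompact P)
    (hU : IsOpen U) (hPU : P ⊆ U) :
    ∃ N, IsCompact N ∧ N ⊆ U ∧ ∀ ε : ENNReal, ε ≠ 0 → ∃ 𝒬 : Finset (Set (Coord m)),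
      (∀ Q ∈ 𝒬, Q ⊆ N) ∧ ∀ u : Coord m → ℂ, ContDiffOn ℝ 1 u U → (∀ Q ∈ 𝒬, ∫ z in Q, u z = 0) →
        ∫⁻ z in P, ‖u z‖ₑ ^ 2 ≤ ε * ∫⁻ z in N, ‖fderiv ℝ u z‖ₑ ^ 2 := by
  obtain ⟨ρ, hρ, hNU⟩ := hP.exists_cthickening_subset_open hU hPU
  refine ⟨Metric.cthickening ρ P, hP.cthickening, hNU, fun ε hε => ?_⟩
  obtain ⟨η, hη, hηρ, hηε⟩ : ∃ η : ENNReal, 0 < η ∧ η ≤ ENNReal.ofReal ρ ∧ η ^ 2 * 2 ^ m ≤ ε := by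
    have hlim : Tendsto (fun η : ENNReal => η ^ 2 * 2 ^ m) (𝓝[>] 0) (𝓝 0) := by
      have hcont : Continuous fun η : ENNReal => η ^ 2 * 2 ^ m :=
        (ENNReal.continuous_mul_const (by simp)).comp (ENNReal.continuous_pow 2)
      simpa using (hcont.tendsto 0).mono_left nhdsWithin_le_nhds
    have hle : ∀ᶠ η : ENNReal in 𝓝[>] 0, η ≤ ENNReal.ofReal ρ :=
      (eventually_le_nhds (ENNReal.ofReal_pos.mpr hρ)).filter_mono nhdsWithin_le_nhds
    exact (eventually_mem_nhdsWithin.and (hle.and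
      (hlim.eventually_le_const (pos_iff_ne_zero.mpr hε)))).exists
  obtain ⟨𝒬, hcov, hdisj, h𝒬⟩ := exists_disjoint_convex_cover hP.isBounded hη.ne'
  have h𝒬N : ∀ Q ∈ 𝒬, Q ⊆ Metric.cthickening ρ P := by
    intro Q hQ z hz
    obtain ⟨-, -, hdiam, w, hwQ, hwP⟩ := h𝒬 Q hQ
    exact Metric.mem_cthickening_of_edist_le z w ρ P hwP
      ((Metric.edist_le_ediam_of_mem hz hwQ).trans (hdiam.trans hηρ))
  refine ⟨𝒬, h𝒬N, fun u hu hzero => ?_⟩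
  have hsum (f : Coord m → ENNReal) : ∫⁻ z in ⋃ Q ∈ 𝒬, Q, f z = ∑ Q ∈ 𝒬, ∫⁻ z in Q, f z :=
    lintegral_biUnion_finset hdisj (fun Q hQ => (h𝒬 Q hQ).2.1) f
  calc ∫⁻ z in P, ‖u z‖ₑ ^ 2
      ≤ ∑ Q ∈ 𝒬, ∫⁻ z in Q, ‖u z‖ₑ ^ 2 := (lintegral_mono_set hcov).trans_eq (hsum _)
    _ ≤ ∑ Q ∈ 𝒬, ε * ∫⁻ z in Q, ‖fderiv ℝ u z‖ₑ ^ 2 := by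
        refine Finset.sum_le_sum fun Q hQ => ?_
        obtain ⟨hconv, hmeas, hdiam, -⟩ := h𝒬 Q hQ
        have hint : IntegrableOn u Q :=
          ((hu.continuousOn.mono hNU).integrableOn_compact hP.cthickening).mono_set (h𝒬N Q hQ)
        have hpoincare := lintegral_enorm_sq_le_lintegral_enorm_fderiv_sq_of_convex volume hU hu
          hconv hmeas (hP.cthickening.isBounded.subset (h𝒬N Q hQ)) ((h𝒬N Q hQ).trans hNU) hint
          (hzero Q hQ)
        rw [finrank_euclideanSpace_fin] at hpoincare
        exact hpoincare.trans (by gcongr; exact le_trans (by gcongr) hηε)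
    _ ≤ ε * ∫⁻ z in Metric.cthickening ρ P, ‖fderiv ℝ u z‖ₑ ^ 2 := by
        rw [← Finset.mul_sum, ← hsum]
        gcongr
        exact iUnion₂_subset h𝒬N

end Cube

lemma norm_sq_le_sum_norm_sq_basisVec {m : ℕ} {F : Type*} [NormedAddCommGroup F] [NormedSpace ℝ F]
    (L : Coord m →L[ℝ] F) : ‖L‖ ^ 2 ≤ ∑ j, ‖L (basisVec m j)‖ ^ 2 := by
  have hsq : 0 ≤ ∑ j, ‖L (basisVec m j)‖ ^ 2 := by positivity
  rw [← Real.sq_sqrt hsq]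
  refine pow_le_pow_left₀ (norm_nonneg _) (L.opNorm_le_bound (Real.sqrt_nonneg _) fun v => ?_) 2
  calc ‖L v‖ = ‖∑ j, v j • L (basisVec m j)‖ := by
        conv_lhs => rw [← (stdBasis m).sum_repr v, map_sum]
        simp only [map_smul, stdBasis_apply]
        rfl
    _ ≤ ∑ j, ‖L (basisVec m j)‖ * ‖v j‖ :=
        (norm_sum_le _ _).trans_eq (Finset.sum_congr rfl fun j _ => by rw [norm_smul, mul_comm])
    _ ≤ _ := (Real.sum_mul_le_sqrt_mul_sqrt _ _ _).trans_eq (by rw [EuclideanSpace.norm_eq])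

variable {m : ℕ} {S : Type*} [TopologicalSpace S] [ChartedSpace (EuclideanSpace ℝ (Fin m)) S]
  [IsManifold (𝓡 m) ∞ S] {f : S → ℂ}

/-- The energy density `|Df|²`, whose integral is the Dirichlet energy. -/
def energy (g : Metric m S) (f : S → ℂ) (y : S) : ENNReal :=
  ENNReal.ofReal (gradInner g f f y).re

lemma enorm_fderiv_sq_le_trace_mul_energy (g : Metric m S) (hf : ContMDiff (𝓡 m) 𝓘(ℝ, ℂ) ∞ f)
    (x : S) {z : Coord m} (hz : z ∈ (chartAt (Coord m) x).target) :
    ‖fderiv ℝ (f ∘ (chartAt (Coord m) x).symm) z‖ₑ ^ 2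
      ≤ ENNReal.ofReal (chartGram g x z).trace * energy g f ((chartAt (Coord m) x).symm z) := by
  have htrace : 0 ≤ (chartGram g x z).trace := (posDef_chartGram g x hz).posSemidef.trace_nonneg
  rw [energy, ← ENNReal.ofReal_mul htrace, ← ofReal_norm, ← ENNReal.ofReal_pow (norm_nonneg _)]
  refine ENNReal.ofReal_le_ofReal ((norm_sq_le_sum_norm_sq_basisVec _).trans ?_)
  rw [mul_comm, Matrix.trace, Finset.mul_sum]
  exact Finset.sum_le_sum fun j _ =>
    norm_sq_chartPartial_le g x hz ((hf _).mdifferentiableAt (by simp)) j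

variable [MeasurableSpace S] [BorelSpace S]

lemma measurable_energy (g : Metric m S) (hf : ContMDiff (𝓡 m) 𝓘(ℝ, ℂ) ∞ f) :
    Measurable (energy g f) :=
  (Complex.continuous_re.comp (continuous_gradInner g hf hf)).measurable.ennreal_ofReal

lemma exists_setLIntegral_chartVolume_le (g : Metric m S) (x : S) {K : Set S} (hK : IsCompact K)
    (hKm : MeasurableSet K) (hKs : K ⊆ (chartAt (Coord m) x).source) :
    ∃ C : ENNReal, C ≠ ⊤ ∧ ∀ f : S → ENNReal, Measurable f →
      ∫⁻ y in K, f y ∂(chartVolume g x)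
        ≤ C * ∫⁻ z in chartAt (Coord m) x '' K, f ((chartAt (Coord m) x).symm z) := by
  set c := chartAt (Coord m) x
  have hcK : IsCompact (c '' K) := hK.image_of_continuousOn (c.continuousOn.mono hKs)
  have hcKt : c '' K ⊆ c.target := (image_mono hKs).trans c.image_source_eq_target.subset
  obtain ⟨b, hb⟩ := hcK.exists_bound_of_continuousOn ((continuousOn_density g x).mono hcKt)
  refine ⟨ENNReal.ofReal b, ENNReal.ofReal_ne_top, fun f hf => ?_⟩
  calc ∫⁻ y in K, f y ∂(chartVolume g x)
      = ∫⁻ z in c.target, ENNReal.ofReal (density g x z) * K.indicator f (c.symm z) := by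
        rw [← lintegral_indicator hKm, lintegral_chartVolume g x (hf.indicator hKm)]
    _ ≤ ∫⁻ z in c '' K, ENNReal.ofReal b * f (c.symm z) := by
        rw [← lintegral_indicator c.open_target.measurableSet,
          ← lintegral_indicator hcK.measurableSet]
        refine lintegral_mono fun z => ?_
        by_cases hz : z ∈ c.target ∧ c.symm z ∈ K
        · have hzK : z ∈ c '' K := ⟨_, hz.2, c.right_inv hz.1⟩
          simp only [indicator, hz, hzK, if_true]
          gcongr
          exact (le_abs_self _).trans (hb z hzK)
        · rcases not_and_or.mp hz with hz | hz <;> simp [indicator, hz]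
    _ = _ := lintegral_const_mul' _ _ ENNReal.ofReal_ne_top

lemma exists_setLIntegral_enorm_fderiv_sq_le (g : Metric m S) (x : S) {N : Set (Coord m)}
    (hN : IsCompact N) (hNt : N ⊆ (chartAt (Coord m) x).target) :
    ∃ C : ENNReal, C ≠ ⊤ ∧ ∀ f : S → ℂ, ContMDiff (𝓡 m) 𝓘(ℝ, ℂ) ∞ f →
      ∫⁻ z in N, ‖fderiv ℝ (f ∘ (chartAt (Coord m) x).symm) z‖ₑ ^ 2
        ≤ C * ∫⁻ y, energy g f y ∂(riemVolume g) := by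
  set c := chartAt (Coord m) x
  have hcont : ContinuousOn (fun z => (chartGram g x z).trace / density g x z) N :=
    ((continuous_id.matrix_trace.comp_continuousOn (continuousOn_chartGram g x)).div
      (continuousOn_density g x) fun z hz => (density_pos g x hz).ne').mono hNt
  obtain ⟨b, hb⟩ := hN.exists_bound_of_continuousOn hcont
  refine ⟨ENNReal.ofReal b, ENNReal.ofReal_ne_top, fun f hf => ?_⟩
  calc ∫⁻ z in N, ‖fderiv ℝ (f ∘ c.symm) z‖ₑ ^ 2
      ≤ ∫⁻ z in N, ENNReal.ofReal b
          * (ENNReal.ofReal (density g x z) * energy g f (c.symm z)) := by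
        refine setLIntegral_mono' hN.measurableSet fun z hz => ?_
        have hpos := density_pos g x (hNt hz)
        refine (enorm_fderiv_sq_le_trace_mul_energy g hf x (hNt hz)).trans ?_
        rw [← mul_assoc, ← ENNReal.ofReal_mul' hpos.le]
        gcongr
        exact (div_le_iff₀ hpos).mp ((le_abs_self _).trans (hb z hz))
    _ = ENNReal.ofReal b * ∫⁻ z in N, ENNReal.ofReal (density g x z) * energy g f (c.symm z) :=
        lintegral_const_mul' _ _ ENNReal.ofReal_ne_top
    _ ≤ ENNReal.ofReal b * ∫⁻ y, energy g f y ∂(chartVolume g x) := by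
        rw [lintegral_chartVolume g x (measurable_energy g hf)]
        gcongr
    _ ≤ _ := by gcongr; exact chartVolume_le_riemVolume g x

lemma exists_forall_setLIntegral_chartVolume_le_energy (g : Metric m S) (x : S) {K : Set S}
    (hK : IsCompact K) (hKm : MeasurableSet K) (hKs : K ⊆ (chartAt (Coord m) x).source)
    {ε : ENNReal} (hε : ε ≠ 0) :
    ∃ 𝒬 : Finset (Set (Coord m)), ∀ f : S → ℂ, ContMDiff (𝓡 m) 𝓘(ℝ, ℂ) ∞ f →
      (∀ Q ∈ 𝒬, IntegrableOn (f ∘ (chartAt (Coord m) x).symm) Q) ∧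
      ((∀ Q ∈ 𝒬, ∫ z in Q, (f ∘ (chartAt (Coord m) x).symm) z = 0) →
        ∫⁻ y in K, ‖f y‖ₑ ^ 2 ∂(chartVolume g x) ≤ ε * ∫⁻ y, energy g f y ∂(riemVolume g)) := by
  set c := chartAt (Coord m) x
  have hcKt : c '' K ⊆ c.target := (image_mono hKs).trans c.image_source_eq_target.subset
  obtain ⟨N, hN, hNt, hpoincare⟩ := exists_forall_lintegral_enorm_sq_le_of_isCompact
    (hK.image_of_continuousOn (c.continuousOn.mono hKs)) c.open_target hcKt
  obtain ⟨A, hA, hAle⟩ := exists_setLIntegral_chartVolume_le g x hK hKm hKs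
  obtain ⟨B, hB, hBle⟩ := exists_setLIntegral_enorm_fderiv_sq_le g x hN hNt
  obtain ⟨𝒬, h𝒬N, h𝒬⟩ := hpoincare (ε / (A * B)) (ENNReal.div_ne_zero.mpr ⟨hε, by finiteness⟩)
  refine ⟨𝒬, fun f hf => ?_⟩
  have hu : ContDiffOn ℝ ∞ (f ∘ c.symm) c.target := contDiffOn_comp_chartAt_symm hf x
  refine ⟨fun Q hQ => ((hu.continuousOn.mono hNt).integrableOn_compact hN).mono_set (h𝒬N Q hQ),
    fun hzero => ?_⟩
  calc ∫⁻ y in K, ‖f y‖ₑ ^ 2 ∂(chartVolume g x)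
      ≤ A * ∫⁻ z in c '' K, ‖(f ∘ c.symm) z‖ₑ ^ 2 :=
        hAle _ (hf.continuous.measurable.enorm.pow_const 2)
    _ ≤ A * (ε / (A * B) * ∫⁻ z in N, ‖fderiv ℝ (f ∘ c.symm) z‖ₑ ^ 2) := by
        gcongr
        exact h𝒬 _ (hu.of_le (by simp)) hzero
    _ ≤ A * (ε / (A * B) * (B * ∫⁻ y, energy g f y ∂(riemVolume g))) := by
        gcongr
        exact hBle f hf
    _ = A * B * (ε / (A * B)) * ∫⁻ y, energy g f y ∂(riemVolume g) := by ring
    _ ≤ ε * ∫⁻ y, energy g f y ∂(riemVolume g) := by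
        gcongr
        exact ENNReal.mul_div_le

lemma exists_forall_lintegral_enorm_sq_le_energy [CompactSpace S] [T2Space S] (g : Metric m S)
    {ε : ENNReal} (hε : ε ≠ 0) :
    ∃ s : Finset (S × Set (Coord m)), ∀ f : S → ℂ, ContMDiff (𝓡 m) 𝓘(ℝ, ℂ) ∞ f →
      (∀ p ∈ s, IntegrableOn (f ∘ (chartAt (Coord m) p.1).symm) p.2) ∧
      ((∀ p ∈ s, ∫ z in p.2, (f ∘ (chartAt (Coord m) p.1).symm) z = 0) →
        ∫⁻ y, ‖f y‖ₑ ^ 2 ∂(riemVolume g) ≤ ε * ∫⁻ y, energy g f y ∂(riemVolume g)) := by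
  classical
  obtain ⟨t, K, hK, hKs, hcov⟩ := exists_compact_chart_cover (Coord m) S
  choose 𝒬 h𝒬 using fun x => exists_forall_setLIntegral_chartVolume_le_energy g x (hK x)
    (hK x).measurableSet (hKs x) (ε := ε / t.card) (ENNReal.div_ne_zero.mpr ⟨hε, by simp⟩)
  refine ⟨(t.sigma 𝒬).image fun p => (p.1, p.2), fun f hf => ?_⟩
  simp only [Finset.forall_mem_image, Finset.mem_sigma]
  refine ⟨fun p hp => (h𝒬 p.1 f hf).1 p.2 hp.2, fun hzero => ?_⟩
  calc ∫⁻ y, ‖f y‖ₑ ^ 2 ∂(riemVolume g)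
      ≤ ∫⁻ y, ‖f y‖ₑ ^ 2 ∂(∑ x ∈ t, (chartVolume g x).restrict (K x)) :=
        lintegral_mono' (riemVolume_le_sum_restrict g (fun x _ => (hK x).measurableSet)
          (fun x _ => hKs x) hcov) le_rfl
    _ = ∑ x ∈ t, ∫⁻ y in K x, ‖f y‖ₑ ^ 2 ∂(chartVolume g x) := lintegral_finsetSum_measure _ _ _
    _ ≤ ∑ _x ∈ t, ε / t.card * ∫⁻ y, energy g f y ∂(riemVolume g) :=
        Finset.sum_le_sum fun x hx => (h𝒬 x f hf).2 fun Q hQ => hzero (x := ⟨x, Q⟩) ⟨hx, hQ⟩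
    _ = t.card * (ε / t.card) * ∫⁻ y, energy g f y ∂(riemVolume g) := by
        rw [Finset.sum_const, nsmul_eq_mul, mul_assoc]
    _ ≤ ε * ∫⁻ y, energy g f y ∂(riemVolume g) := by
        gcongr
        exact ENNReal.mul_div_le

end RiemGeom

/-! ## Low eigenspaces of the Laplacian -/

lemma exists_linearMap_mem_of_forall_exists_mem {𝕜 V W X : Type*} [DivisionRing 𝕜] [AddCommGroup V]
    [Module 𝕜 V] [AddCommGroup W] [Module 𝕜 W] [AddCommGroup X] [Module 𝕜 X] (u : V →ₗ[𝕜] X)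
    (G : Submodule 𝕜 (W × X)) (h : ∀ v, ∃ w, (w, u v) ∈ G) :
    ∃ σ : V →ₗ[𝕜] W, ∀ v, (σ v, u v) ∈ G := by
  let G' : Submodule 𝕜 (W × V) := G.comap (LinearMap.id.prodMap u)
  have hsurj : Function.Surjective (LinearMap.snd 𝕜 W V ∘ₗ G'.subtype) := fun v =>
    (h v).elim fun w hw => ⟨⟨(w, v), hw⟩, rfl⟩
  obtain ⟨ρ, hρ⟩ := LinearMap.exists_rightInverse_of_surjective _ (LinearMap.range_eq_top.mpr hsurj)
  refine ⟨LinearMap.fst 𝕜 W V ∘ₗ G'.subtype ∘ₗ ρ, fun v => ?_⟩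
  have hsnd : (ρ v : W × V).2 = v := LinearMap.congr_fun hρ v
  have hmem : ((ρ v : W × V).1, u (ρ v : W × V).2) ∈ G := (ρ v).2
  rwa [hsnd] at hmem

lemma lintegral_enorm_sq_eq_enorm_sq {α E : Type*} [MeasurableSpace α] {μ : Measure α}
    [NormedAddCommGroup E] (η : Lp E 2 μ) : ∫⁻ x, ‖η x‖ₑ ^ 2 ∂μ = ‖η‖ₑ ^ 2 := by
  have h := eLpNorm_nnreal_pow_eq_lintegral (f := η) (μ := μ) (p := 2) two_ne_zero
  rw [Lp.enorm_def]
  simpa only [NNReal.coe_ofNat, ENNReal.coe_ofNat, ENNReal.rpow_ofNat] using h.symm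

namespace RiemGeom

variable {m : ℕ} {S : Type*} [TopologicalSpace S] [CompactSpace S] [T2Space S]
  [ChartedSpace (EuclideanSpace ℝ (Fin m)) S] [IsManifold (𝓡 m) ∞ S]
  [MeasurableSpace S] [BorelSpace S]

lemma integrable_riemVolume {E : Type*} [NormedAddCommGroup E] (g : Metric m S) {f : S → E}
    (hf : Continuous f) : Integrable f (riemVolume g) :=
  have _ := isFiniteMeasure_riemVolume g
  hf.integrable_of_hasCompactSupport (HasCompactSupport.of_compactSpace f)

lemma finiteDimensional_of_lintegral_energy_le (g : Metric m S) {V : Type*} [AddCommGroup V]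
    [Module ℂ V] (σ : V →ₗ[ℂ] S → ℂ) (hσ : ∀ v, ContMDiff (𝓡 m) 𝓘(ℝ, ℂ) ∞ (σ v))
    (hinj : ∀ v, σ v =ᵐ[riemVolume g] 0 → v = 0) {C : ENNReal} (hC : C ≠ ⊤)
    (henergy : ∀ v, ∫⁻ y, energy g (σ v) y ∂(riemVolume g)
      ≤ C * ∫⁻ y, ‖σ v y‖ₑ ^ 2 ∂(riemVolume g)) :
    FiniteDimensional ℂ V := by
  have hε : (C + 1)⁻¹ ≠ 0 := ENNReal.inv_ne_zero.mpr (by finiteness)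
  obtain ⟨s, hs⟩ := exists_forall_lintegral_enorm_sq_le_energy g hε
  let average : V →ₗ[ℂ] s → ℂ :=
    { toFun v p := ∫ z in p.1.2, (σ v ∘ (chartAt (Coord m) p.1.1).symm) z
      map_add' v w := funext fun p => by
        simpa using integral_add ((hs _ (hσ v)).1 _ p.2) ((hs _ (hσ w)).1 _ p.2)
      map_smul' c v := funext fun p => by
        simpa using integral_const_mul c _ }
  refine FiniteDimensional.of_injective average
    ((injective_iff_map_eq_zero average).mpr fun v hv => hinj v ?_)
  have hmeas : Measurable fun y => ‖σ v y‖ₑ ^ 2 :=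
    (hσ v).continuous.measurable.enorm.pow_const 2
  set I := ∫⁻ y, ‖σ v y‖ₑ ^ 2 ∂(riemVolume g)
  have hI : I ≠ ⊤ := by
    have hint : Integrable (fun y => ‖σ v y‖ ^ 2) (riemVolume g) :=
      integrable_riemVolume g ((hσ v).continuous.norm.pow 2)
    simpa [I] using hint.hasFiniteIntegral.ne
  have hle : I ≤ (C + 1)⁻¹ * C * I := by
    rw [mul_assoc]
    exact ((hs _ (hσ v)).2 fun p hp => congrFun hv ⟨p, hp⟩).trans (by gcongr; exact henergy v)
  have hlt : (C + 1)⁻¹ * C < 1 := by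
    rw [mul_comm, ← div_eq_mul_inv]
    exact ENNReal.div_lt_of_lt_mul (by simpa using ENNReal.lt_add_right hC one_ne_zero)
  have hI0 : I = 0 := by
    by_contra hne
    exact hle.not_gt (by simpa using ENNReal.mul_lt_mul_left hne hI hlt)
  filter_upwards [(lintegral_eq_zero_iff hmeas).mp hI0] with y hy
  simpa using hy

/-- The triples `(f, η, ζ)` such that `f` is a smooth function in the class `η ∈ L²(S)` and
`ζ = -Δ f` in the weak sense. -/
def laplaceGraph (g : Metric m S) : Submodule ℂ ((S → ℂ) × L2 g × L2 g) where
  carrier := {p | ContMDiff (𝓡 m) 𝓘(ℝ, ℂ) ∞ p.1 ∧ p.2.1 =ᵐ[riemVolume g] p.1 ∧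
    ∀ (h : S → ℂ) (θ : L2 g), ContMDiff (𝓡 m) 𝓘(ℝ, ℂ) ∞ h → θ =ᵐ[riemVolume g] h →
      ∫ x, gradInner g p.1 h x ∂(riemVolume g) = inner ℂ θ p.2.2}
  add_mem' := by
    rintro ⟨f, η, ζ⟩ ⟨f', η', ζ'⟩ ⟨hf, hη, hζ⟩ ⟨hf', hη', hζ'⟩
    refine ⟨hf.add hf', (Lp.coeFn_add η η').trans (hη.add hη'), fun h θ hh hθ => ?_⟩
    have hadd (x : S) : gradInner g (f + f') h x = gradInner g f h x + gradInner g f' h x :=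
      gradInner_add_left g h ((hf x).mdifferentiableAt (by simp))
        ((hf' x).mdifferentiableAt (by simp))
    simp only [Prod.mk_add_mk, hadd, inner_add_right]
    rw [integral_add (integrable_riemVolume g (continuous_gradInner g hf hh))
      (integrable_riemVolume g (continuous_gradInner g hf' hh)), hζ h θ hh hθ, hζ' h θ hh hθ]
  zero_mem' := by
    refine ⟨contMDiff_const (c := (0 : ℂ)), Lp.coeFn_zero _ _ _, fun h θ _ _ => ?_⟩
    have hzero (x : S) : gradInner g 0 h x = 0 := gradInner_const_left g 0 h x
    simp [hzero]
  smul_mem' := by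
    rintro c ⟨f, η, ζ⟩ ⟨hf, hη, hζ⟩
    refine ⟨contMDiff_const_smul hf c, (Lp.coeFn_smul c η).trans (hη.const_smul c),
      fun h θ hh hθ => ?_⟩
    have hsmul (x : S) : gradInner g (c • f) h x = c * gradInner g f h x :=
      gradInner_smul_left g h ((hf x).mdifferentiableAt (by simp)) c
    simp only [Prod.smul_mk, hsmul, inner_smul_right]
    rw [integral_const_mul, hζ h θ hh hθ]

lemma exists_mem_laplaceGraph_of_mem_eigenspace (g : Metric m S) {μ : ℝ} {η : L2 g}
    (hη : η ∈ eigenspace g μ) : ∃ f, (f, η, (μ : ℂ) • η) ∈ laplaceGraph g := by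
  refine Submodule.span_induction (p := fun η _ => ∃ f, (f, η, (μ : ℂ) • η) ∈ laplaceGraph g)
    ?_ ?_ ?_ ?_ hη
  · rintro η ⟨f, hf, hηf, hlap⟩
    refine ⟨f, hf, hηf, fun h θ hh hθ => ?_⟩
    simp only [hlap h hh, neg_mul, mul_assoc, integral_neg, neg_neg, integral_const_mul,
      inner_smul_right, L2.inner_def]
    congr 1
    refine integral_congr_ae ?_
    filter_upwards [hηf, hθ] with x hηx hθx
    simp [hηx, hθx]
  · exact ⟨0, by rw [smul_zero]; exact zero_mem _⟩
  · rintro η η' _ _ ⟨f, hf⟩ ⟨f', hf'⟩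
    exact ⟨f + f', by simpa using (laplaceGraph g).add_mem hf hf'⟩
  · rintro c η _ ⟨f, hf⟩
    exact ⟨c • f, by simpa [smul_comm _ c] using (laplaceGraph g).smul_mem c hf⟩

lemma lintegral_energy_of_mem_laplaceGraph (g : Metric m S) {f : S → ℂ} {η ζ : L2 g}
    (h : (f, η, ζ) ∈ laplaceGraph g) :
    ∫⁻ x, energy g f x ∂(riemVolume g) = ENNReal.ofReal (inner ℂ η ζ).re := by
  obtain ⟨hf, hη, hζ⟩ := h
  have hint : Integrable (gradInner g f f) (riemVolume g) :=
    integrable_riemVolume g (continuous_gradInner g hf hf)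
  rw [← hζ f η hf hη]
  exact (ofReal_integral_eq_lintegral_ofReal hint.re
    (Eventually.of_forall (re_gradInner_self_nonneg g f))).symm.trans
    (congrArg ENNReal.ofReal (integral_re hint))

end RiemGeom

namespace Cosmo

open RiemGeom

variable {m : ℕ} {S : Type*} [TopologicalSpace S] [CompactSpace S] [T2Space S]
  [ChartedSpace (EuclideanSpace ℝ (Fin m)) S] [IsManifold (𝓡 m) ∞ S]
  [MeasurableSpace S] [BorelSpace S]

lemma exists_mem_laplaceGraph_negLaplacian (P : Params) (g : Metric m S) (η : H0 P g) :
    ∃ f, (f, (η : L2 g), (negLaplacian P g η : L2 g)) ∈ laplaceGraph g := by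
  obtain ⟨s, v, hη, hΔη⟩ := SpectralOp.exists_sum (fun μ : LowEig P m => eigenspace g μ.1)
    (ortho P g) (fun μ => μ.1) η
  change (negLaplacian P g η : L2 g) = _ at hΔη
  choose f hf using fun μ : LowEig P m => exists_mem_laplaceGraph_of_mem_eigenspace g (v μ).2
  refine ⟨∑ μ ∈ s, f μ, ?_⟩
  rw [hη, hΔη]
  simpa [prod_mk_sum] using (laplaceGraph g).sum_mem fun μ (_ : μ ∈ s) => hf μ

theorem finiteDimensional_H0 (P : Params) (g : Metric m S) : FiniteDimensional ℂ (H0 P g) := by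
  obtain ⟨σ, hσ⟩ : ∃ σ : H0 P g →ₗ[ℂ] S → ℂ, ∀ η : H0 P g,
      (σ η, (η : L2 g), (negLaplacian P g η : L2 g)) ∈ laplaceGraph g :=
    exists_linearMap_mem_of_forall_exists_mem
      ((H0 P g).subtype.prod ((H0 P g).subtype ∘ₗ (negLaplacian P g).toLinearMap))
      (laplaceGraph g) (exists_mem_laplaceGraph_negLaplacian P g)
  have hrep (η : H0 P g) : (η : L2 g) =ᵐ[riemVolume g] σ η := (hσ η).2.1
  refine finiteDimensional_of_lintegral_energy_le g σ (fun η => (hσ η).1) (fun η hη => ?_)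
    (ENNReal.ofReal_ne_top (r := ((m : ℝ) - 1) ^ 2 / 4 / P.k)) fun η => ?_
  · exact Subtype.ext ((Lp.eq_zero_iff_ae_eq_zero).mpr ((hrep η).trans hη))
  · have hnorm : ∫⁻ x, ‖σ η x‖ₑ ^ 2 ∂(riemVolume g) = ENNReal.ofReal (‖η‖ ^ 2) := by
      rw [ENNReal.ofReal_pow (norm_nonneg _), ofReal_norm]
      refine .trans ?_ (lintegral_enorm_sq_eq_enorm_sq (η : L2 g))
      exact lintegral_congr_ae ((hrep η).mono fun x hx => by simp only [hx])
    rw [lintegral_energy_of_mem_laplaceGraph g (hσ η), hnorm, ← ENNReal.ofReal_mul' (sq_nonneg _)]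
    refine ENNReal.ofReal_le_ofReal (le_of_eq_of_le ?_
      (SpectralOp.linOp_re_inner (fun μ : LowEig P m => eigenspace g μ.1) (ortho P g) (fun μ => μ.1)
        _ (fun μ => μ.le) η))
    exact inner_re_symm (𝕜 := ℂ) _ _

lemma nontrivial_H0 [Nonempty S] (P : Params) (g : Metric m S) : Nontrivial (H0 P g) := by
  have _ := isFiniteMeasure_riemVolume g
  let one : L2 g := (memLp_const (1 : ℂ)).toLp fun _ => (1 : ℂ)
  have hone : one =ᵐ[riemVolume g] fun _ => (1 : ℂ) := MemLp.coeFn_toLp _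
  have hmem : one ∈ eigenspace g 0 := Submodule.subset_span
    ⟨_, contMDiff_const, hone, fun h _ => by simp [gradInner_const_left]⟩
  have hlow : P.muBar m 0 ≤ 0 := by
    have := sq_nonneg ((m : ℝ) - 1)
    rw [Params.muBar]
    linarith
  refine ⟨⟨⟨one, le_iSup (fun μ : LowEig P m => eigenspace g μ.1) ⟨0, le_rfl, hlow⟩ hmem⟩, 0,
    fun h => riemVolume_ne_zero g ?_⟩⟩
  have hzero : one =ᵐ[riemVolume g] 0 := Lp.eq_zero_iff_ae_eq_zero.mp (congrArg Subtype.val h)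
  have hfalse : ∀ᵐ _ ∂(riemVolume g), False := by
    filter_upwards [hone, hzero] with x hx hx'
    simp [hx] at hx'
  simpa using hfalse

end Cosmo

/-! ## Multiplication operators on the form space -/

namespace Radial

variable {F : Type*} [NormedAddCommGroup F] [InnerProductSpace ℂ F] {T : AngularOp F} {M : Model}

lemma TestSpace.continuous_of_continuousOn {G : Type*} [NormedAddCommGroup G] (φ : TestSpace T M)
    {h : ℝ → G} (hc : ContinuousOn h (Ioi 0)) (h0 : ∀ r, r ∉ tsupport φ.fn → h r = 0) :
    Continuous h := by
  refine continuous_iff_continuousAt.mpr fun r => ?_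
  by_cases hr : r ∈ tsupport φ.fn
  · exact hc.continuousAt (Ioi_mem_nhds (M.interval_subset (φ.tsupport_subset hr)))
  · refine continuousAt_const.congr (f := fun _ => 0) ?_
    filter_upwards [(isClosed_tsupport φ.fn).isOpen_compl.mem_nhds hr] with s hs
    exact (h0 s hs).symm

lemma TestSpace.memLp_of_continuousOn (φ : TestSpace T M) {h : ℝ → F}
    (hc : ContinuousOn h (Ioi 0)) (h0 : ∀ r, r ∉ tsupport φ.fn → h r = 0) :
    MemLp h 2 (radialMeasure M) :=
  (φ.continuous_of_continuousOn hc h0).memLp_of_hasCompactSupport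
    (φ.compact.mono' fun r => not_imp_comm.mp (h0 r))

lemma integral_inner_eq_inner_toLp {h : ℝ → F} (hh : MemLp h 2 (radialMeasure M))
    (u : WaveSpace F M) :
    ∫ r, inner ℂ (h r) (u r) ∂(radialMeasure M) = inner ℂ (hh.toLp h) u := by
  rw [L2.inner_def]
  refine integral_congr_ae ?_
  filter_upwards [hh.coeFn_toLp] with r hr
  rw [hr]

lemma inner_toLp_toLp {h k : ℝ → F} (hh : MemLp h 2 (radialMeasure M))
    (hk : MemLp k 2 (radialMeasure M)) :
    inner ℂ (hh.toLp h) (hk.toLp k) = ∫ r in M.interval, (r : ℂ) * inner ℂ (h r) (k r) := by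
  rw [← integral_inner_eq_inner_toLp]
  simp only [← Complex.real_smul, ← integral_radialMeasure]
  refine integral_congr_ae ?_
  filter_upwards [hk.coeFn_toLp] with r hr
  rw [hr]

lemma norm_toLp_sq {h : ℝ → F} (hh : MemLp h 2 (radialMeasure M)) :
    ‖hh.toLp h‖ ^ 2 = ∫ r in M.interval, r * ‖h r‖ ^ 2 := by
  have hinner := inner_toLp_toLp hh hh
  simp only [inner_self_eq_norm_sq_to_K, Complex.coe_algebraMap] at hinner
  exact_mod_cast hinner

/-- Continuous functions on the interval of a model for which `ψ ↦ p ψ` is bounded from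
`H_i(I_i)` to `H(I_i, 1)`: at most linear growth, and boundedness if the scalar product has no
`r³` term. -/
structure Multiplier (M : Model) where
  fn : ℝ → ℝ
  continuous : Continuous fn
  bound : ∃ C : ℝ, 0 ≤ C ∧ ∀ r ∈ M.interval, fn r ^ 2 ≤ C * (1 + M.weight * r ^ 2)

/-- The constant multiplier `1`, which gives the embedding of `H_i(I_i)` into `H(I_i, 1)`. -/
def Multiplier.one (M : Model) : Multiplier M where
  fn _ := 1
  continuous := continuous_const
  bound := ⟨1, one_pos.le, fun r _ => by nlinarith [M.weight_nonneg, sq_nonneg r]⟩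

lemma TestSpace.memLp_smul (φ : TestSpace T M) {p : ℝ → ℝ} (hp : Continuous p) :
    MemLp (fun r => p r • φ.fn r) 2 (radialMeasure M) :=
  φ.memLp_of_continuousOn (hp.smul φ.contDiff.continuous).continuousOn
    fun r hr => by rw [φ.fn_zero_of hr, smul_zero]

/-- Multiplication by `p` on test functions, with values in `H(I_i, 1)`. -/
def mulTest (T : AngularOp F) (M : Model) (p : Multiplier M) :
    TestSpace T M →ₗ[ℂ] WaveSpace F M where
  toFun φ := (φ.memLp_smul p.continuous).toLp _
  map_add' φ χ := by
    rw [← MemLp.toLp_add]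
    exact MemLp.toLp_congr _ _ (ae_of_all _ fun r => smul_add (p.fn r) (φ.fn r) (χ.fn r))
  map_smul' c φ := by
    rw [RingHom.id_apply, ← MemLp.toLp_const_smul]
    exact MemLp.toLp_congr _ _ (ae_of_all _ fun r => smul_comm (p.fn r) c (φ.fn r))

lemma mulTest_apply (p : Multiplier M) (φ : TestSpace T M) :
    mulTest T M p φ = (φ.memLp_smul p.continuous).toLp _ := rfl

lemma mulTest_one : mulTest T M (.one M) = testIncl T M :=
  LinearMap.ext fun φ => MemLp.toLp_congr (φ.memLp_smul continuous_const) φ.memLp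
    (ae_of_all _ fun r => one_smul ℝ (φ.fn r))

lemma norm_sq_mulTest (p : Multiplier M) (φ : TestSpace T M) :
    ‖mulTest T M p φ‖ ^ 2 = ∫ r in M.interval, r * p.fn r ^ 2 * ‖φ.fn r‖ ^ 2 := by
  rw [mulTest_apply, norm_toLp_sq]
  simp only [norm_smul, mul_pow, mul_assoc, Real.norm_eq_abs, sq_abs]

lemma inner_toLp_mulTest {h : ℝ → F} (hh : MemLp h 2 (radialMeasure M)) (p : Multiplier M)
    (φ : TestSpace T M) : inner ℂ (hh.toLp h) (mulTest T M p φ)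
      = ∫ r in M.interval, ((r * p.fn r : ℝ) : ℂ) * inner ℂ (h r) (φ.fn r) := by
  rw [mulTest_apply, inner_toLp_toLp]
  simp only [inner_smul_right_eq_smul, Complex.real_smul, Complex.ofReal_mul, mul_assoc]

lemma setIntegral_mul_norm_sq_mono (φ : TestSpace T M) {u v : ℝ → ℝ} (hu : Continuous u)
    (hv : Continuous v) (huv : ∀ r ∈ M.interval, u r ≤ v r) :
    ∫ r in M.interval, u r * ‖φ.fn r‖ ^ 2 ≤ ∫ r in M.interval, v r * ‖φ.fn r‖ ^ 2 :=
  setIntegral_mono_on (integrable_weight φ u hu).integrableOn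
    (integrable_weight φ v hv).integrableOn M.measurableSet_interval
    fun r hr => mul_le_mul_of_nonneg_right (huv r hr) (sq_nonneg _)

lemma integral_deriv_add_integral_weight_le (φ : TestSpace T M) :
    (∫ r in M.interval, r * ‖deriv φ.fn r‖ ^ 2)
      + ∫ r in M.interval, M.weight * r ^ 3 * ‖φ.fn r‖ ^ 2 ≤ ‖φ‖ ^ 2 := by
  rw [← integral_add (integrable_deriv φ).integrableOn
    (integrable_weight φ _ (by fun_prop)).integrableOn]
  exact norm_sq_ge φ

lemma integral_weight_le (φ : TestSpace T M) :
    ∫ r in M.interval, M.weight * r ^ 3 * ‖φ.fn r‖ ^ 2 ≤ ‖φ‖ ^ 2 := by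
  have hderiv : 0 ≤ ∫ r in M.interval, r * ‖deriv φ.fn r‖ ^ 2 :=
    setIntegral_nonneg M.measurableSet_interval fun r hr =>
      mul_nonneg (M.interval_subset hr).le (sq_nonneg _)
  linarith [integral_deriv_add_integral_weight_le φ]

lemma integral_deriv_le (φ : TestSpace T M) :
    ∫ r in M.interval, r * ‖deriv φ.fn r‖ ^ 2 ≤ ‖φ‖ ^ 2 := by
  have hweight : 0 ≤ ∫ r in M.interval, M.weight * r ^ 3 * ‖φ.fn r‖ ^ 2 :=
    setIntegral_nonneg M.measurableSet_interval fun r hr =>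
      mul_nonneg (mul_nonneg M.weight_nonneg (pow_nonneg (M.interval_subset hr).le 3))
        (sq_nonneg _)
  linarith [integral_deriv_add_integral_weight_le φ]

lemma exists_norm_mulTest_le (T : AngularOp F) (M : Model) (p : Multiplier M) :
    ∃ C : ℝ, ∀ φ : TestSpace T M, ‖mulTest T M p φ‖ ≤ C * ‖φ‖ := by
  obtain ⟨K, hK⟩ := testIncl_bound T M
  obtain ⟨C, hC, hp⟩ := p.bound
  refine ⟨Real.sqrt (C * (K ^ 2 + 1)), fun φ => le_of_sq_le_sq ?_ (by positivity)⟩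
  rw [mul_pow, Real.sq_sqrt (by positivity), mul_assoc]
  have hcont := p.continuous
  have hincl : ‖testIncl T M φ‖ ^ 2 ≤ (K * ‖φ‖) ^ 2 := by gcongr; exact hK φ
  calc ‖mulTest T M p φ‖ ^ 2
      ≤ ∫ r in M.interval, C * (r + M.weight * r ^ 3) * ‖φ.fn r‖ ^ 2 := by
        rw [norm_sq_mulTest]
        refine setIntegral_mul_norm_sq_mono φ (by fun_prop) (by fun_prop) fun r hr => ?_
        linarith [mul_le_mul_of_nonneg_left (hp r hr) (M.interval_subset hr).le]
    _ = C * (‖testIncl T M φ‖ ^ 2 + ∫ r in M.interval, M.weight * r ^ 3 * ‖φ.fn r‖ ^ 2) := by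
        rw [norm_sq_testIncl,
          ← integral_add (integrable_weight φ (fun r => r) (by fun_prop)).integrableOn
          (integrable_weight φ _ (by fun_prop)).integrableOn, ← integral_const_mul]
        simp only [add_mul, mul_assoc]
    _ ≤ C * ((K ^ 2 + 1) * ‖φ‖ ^ 2) := by
        gcongr
        linarith [integral_weight_le φ]

lemma formSpace_ext {ψ χ : FormSpace T M}
    (h : ∀ φ : TestSpace T M, inner ℂ (φ : FormSpace T M) ψ = inner ℂ (φ : FormSpace T M) χ) :
    ψ = χ :=
  UniformSpace.Completion.denseRange_coe.eq_of_inner_right ℂ h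

section Complete

variable [CompleteSpace F]

/-- Multiplication by `p` as an operator from `H_i(I_i)` to `H(I_i, 1)`. -/
def mulOp (T : AngularOp F) (M : Model) (p : Multiplier M) : FormSpace T M →L[ℂ] WaveSpace F M :=
  (mulTest T M p).extendOfNorm
    (UniformSpace.Completion.toComplL : TestSpace T M →L[ℂ] FormSpace T M).toLinearMap

lemma mulOp_coe (p : Multiplier M) (φ : TestSpace T M) :
    mulOp T M p (φ : FormSpace T M) = mulTest T M p φ :=
  LinearMap.extendOfNorm_eq UniformSpace.Completion.denseRange_coe
    ((exists_norm_mulTest_le T M p).imp fun C hC φ =>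
      (hC φ).trans_eq (congrArg (C * ·) (UniformSpace.Completion.norm_coe φ).symm)) φ

lemma embed_eq_mulOp_one : embed T M = mulOp T M (.one M) :=
  UniformSpace.Completion.ext UniformSpace.Completion.continuous_extension
    (mulOp T M (.one M)).continuous fun φ => by rw [embed_coe, mulOp_coe, mulTest_one]

/-- The operator on `H_i(I_i)` that represents the quadratic form `∫ r p² ‖ψ‖² dr`. -/
def gram (T : AngularOp F) (M : Model) (p : Multiplier M) : FormSpace T M →L[ℂ] FormSpace T M :=
  (mulOp T M p).adjoint ∘L mulOp T M p

lemma isPositive_gram (p : Multiplier M) : (gram T M p).IsPositive :=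
  ContinuousLinearMap.isPositive_adjoint_comp_self _

lemma re_inner_gram_self (p : Multiplier M) (ψ : FormSpace T M) :
    (inner ℂ (gram T M p ψ) ψ).re = ‖mulOp T M p ψ‖ ^ 2 := by
  rw [gram, ContinuousLinearMap.comp_apply, ContinuousLinearMap.adjoint_inner_left]
  exact inner_self_eq_norm_sq (𝕜 := ℂ) _

lemma adjoint_embed_sq_smul (p : Multiplier M) (φ : TestSpace T M) :
    (mulOp T M (.one M)).adjoint
        ((φ.memLp_smul (p := fun r => p.fn r ^ 2) (p.continuous.pow 2)).toLp _)
      = gram T M p (φ : FormSpace T M) := by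
  refine formSpace_ext fun χ => ?_
  rw [gram, ContinuousLinearMap.comp_apply, ContinuousLinearMap.adjoint_inner_right,
    ContinuousLinearMap.adjoint_inner_right, ← inner_conj_symm, ← inner_conj_symm (mulOp T M p χ),
    mulOp_coe, mulOp_coe, mulOp_coe, mulTest_apply p φ, inner_toLp_mulTest, inner_toLp_mulTest]
  simp only [Multiplier.one, inner_smul_left_eq_smul, Complex.real_smul]
  push_cast
  congr! 3 with r
  ring

end Complete

/-! ## The eigenvalue problem as an operator pencil -/

lemma TestSpace.contDiff_smul_deriv (φ : TestSpace T M) :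
    ContDiff ℝ 1 fun s : ℝ => s • deriv φ.fn s :=
  contDiff_id.smul ((contDiff_infty_iff_deriv.mp φ.contDiff).2.of_le (by simp))

lemma TestSpace.deriv_smul_deriv_zero_of (φ : TestSpace T M) {r : ℝ} (hr : r ∉ tsupport φ.fn) :
    deriv (fun s : ℝ => s • deriv φ.fn s) r = 0 := by
  have hzero : (fun s : ℝ => s • deriv φ.fn s) =ᶠ[𝓝 r] fun _ => 0 := by
    filter_upwards [(isClosed_tsupport φ.fn).isOpen_compl.mem_nhds hr] with s hs
    rw [φ.deriv_zero_of hs, smul_zero]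
  rw [hzero.deriv_eq, deriv_const]

lemma integral_inner_deriv_smul_deriv (φ χ : TestSpace T M) :
    ∫ r in M.interval, (inner ℂ (deriv (fun s : ℝ => s • deriv φ.fn s) r) (χ.fn r)
      + (r : ℂ) * inner ℂ (deriv φ.fn r) (deriv χ.fn r)) = 0 := by
  have hflux := φ.contDiff_smul_deriv.continuous_deriv le_rfl
  have hφ' := φ.continuous_deriv
  have hχ' := χ.continuous_deriv
  have hχ := χ.contDiff.continuous
  rw [setIntegral_eq_integral_of_forall_compl_eq_zero fun r hr => ?vanish]
  case vanish =>
    have hr' : r ∉ tsupport χ.fn := fun h => hr (χ.tsupport_subset h)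
    rw [χ.fn_zero_of hr', χ.deriv_zero_of hr', inner_zero_right, inner_zero_right, mul_zero,
      add_zero]
  refine integral_eq_zero_of_hasDerivAt_of_integrable
    (f := fun r => inner ℂ (r • deriv φ.fn r) (χ.fn r)) (fun r => ?_)
    (integrable_of_support χ _ (Continuous.continuousOn (by fun_prop)) fun r hr => ?_)
    (integrable_of_support χ _ (Continuous.continuousOn (by fun_prop)) fun r hr => ?_)
  · have hderiv := ((φ.contDiff_smul_deriv.differentiable one_ne_zero r).hasDerivAt).inner ℂ
      (χ.diff r).hasDerivAt
    rwa [inner_smul_left_eq_smul, Complex.real_smul, add_comm] at hderiv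
  · rw [χ.fn_zero_of hr, χ.deriv_zero_of hr, inner_zero_right, inner_zero_right, mul_zero, add_zero]
  · rw [χ.fn_zero_of hr, inner_zero_right]

lemma hamiltonian_zero_of (q : ℝ → ℝ) (φ : TestSpace T M) {r : ℝ} (hr : r ∉ tsupport φ.fn) :
    hamiltonian q φ r = 0 := by
  simp [hamiltonian, φ.deriv_smul_deriv_zero_of hr, φ.fn_zero_of hr]

lemma continuousOn_hamiltonian {q : ℝ → ℝ} (hq : Continuous q) (φ : TestSpace T M) :
    ContinuousOn (hamiltonian q φ) (Ioi 0) := by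
  have hflux := φ.contDiff_smul_deriv.continuous_deriv le_rfl
  have hφ := φ.contDiff.continuous
  have hinv : ContinuousOn (fun r : ℝ => r⁻¹) (Ioi 0) :=
    continuousOn_inv₀.mono fun r hr => ne_of_gt hr
  have hinv_sq : ContinuousOn (fun r : ℝ => (r ^ 2)⁻¹) (Ioi 0) :=
    (continuousOn_pow 2).inv₀ fun r hr => pow_ne_zero 2 (ne_of_gt hr)
  exact (((hinv.smul hflux.continuousOn).neg).sub
    (hinv_sq.smul (T.op.continuous.comp hφ).continuousOn)).add (hq.smul hφ).continuousOn

/-- The operator that belongs to the scalar product of `H_i(I_i)`. -/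
abbrev formHamiltonian (φ : TestSpace T M) : ℝ → F := hamiltonian (fun r => M.weight * r ^ 2) φ

lemma memLp_smul_formHamiltonian (φ : TestSpace T M) {p : ℝ → ℝ} (hp : ContinuousOn p (Ioi 0)) :
    MemLp (fun r => p r • formHamiltonian φ r) 2 (radialMeasure M) :=
  φ.memLp_of_continuousOn (hp.smul (continuousOn_hamiltonian (by fun_prop) φ)) fun r hr => by
    rw [formHamiltonian, hamiltonian_zero_of _ φ hr, smul_zero]

lemma memLp_formHamiltonian (φ : TestSpace T M) :
    MemLp (formHamiltonian φ) 2 (radialMeasure M) :=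
  φ.memLp_of_continuousOn (continuousOn_hamiltonian (by fun_prop) φ)
    fun _ hr => hamiltonian_zero_of _ φ hr

lemma integral_inner_formHamiltonian (φ χ : TestSpace T M) :
    ∫ r in M.interval, (r : ℂ) * inner ℂ (formHamiltonian φ r) (χ.fn r) = inner ℂ φ χ := by
  rw [TestSpace.inner_def, ← sub_eq_zero, ← integral_sub, ← neg_eq_zero, ← integral_neg,
    ← integral_inner_deriv_smul_deriv φ χ]
  · refine setIntegral_congr_fun M.measurableSet_interval fun r hr => ?_
    have hr0 : (r : ℂ) ≠ 0 := by exact_mod_cast (M.interval_subset hr : 0 < r).ne'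
    simp only [hamiltonian, formDensity, inner_add_left, inner_sub_left, inner_neg_left,
      inner_smul_left_eq_smul, Complex.real_smul]
    push_cast
    field_simp
    ring
  · refine (integrable_of_support χ _ ?_ fun r hr => ?_).integrableOn
    · exact Complex.continuous_ofReal.continuousOn.mul
        ((continuousOn_hamiltonian (by fun_prop) φ).inner χ.contDiff.continuous.continuousOn)
    · rw [χ.fn_zero_of hr, inner_zero_right, mul_zero]
  · exact (integrable_formDensity φ χ).integrableOn

lemma Model.isOpen_interval (M : Model) : IsOpen M.interval := by
  cases M with
  | bounded r₀ => exact isOpen_Ioo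
  | unbounded => exact isOpen_Ioi

lemma ae_mem_interval (M : Model) : ∀ᵐ r ∂(radialMeasure M), r ∈ M.interval :=
  (withDensity_absolutelyContinuous _ _).ae_le (ae_restrict_mem M.measurableSet_interval)

section Complete

variable [CompleteSpace F]

lemma adjoint_mulOp_inv_smul_formHamiltonian (p : Multiplier M) (hp : ∀ r, 0 < r → p.fn r ≠ 0)
    (φ : TestSpace T M) :
    (mulOp T M p).adjoint
      ((memLp_smul_formHamiltonian φ (p := fun r => (p.fn r)⁻¹)
        (p.continuous.continuousOn.inv₀ hp)).toLp _) = φ := by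
  refine formSpace_ext fun χ => ?_
  rw [ContinuousLinearMap.adjoint_inner_right, mulOp_coe, ← inner_conj_symm, inner_toLp_mulTest,
    ← inner_conj_symm (χ : FormSpace T M), UniformSpace.Completion.inner_coe,
    ← integral_inner_formHamiltonian]
  congr 1
  refine setIntegral_congr_fun M.measurableSet_interval fun r hr => ?_
  have hpr : (p.fn r : ℂ) ≠ 0 := by exact_mod_cast hp r (M.interval_subset hr)
  simp only [inner_smul_left_eq_smul, Complex.real_smul]
  push_cast
  field_simp

lemma adjoint_embed_formHamiltonian (φ : TestSpace T M) :
    (mulOp T M (.one M)).adjoint ((memLp_formHamiltonian φ).toLp _) = φ := by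
  rw [← adjoint_mulOp_inv_smul_formHamiltonian (.one M) (fun _ _ => one_ne_zero) φ]
  refine congrArg _ (MemLp.toLp_congr _ _ (ae_of_all _ fun r => ?_))
  simp only [Multiplier.one, inv_one, one_smul]

lemma mulOp_injective (p : Multiplier M) (hp : ∀ r, 0 < r → p.fn r ≠ 0) :
    Function.Injective (mulOp T M p) := by
  refine (injective_iff_map_eq_zero _).mpr fun ψ hψ => formSpace_ext fun φ => ?_
  rw [← adjoint_mulOp_inv_smul_formHamiltonian p hp φ, ContinuousLinearMap.adjoint_inner_left, hψ,
    inner_zero_right, inner_zero_right]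

lemma gram_injective (p : Multiplier M) (hp : ∀ r, 0 < r → p.fn r ≠ 0) :
    Function.Injective (gram T M p) :=
  (mulOp T M p).adjoint_comp_self_injective_iff.mpr (mulOp_injective p hp)

lemma integral_inner_embed {h : ℝ → F} (hh : MemLp h 2 (radialMeasure M)) (ψ : FormSpace T M) :
    ∫ r, inner ℂ (h r) (embed T M ψ r) ∂(radialMeasure M)
      = inner ℂ ((mulOp T M (.one M)).adjoint (hh.toLp h)) ψ := by
  rw [integral_inner_eq_inner_toLp hh, embed_eq_mulOp_one, ContinuousLinearMap.adjoint_inner_left]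

/-- The operator on `H_i(I_i)` that represents the quadratic form of `hamiltonian q` for the
potential `q = weight r² + α p² + β s²`. -/
def hamiltonianOp (T : AngularOp F) (M : Model) (p s : Multiplier M) (α β : ℝ) :
    FormSpace T M →L[ℂ] FormSpace T M :=
  1 + (α : ℂ) • gram T M p + (β : ℂ) • gram T M s

lemma isSelfAdjoint_hamiltonianOp (p s : Multiplier M) (α β : ℝ) :
    IsSelfAdjoint (hamiltonianOp T M p s α β) :=
  ((IsSelfAdjoint.one _).add
    (IsSelfAdjoint.smul (Complex.conj_ofReal α) (isPositive_gram p).isSelfAdjoint)).add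
    (IsSelfAdjoint.smul (Complex.conj_ofReal β) (isPositive_gram s).isSelfAdjoint)

lemma re_inner_hamiltonianOp_self (p s : Multiplier M) (α β : ℝ) (ψ : FormSpace T M) :
    (inner ℂ (hamiltonianOp T M p s α β ψ) ψ).re
      = ‖ψ‖ ^ 2 + α * ‖mulOp T M p ψ‖ ^ 2 + β * ‖mulOp T M s ψ‖ ^ 2 := by
  simp only [hamiltonianOp, add_apply, smul_apply,
    one_apply_eq_self, inner_add_left, inner_smul_left, Complex.conj_ofReal,
    Complex.add_re, Complex.re_ofReal_mul, re_inner_gram_self]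
  rw [← inner_self_eq_norm_sq (𝕜 := ℂ) ψ, RCLike.re_to_complex]

lemma integral_inner_hamiltonian (p s : Multiplier M) {q : ℝ → ℝ} {α β : ℝ}
    (hq : ∀ r ∈ M.interval, q r = M.weight * r ^ 2 + α * p.fn r ^ 2 + β * s.fn r ^ 2)
    (φ : TestSpace T M) (ψ : FormSpace T M) :
    ∫ r, inner ℂ (hamiltonian q φ r) (embed T M ψ r) ∂(radialMeasure M)
      = inner ℂ (φ : FormSpace T M) (hamiltonianOp T M p s α β ψ) := by
  have hform := memLp_formHamiltonian φ
  have hpφ := φ.memLp_smul (p := fun r => p.fn r ^ 2) (p.continuous.pow 2)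
  have hsφ := φ.memLp_smul (p := fun r => s.fn r ^ 2) (s.continuous.pow 2)
  have hsum : (fun r => hamiltonian q φ r) =ᵐ[radialMeasure M] formHamiltonian φ
      + (α : ℂ) • (fun r => p.fn r ^ 2 • φ.fn r) + (β : ℂ) • fun r => s.fn r ^ 2 • φ.fn r := by
    filter_upwards [ae_mem_interval M] with r hr
    simp only [hamiltonian, hq r hr, Pi.add_apply, Pi.smul_apply, Complex.coe_smul, add_smul,
      mul_smul]
    abel
  rw [← (isSelfAdjoint_hamiltonianOp p s α β).isSymmetric.apply_clm,
    integral_congr_ae (hsum.mono fun r hr => congrArg (inner ℂ · (embed T M ψ r)) hr),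
    integral_inner_embed ((hform.add (hpφ.const_smul _)).add (hsφ.const_smul _)),
    MemLp.toLp_add (hform.add (hpφ.const_smul _)) (hsφ.const_smul _),
    MemLp.toLp_add hform (hpφ.const_smul _), MemLp.toLp_const_smul _ hpφ,
    MemLp.toLp_const_smul _ hsφ]
  simp only [map_add, map_smul, adjoint_embed_formHamiltonian, adjoint_embed_sq_smul]
  rfl

lemma integral_inner_smul_weight (p : Multiplier M) {w : ℝ → ℝ} {γ : ℝ}
    (hw : ∀ r ∈ M.interval, w r = γ * p.fn r ^ 2) (φ : TestSpace T M) (ψ : FormSpace T M) :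
    ∫ r, inner ℂ (w r • φ.fn r) (embed T M ψ r) ∂(radialMeasure M)
      = inner ℂ (φ : FormSpace T M) ((γ : ℂ) • gram T M p ψ) := by
  have hweight : (fun r => inner ℂ (w r • φ.fn r) (embed T M ψ r)) =ᵐ[radialMeasure M] fun r =>
      (γ : ℂ) * inner ℂ (p.fn r ^ 2 • φ.fn r) (embed T M ψ r) := by
    filter_upwards [ae_mem_interval M] with r hr
    simp only [hw r hr, inner_smul_left_eq_smul, Complex.real_smul, mul_smul]
  rw [integral_congr_ae hweight, integral_const_mul,
    integral_inner_embed (φ.memLp_smul (p := fun r => p.fn r ^ 2) (p.continuous.pow 2)),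
    adjoint_embed_sq_smul, inner_smul_right,
    (isPositive_gram p).isSelfAdjoint.isSymmetric.apply_clm]

lemma isEigenpair_iff_pencil (p s : Multiplier M) {q w : ℝ → ℝ} {α β γ l : ℝ}
    (hq : ∀ r ∈ M.interval, q r = M.weight * r ^ 2 + α * p.fn r ^ 2 + β * s.fn r ^ 2)
    (hw : ∀ r ∈ M.interval, w r = γ * p.fn r ^ 2) (ψ : FormSpace T M) :
    IsEigenpair q w l ψ ↔
      hamiltonianOp T M p s α β ψ = (l : ℂ) • ((γ : ℂ) • gram T M p) ψ := by
  simp only [IsEigenpair, integral_inner_hamiltonian p s hq, integral_inner_smul_weight p hw,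
    ← inner_smul_right]
  exact ⟨formSpace_ext, fun h φ => congrArg _ h⟩

end Complete

/-! ## Density of the form space -/

/-- The test function `f u` for a bump function `f` on the interval of the model. -/
def TestSpace.cutoff (T : AngularOp F) {f : ℝ → ℝ} (hf : ContDiff ℝ ∞ f) (hc : HasCompactSupport f)
    (hs : tsupport f ⊆ M.interval) {u : ℝ → F} (hu : ContDiff ℝ ∞ u) : TestSpace T M :=
  ⟨fun r => f r • u r, hf.smul hu, hc.smul_right, (tsupport_smul_subset_left f u).trans hs⟩

section Complete

variable [CompleteSpace F]

lemma denseRange_mulOp_one : DenseRange (mulOp T M (.one M)) := by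
  suffices h : (mulOp T M (.one M)).range.topologicalClosure = ⊤ from
    Submodule.dense_iff_topologicalClosure_eq_top.mpr h
  refine (Submodule.topologicalClosure_eq_top_iff).mpr ((Submodule.eq_bot_iff _).mpr fun u hu => ?_)
  have hloc : LocallyIntegrable u (radialMeasure M) := (Lp.memLp u).locallyIntegrable one_le_two
  have hzero : ∀ᵐ r ∂(radialMeasure M), r ∈ M.interval → u r = 0 := by
    refine M.isOpen_interval.ae_eq_zero_of_integral_contDiff_smul_eq_zero
      (hloc.locallyIntegrableOn _) fun f hf hc hs => ext_inner_left ℂ fun v => ?_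
    let φ : TestSpace T M := .cutoff T hf hc hs contDiff_const (u := fun _ => v)
    have horth : inner ℂ (mulOp T M (.one M) φ) u = 0 := hu _ ⟨φ, rfl⟩
    rw [mulOp_coe, mulTest_one] at horth
    rw [inner_zero_right, ← horth,
      ← integral_inner (hloc.integrable_smul_left_of_hasCompactSupport hf.continuous hc)]
    refine (integral_congr_ae (ae_of_all _ fun r => ?_)).trans
      (integral_inner_eq_inner_toLp φ.memLp u)
    change inner ℂ v (f r • u r) = inner ℂ (f r • v) (u r)
    rw [inner_smul_left_eq_smul, inner_smul_right_eq_smul]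
  refine Lp.eq_zero_iff_ae_eq_zero.mpr ?_
  filter_upwards [hzero, ae_mem_interval M] with r hr hrI using hr hrI

lemma topologicalClosure_span_range_embed {ι : Type*} {ψ : ι → FormSpace T M}
    (hψ : (Submodule.span ℂ (range ψ)).topologicalClosure = ⊤) :
    (Submodule.span ℂ (range fun j => embed T M (ψ j))).topologicalClosure = ⊤ := by
  have hrange : (range fun j => embed T M (ψ j)) = mulOp T M (.one M) '' range ψ := by
    rw [embed_eq_mulOp_one, ← range_comp]
    rfl
  rw [hrange, ← ContinuousLinearMap.coe_coe, Submodule.span_image]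
  exact denseRange_mulOp_one.topologicalClosure_map_submodule hψ

end Complete

/-! ## Evaluation at points -/

lemma setIntegral_le_setIntegral_interval (φ : TestSpace T M) {h : ℝ → ℝ} (hi : Integrable h)
    (h0 : ∀ r, r ∉ tsupport φ.fn → h r = 0) (hpos : ∀ r, 0 < r → 0 ≤ h r) {A : Set ℝ}
    (hA : A ⊆ Ioi 0) : ∫ r in A, h r ≤ ∫ r in M.interval, h r := by
  have hinterval : ∫ r in M.interval, h r = ∫ r in Ioi 0, h r :=
    (setIntegral_eq_of_subset_of_forall_sdiff_eq_zero measurableSet_Ioi M.interval_subset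
      fun r hr => h0 r fun hsupp => hr.2 (φ.tsupport_subset hsupp)).symm
  rw [hinterval]
  exact setIntegral_mono_set hi.integrableOn (ae_restrict_of_forall_mem measurableSet_Ioi hpos)
    hA.eventuallyLE

lemma setIntegral_mul_norm_sq_le (φ : TestSpace T M) {A : Set ℝ} (hA : A ⊆ Ioi 0) :
    ∫ r in A, r * ‖φ.fn r‖ ^ 2 ≤ ‖testIncl T M φ‖ ^ 2 := by
  rw [norm_sq_testIncl]
  exact setIntegral_le_setIntegral_interval φ (integrable_weight φ (fun r => r) continuous_id)
    (fun r hr => by rw [φ.fn_zero_of hr, norm_zero, zero_pow two_ne_zero, mul_zero])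
    (fun r hr => by positivity) hA

lemma setIntegral_mul_norm_deriv_sq_le (φ : TestSpace T M) {A : Set ℝ} (hA : A ⊆ Ioi 0) :
    ∫ r in A, r * ‖deriv φ.fn r‖ ^ 2 ≤ ‖φ‖ ^ 2 :=
  (setIntegral_le_setIntegral_interval φ (integrable_deriv φ)
    (fun r hr => by rw [φ.deriv_zero_of hr, norm_zero, zero_pow two_ne_zero, mul_zero])
    (fun r hr => by positivity) hA).trans (integral_deriv_le φ)

lemma hasDerivAt_norm_sq (φ : TestSpace T M) (r : ℝ) :
    HasDerivAt (fun r => ‖φ.fn r‖ ^ 2) (2 * (inner ℂ (φ.fn r) (deriv φ.fn r)).re) r := by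
  let := InnerProductSpace.rclikeToReal ℂ F
  exact (φ.diff r).hasDerivAt.norm_sq

lemma continuous_re_inner_deriv (φ : TestSpace T M) :
    Continuous fun r => (inner ℂ (φ.fn r) (deriv φ.fn r)).re :=
  Complex.continuous_re.comp (φ.contDiff.continuous.inner φ.continuous_deriv)

lemma abs_re_inner_deriv_le (φ : TestSpace T M) (r : ℝ) :
    |(inner ℂ (φ.fn r) (deriv φ.fn r)).re| ≤ ‖φ.fn r‖ * ‖deriv φ.fn r‖ :=
  (Complex.abs_re_le_norm _).trans (norm_inner_le_norm _ _)

lemma integral_Ioi_re_inner_deriv (φ : TestSpace T M) (x : ℝ) :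
    ∫ r in Ioi x, 2 * (inner ℂ (φ.fn r) (deriv φ.fn r)).re = -‖φ.fn x‖ ^ 2 := by
  have hcont := continuous_re_inner_deriv φ
  have hderiv : deriv (fun r => ‖φ.fn r‖ ^ 2) =
      fun r => 2 * (inner ℂ (φ.fn r) (deriv φ.fn r)).re :=
    funext fun r => (hasDerivAt_norm_sq φ r).deriv
  rw [← hderiv, HasCompactSupport.integral_Ioi_deriv_eq
    (contDiff_one_iff_deriv.mpr ⟨fun r => (hasDerivAt_norm_sq φ r).differentiableAt,
      hderiv ▸ hcont.const_mul 2⟩)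
    (φ.compact.norm.comp_left (g := (· ^ 2)) (zero_pow two_ne_zero))]

lemma norm_fn_sq_le {x : ℝ} (hx : 0 < x) (φ : TestSpace T M) :
    ‖φ.fn x‖ ^ 2 ≤ x⁻¹ * (‖testIncl T M φ‖ ^ 2 + ‖φ‖ ^ 2) := by
  have hi := integrable_weight φ (fun r => r) continuous_id
  have hi' := integrable_deriv φ
  have hinner : Integrable fun r => 2 * (inner ℂ (φ.fn r) (deriv φ.fn r)).re :=
    integrable_of_support φ _ ((continuous_re_inner_deriv φ).const_mul 2).continuousOn
      fun r hr => by rw [φ.fn_zero_of hr, inner_zero_left, Complex.zero_re, mul_zero]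
  calc ‖φ.fn x‖ ^ 2 = ∫ r in Ioi x, -(2 * (inner ℂ (φ.fn r) (deriv φ.fn r)).re) := by
        rw [integral_neg, integral_Ioi_re_inner_deriv, neg_neg]
    _ ≤ ∫ r in Ioi x, x⁻¹ * (r * ‖φ.fn r‖ ^ 2 + r * ‖deriv φ.fn r‖ ^ 2) := by
        refine setIntegral_mono_on hinner.neg.integrableOn
          ((hi.add hi').const_mul x⁻¹).integrableOn measurableSet_Ioi fun r (hr : x < r) => ?_
        have hxr : 1 ≤ x⁻¹ * r := by
          rw [inv_mul_eq_div, one_le_div hx]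
          exact hr.le
        have habs := (abs_le.mp (abs_re_inner_deriv_le φ r)).1
        nlinarith [sq_nonneg (‖φ.fn r‖ - ‖deriv φ.fn r‖), mul_le_mul_of_nonneg_right hxr
          (by positivity : 0 ≤ ‖φ.fn r‖ ^ 2 + ‖deriv φ.fn r‖ ^ 2)]
    _ ≤ x⁻¹ * (‖testIncl T M φ‖ ^ 2 + ‖φ‖ ^ 2) := by
        rw [integral_const_mul, integral_add hi.integrableOn hi'.integrableOn]
        have hx' : Ioi x ⊆ Ioi 0 := Ioi_subset_Ioi hx.le
        exact mul_le_mul_of_nonneg_left (add_le_add (setIntegral_mul_norm_sq_le φ hx')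
          (setIntegral_mul_norm_deriv_sq_le φ hx')) (inv_nonneg.mpr hx.le)

/-- Evaluation of test functions at `x`. -/
def evalTest (T : AngularOp F) (M : Model) (x : ℝ) : TestSpace T M →ₗ[ℂ] F where
  toFun φ := φ.fn x
  map_add' _ _ := rfl
  map_smul' _ _ := rfl

lemma exists_norm_evalTest_le (T : AngularOp F) (M : Model) {x : ℝ} (hx : 0 < x) :
    ∃ C : ℝ, ∀ φ : TestSpace T M, ‖evalTest T M x φ‖ ≤ C * ‖φ‖ := by
  obtain ⟨K, hK⟩ := testIncl_bound T M
  refine ⟨Real.sqrt (x⁻¹ * (K ^ 2 + 1)), fun φ => le_of_sq_le_sq ?_ (by positivity)⟩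
  have hincl : ‖testIncl T M φ‖ ^ 2 ≤ (K * ‖φ‖) ^ 2 := by gcongr; exact hK φ
  rw [mul_pow, Real.sq_sqrt (by positivity), mul_assoc]
  refine (norm_fn_sq_le hx φ).trans ?_
  gcongr
  linarith

section Complete

variable [CompleteSpace F]

/-- Evaluation of elements of `H_i(I_i)` at `x`, which is meaningful only for `x > 0`. -/
def eval (T : AngularOp F) (M : Model) (x : ℝ) : FormSpace T M →L[ℂ] F :=
  (evalTest T M x).extendOfNorm
    (UniformSpace.Completion.toComplL : TestSpace T M →L[ℂ] FormSpace T M).toLinearMap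

lemma eval_coe {x : ℝ} (hx : 0 < x) (φ : TestSpace T M) : eval T M x φ = φ.fn x :=
  LinearMap.extendOfNorm_eq UniformSpace.Completion.denseRange_coe
    ((exists_norm_evalTest_le T M hx).imp fun C hC φ =>
      (hC φ).trans_eq (congrArg (C * ·) (UniformSpace.Completion.norm_coe φ).symm)) φ

/-- The test functions `f P v` with polynomials `P`, for a bump function `f` on the interval of
the model and a vector `v`. -/
def polynomialTest (T : AngularOp F) {f : ℝ → ℝ} (hf : ContDiff ℝ ∞ f) (hc : HasCompactSupport f)
    (hs : tsupport f ⊆ M.interval) (v : F) : Polynomial ℂ →ₗ[ℂ] TestSpace T M where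
  toFun P := .cutoff T hf hc hs (u := fun r : ℝ => P.eval (r : ℂ) • v)
    ((((P.contDiff_aeval ∞).restrict_scalars ℝ).comp Complex.ofRealCLM.contDiff).smul
      contDiff_const)
  map_add' P Q := Subtype.ext <| funext fun r => by
    change f r • (P + Q).eval (r : ℂ) • v = f r • P.eval (r : ℂ) • v + f r • Q.eval (r : ℂ) • v
    rw [Polynomial.eval_add, add_smul, smul_add]
  map_smul' c P := Subtype.ext <| funext fun r => by
    change f r • (c • P).eval (r : ℂ) • v = c • f r • P.eval (r : ℂ) • v
    rw [Polynomial.eval_smul, smul_eq_mul, mul_smul, smul_comm]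

lemma not_finiteDimensional_formSpace [Nontrivial F] (T : AngularOp F)
    (hM : M.interval.Nonempty) : ¬ FiniteDimensional ℂ (FormSpace T M) := by
  intro hfin
  obtain ⟨v, hv⟩ := exists_ne (0 : F)
  obtain ⟨x, hx⟩ := hM
  obtain ⟨f, hs, hc, hf, -, hfx⟩ :=
    exists_contDiff_tsupport_subset (n := ⊤) (M.isOpen_interval.mem_nhds hx)
  refine Polynomial.not_finite (R := ℂ) (Module.Finite.of_injective
    ((UniformSpace.Completion.toComplL : TestSpace T M →L[ℂ] FormSpace T M).toLinearMap ∘ₗ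
      polynomialTest T hf hc hs v) ((injective_iff_map_eq_zero _).mpr fun P hP => ?_))
  have hcoe : ((polynomialTest T hf hc hs v P : TestSpace T M) : FormSpace T M) = 0 := hP
  have hnear : {r : ℝ | 0 < r ∧ f r ≠ 0} ∈ 𝓝 x :=
    inter_mem (Ioi_mem_nhds (M.interval_subset hx))
      (hf.continuous.continuousAt.eventually_ne (hfx ▸ one_ne_zero))
  refine P.eq_zero_of_infinite_isRoot
    (((infinite_of_mem_nhds x hnear).image Complex.ofReal_injective.injOn).mono ?_)
  rintro _ ⟨r, ⟨hr, hfr⟩, rfl⟩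
  have heval : f r • P.eval (r : ℂ) • v = 0 := by
    rw [← map_zero (eval T M r), ← hcoe, eval_coe hr]
    rfl
  simpa [hfr, hv] using heval

end Complete

/-! ## Compactness of multiplication operators -/

lemma intervalIntegral_deriv_sq_sub_sq_mul_norm_sq (φ : TestSpace T M) (x y : ℝ) :
    ∫ r in x..y, (2 * r * ‖φ.fn r‖ ^ 2
      + (r ^ 2 - x ^ 2) * (2 * (inner ℂ (φ.fn r) (deriv φ.fn r)).re))
        = (y ^ 2 - x ^ 2) * ‖φ.fn y‖ ^ 2 := by
  have hφ := φ.contDiff.continuous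
  have hinner := continuous_re_inner_deriv φ
  rw [intervalIntegral.integral_eq_sub_of_hasDerivAt
    (f := fun r => (r ^ 2 - x ^ 2) * ‖φ.fn r‖ ^ 2) (fun r _ => ?_)
    (Continuous.intervalIntegrable (by fun_prop) _ _)]
  · ring
  · exact (((hasDerivAt_pow 2 r).sub_const (x ^ 2)).mul
      (hasDerivAt_norm_sq φ r)).congr_deriv (by norm_num)

lemma intervalIntegral_mul_norm_sq_le (φ : TestSpace T M) {x y : ℝ} (hx : 0 ≤ x) (hxy : x ≤ y) :
    ∫ r in x..y, r * ‖φ.fn r‖ ^ 2 ≤ 4 * (y - x) ^ 2 * (∫ r in x..y, r * ‖deriv φ.fn r‖ ^ 2)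
      + (y ^ 2 - x ^ 2) * ‖φ.fn y‖ ^ 2 := by
  have hφ := φ.contDiff.continuous
  have hφ' := φ.continuous_deriv
  have hinner := continuous_re_inner_deriv φ
  rw [← intervalIntegral_deriv_sq_sub_sq_mul_norm_sq, ← intervalIntegral.integral_const_mul,
    ← intervalIntegral.integral_add (Continuous.intervalIntegrable (by fun_prop) _ _)
      (Continuous.intervalIntegrable (by fun_prop) _ _)]
  refine intervalIntegral.integral_mono_on hxy (Continuous.intervalIntegrable (by fun_prop) _ _)
    (Continuous.intervalIntegrable (by fun_prop) _ _) fun r ⟨hxr, hry⟩ => ?_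
  have hr : 0 ≤ r := hx.trans hxr
  have hweight : r ^ 2 - x ^ 2 ≤ 2 * r * (y - x) := by nlinarith
  have hcross : -(2 * r * (y - x) * (‖φ.fn r‖ * ‖deriv φ.fn r‖))
      ≤ (r ^ 2 - x ^ 2) * (inner ℂ (φ.fn r) (deriv φ.fn r)).re := by
    have hweight_nonneg : 0 ≤ r ^ 2 - x ^ 2 := sub_nonneg.mpr (pow_le_pow_left₀ hx hxr 2)
    have hlower := mul_le_mul_of_nonneg_left (abs_le.mp (abs_re_inner_deriv_le φ r)).1
      hweight_nonneg
    have hupper := mul_le_mul_of_nonneg_right hweight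
      (by positivity : 0 ≤ ‖φ.fn r‖ * ‖deriv φ.fn r‖)
    linarith
  have hsquare := mul_nonneg hr (sq_nonneg (‖φ.fn r‖ - 2 * (y - x) * ‖deriv φ.fn r‖))
  linarith

lemma intervalIntegral_le_sum_eval (φ : TestSpace T M) {R : ℝ} (hR : 0 < R) {N : ℕ} (hN : 0 < N) :
    ∫ r in (0 : ℝ)..R, r * ‖φ.fn r‖ ^ 2 ≤ 4 * (R / N) ^ 2 * ‖φ‖ ^ 2
      + R ^ 2 * ∑ k : Fin N, ‖φ.fn ((k + 1 : ℕ) * (R / N))‖ ^ 2 := by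
  have hφ := φ.contDiff.continuous
  have hφ' := φ.continuous_deriv
  have hδ : 0 ≤ R / N := by positivity
  set x : ℕ → ℝ := fun k => k * (R / N) with hx
  have hx_mono : Monotone x := fun j k hjk => by simp only [hx]; gcongr
  have hx_nonneg (k : ℕ) : 0 ≤ x k := mul_nonneg k.cast_nonneg hδ
  have hx_zero : x 0 = 0 := by simp only [hx, Nat.cast_zero, zero_mul]
  have hx_last : x N = R := mul_div_cancel₀ R (Nat.cast_ne_zero.mpr hN.ne')
  have hx_step (k : ℕ) : x (k + 1) - x k = R / N := by simp only [hx]; push_cast; ring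
  have hpiece (k : Fin N) : ∫ r in x k..x (k + 1), r * ‖φ.fn r‖ ^ 2
      ≤ 4 * (R / N) ^ 2 * (∫ r in x k..x (k + 1), r * ‖deriv φ.fn r‖ ^ 2)
        + R ^ 2 * ‖φ.fn (x (k + 1))‖ ^ 2 := by
    refine (intervalIntegral_mul_norm_sq_le φ (hx_nonneg k) (hx_mono k.val.le_succ)).trans ?_
    rw [hx_step]
    gcongr
    have hxR : x (k + 1) ^ 2 ≤ R ^ 2 :=
      pow_le_pow_left₀ (hx_nonneg _) ((hx_mono k.2).trans_eq hx_last) 2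
    linarith [sq_nonneg (x k)]
  have hsum {h : ℝ → ℝ} (hh : Continuous h) :
      ∑ k : Fin N, ∫ r in x k..x (k + 1), h r = ∫ r in (0 : ℝ)..R, h r := by
    rw [Fin.sum_univ_eq_sum_range (fun k => ∫ r in x k..x (k + 1), h r),
      intervalIntegral.sum_integral_adjacent_intervals fun k _ => hh.intervalIntegrable _ _,
      hx_zero, hx_last]
  have hderiv : ∫ r in (0 : ℝ)..R, r * ‖deriv φ.fn r‖ ^ 2 ≤ ‖φ‖ ^ 2 := by
    rw [intervalIntegral.integral_of_le hR.le]
    exact setIntegral_mul_norm_deriv_sq_le φ Ioc_subset_Ioi_self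
  rw [← hsum (by fun_prop)]
  refine (Finset.sum_le_sum fun k _ => hpiece k).trans ?_
  rw [Finset.sum_add_distrib, ← Finset.mul_sum, ← Finset.mul_sum, hsum (by fun_prop)]
  gcongr

lemma setIntegral_mul_norm_sq_mono_subset (φ : TestSpace T M) {u v : ℝ → ℝ} (hu : Continuous u)
    (hv : Continuous v) {A B : Set ℝ} (hA : MeasurableSet A) (hB : MeasurableSet B) (hAB : A ⊆ B)
    (huv : ∀ r ∈ A, u r ≤ v r) (hv₀ : ∀ r ∈ B, 0 ≤ v r) :
    ∫ r in A, u r * ‖φ.fn r‖ ^ 2 ≤ ∫ r in B, v r * ‖φ.fn r‖ ^ 2 :=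
  (setIntegral_mono_on (integrable_weight φ u hu).integrableOn
    (integrable_weight φ v hv).integrableOn hA
    fun r hr => mul_le_mul_of_nonneg_right (huv r hr) (sq_nonneg _)).trans
  (setIntegral_mono_set (integrable_weight φ v hv).integrableOn
    (ae_restrict_of_forall_mem hB fun r hr => mul_nonneg (hv₀ r hr) (sq_nonneg _))
    hAB.eventuallyLE)

lemma norm_sq_mulTest_le (p : Multiplier M) {R P ε : ℝ} (hR : 0 ≤ R)
    (hP : ∀ r ∈ Icc 0 R, p.fn r ^ 2 ≤ P) (hε : 0 ≤ ε)
    (hp : ∀ r ∈ M.interval, R < r → p.fn r ^ 2 ≤ ε * (M.weight * r ^ 2)) (φ : TestSpace T M) :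
    ‖mulTest T M p φ‖ ^ 2 ≤ P * (∫ r in (0 : ℝ)..R, r * ‖φ.fn r‖ ^ 2) + ε * ‖φ‖ ^ 2 := by
  have hP₀ : 0 ≤ P := (sq_nonneg _).trans (hP 0 ⟨le_rfl, hR⟩)
  have hw := M.weight_nonneg
  have hpc : Continuous fun r => r * p.fn r ^ 2 := continuous_id.mul (p.continuous.pow 2)
  have hM := M.measurableSet_interval
  have hlow : ∫ r in M.interval ∩ Ioc 0 R, r * p.fn r ^ 2 * ‖φ.fn r‖ ^ 2
      ≤ P * ∫ r in (0 : ℝ)..R, r * ‖φ.fn r‖ ^ 2 := by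
    rw [intervalIntegral.integral_of_le hR, ← integral_const_mul]
    simp only [← mul_assoc P]
    refine setIntegral_mul_norm_sq_mono_subset φ hpc (by fun_prop)
      (hM.inter measurableSet_Ioc) measurableSet_Ioc inter_subset_right (fun r ⟨_, hr⟩ => ?_)
      fun r hr => mul_nonneg hP₀ hr.1.le
    rw [mul_comm]
    exact mul_le_mul_of_nonneg_right (hP r ⟨hr.1.le, hr.2⟩) hr.1.le
  have hhigh : ∫ r in M.interval \ Ioc 0 R, r * p.fn r ^ 2 * ‖φ.fn r‖ ^ 2 ≤ ε * ‖φ‖ ^ 2 := by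
    refine le_trans ?_ (mul_le_mul_of_nonneg_left (integral_weight_le φ) hε)
    rw [← integral_const_mul]
    simp only [← mul_assoc ε]
    refine setIntegral_mul_norm_sq_mono_subset φ hpc (by fun_prop)
      (hM.diff measurableSet_Ioc) hM sdiff_subset (fun r ⟨hr, hr'⟩ => ?_) fun r hr => ?_
    · have hr₀ := M.interval_subset hr
      have hpr := hp r hr (not_le.mp fun hrR => hr' ⟨hr₀, hrR⟩)
      linarith [mul_le_mul_of_nonneg_left hpr (le_of_lt hr₀)]
    · have hr₀ : 0 < r := M.interval_subset hr
      positivity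
  rw [norm_sq_mulTest, ← integral_inter_add_sdiff measurableSet_Ioc
    (integrable_weight φ _ hpc).integrableOn]
  exact add_le_add hlow hhigh

/-- Multipliers that are small in comparison with the density `r³` of the scalar product near the
upper end of the interval; on a bounded interval this is no condition. -/
def Multiplier.IsNegligible (p : Multiplier M) : Prop :=
  ∀ ε : ℝ, 0 < ε → ∃ R : ℝ, 0 < R ∧
    ∀ r ∈ M.interval, R < r → p.fn r ^ 2 ≤ ε * (M.weight * r ^ 2)

section Complete

variable [CompleteSpace F]

lemma exists_norm_sq_mulOp_le_sum_eval {p : Multiplier M} (hp : p.IsNegligible) {ε : ℝ}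
    (hε : 0 < ε) : ∃ (N : ℕ) (x : Fin N → ℝ) (C : ℝ), ∀ ψ : FormSpace T M,
      ‖mulOp T M p ψ‖ ^ 2 ≤ ε * ‖ψ‖ ^ 2 + C * ∑ k, ‖eval T M (x k) ψ‖ ^ 2 := by
  obtain ⟨R, hR, hpR⟩ := hp (ε / 2) (half_pos hε)
  obtain ⟨P, hP⟩ := (isCompact_Icc (a := (0 : ℝ)) (b := R)).bddAbove_image
    (f := fun r => p.fn r ^ 2) (p.continuous.pow 2).continuousOn
  have hPR : ∀ r ∈ Icc 0 R, p.fn r ^ 2 ≤ P := fun r hr => hP (mem_image_of_mem _ hr)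
  have hP₀ : 0 ≤ P := (sq_nonneg _).trans (hPR 0 ⟨le_rfl, hR.le⟩)
  obtain ⟨N, hNε, hN⟩ : ∃ N : ℕ, P * (4 * (R / N) ^ 2) ≤ ε / 2 ∧ 0 < N := by
    have hlim : Tendsto (fun N : ℕ => P * (4 * (R / N) ^ 2)) atTop (𝓝 0) := by
      simpa only [zero_pow two_ne_zero, mul_zero] using
        (((tendsto_const_div_atTop_nhds_zero_nat R).pow 2).const_mul 4).const_mul P
    exact ((hlim.eventually_le_const (half_pos hε)).and (eventually_gt_atTop 0)).exists
  have hx (k : Fin N) : 0 < ((k + 1 : ℕ) : ℝ) * (R / N) := by positivity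
  refine ⟨N, fun k => (k + 1 : ℕ) * (R / N), P * R ^ 2, fun ψ => ?_⟩
  refine UniformSpace.Completion.denseRange_coe.induction_on ψ
    (isClosed_le (by fun_prop) (by fun_prop)) fun φ => ?_
  simp only [mulOp_coe, eval_coe (hx _), UniformSpace.Completion.norm_coe]
  have hsplit := norm_sq_mulTest_le p hR.le hPR (half_pos hε).le hpR φ
  have hlow := mul_le_mul_of_nonneg_left (intervalIntegral_le_sum_eval φ hR hN) hP₀
  have hmesh := mul_le_mul_of_nonneg_right hNε (sq_nonneg ‖φ‖)
  linarith

/-- On the elements of `H_i(I_i)` that vanish at the points of a fine partition, the operator has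
small norm. -/
theorem isCompactOperator_mulOp [FiniteDimensional ℂ F] {p : Multiplier M}
    (hp : p.IsNegligible) : IsCompactOperator (mulOp T M p) := by
  refine isCompactOperator_of_forall_small_on_finite_codim _ fun ε hε => ?_
  obtain ⟨N, x, C, hx⟩ := exists_norm_sq_mulOp_le_sum_eval (T := T) hp (pow_pos hε 2)
  let evals : FormSpace T M →L[ℂ] (Fin N → F) := .pi fun k => eval T M (x k)
  refine ⟨evals.ker, evals.isClosed_ker,
    Module.Finite.equiv evals.toLinearMap.quotKerEquivRange.symm, fun ψ hψ => ?_⟩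
  have heval (k : Fin N) : eval T M (x k) ψ = 0 := congrFun hψ k
  have hψε := hx ψ
  simp only [heval, norm_zero, zero_pow two_ne_zero, Finset.sum_const_zero, mul_zero,
    add_zero, ← mul_pow] at hψε
  exact le_of_sq_le_sq hψε (by positivity)

end Complete

/-! ## Eigensystems of coercive radial problems -/

section Complete

variable [CompleteSpace F]

lemma hamiltonianOp_shift (p s : Multiplier M) (α β γ b : ℝ) :
    hamiltonianOp T M p s (α + b * γ) β
      = hamiltonianOp T M p s α β + (b : ℂ) • (γ : ℂ) • gram T M p := by
  simp only [hamiltonianOp]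
  push_cast
  module

lemma isStrictlyPositive_hamiltonianOp {p s : Multiplier M} {α β c : ℝ} (hc : 0 < c)
    (hcoer : ∀ φ : TestSpace T M, c * ‖φ‖ ^ 2
      ≤ ‖φ‖ ^ 2 + α * ‖mulTest T M p φ‖ ^ 2 + β * ‖mulTest T M s φ‖ ^ 2) :
    IsStrictlyPositive (hamiltonianOp T M p s α β) := by
  refine isStrictlyPositive_of_coercive (isSelfAdjoint_hamiltonianOp p s α β) hc fun ψ => ?_
  rw [re_inner_hamiltonianOp_self]
  refine UniformSpace.Completion.denseRange_coe.induction_on ψ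
    (isClosed_le (by fun_prop) (by fun_prop)) fun φ => ?_
  simpa only [mulOp_coe, UniformSpace.Completion.norm_coe] using hcoer φ

theorem exists_isCompleteEigensystem [FiniteDimensional ℂ F] [Nontrivial F]
    (hM : M.interval.Nonempty) {p s : Multiplier M} {q w : ℝ → ℝ} {α β γ b c : ℝ}
    (hq : ∀ r ∈ M.interval, q r = M.weight * r ^ 2 + α * p.fn r ^ 2 + β * s.fn r ^ 2)
    (hw : ∀ r ∈ M.interval, w r = γ * p.fn r ^ 2) (hγ : 0 < γ)
    (hp₀ : ∀ r, 0 < r → p.fn r ≠ 0) (hp : p.IsNegligible) (hc : 0 < c)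
    (hcoer : ∀ φ : TestSpace T M, c * ‖φ‖ ^ 2
      ≤ ‖φ‖ ^ 2 + (α + b * γ) * ‖mulTest T M p φ‖ ^ 2 + β * ‖mulTest T M s φ‖ ^ 2) :
    ∃ (Λ : ℕ → ℝ) (ψ : ℕ → FormSpace T M),
      IsCompleteEigensystem ℂ (IsEigenpair q w) Λ ψ := by
  have hpos : ((γ : ℂ) • gram T M p).IsPositive :=
    (isPositive_gram p).smul_of_nonneg (Complex.zero_le_real.mpr hγ.le)
  have hcompact : IsCompactOperator ((γ : ℂ) • gram T M p) :=
    ((isCompactOperator_mulOp hp).clm_comp (mulOp T M p).adjoint).smul (γ : ℂ)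
  have hinj : Function.Injective ((γ : ℂ) • gram T M p) :=
    (smul_right_injective _ (Complex.ofReal_ne_zero.mpr hγ.ne')).comp (gram_injective p hp₀)
  obtain ⟨Λ, ψ, hψ⟩ := exists_isCompleteEigensystem_pencil (not_finiteDimensional_formSpace T hM)
    (isStrictlyPositive_hamiltonianOp hc hcoer) hpos hcompact hinj
  refine ⟨fun j => Λ j - b, ψ, hψ.congr_shift b fun l v => ?_⟩
  rw [isEigenpair_iff_pencil p s hq hw, hamiltonianOp_shift, Complex.ofReal_add, add_smul]
  exact add_left_inj (((b : ℂ) • (γ : ℂ) • gram T M p) v) |>.symm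

end Complete

/-! ## Powers of the radius -/

lemma rpow_sq_le {r a : ℝ} (hr : 0 ≤ r) (ha₀ : 0 ≤ a) (ha₁ : a ≤ 1) :
    (r ^ a) ^ 2 ≤ 1 + r ^ 2 := by
  rw [← Real.rpow_mul_natCast hr, mul_comm, Real.rpow_natCast_mul hr]
  calc (r ^ 2) ^ a ≤ (1 + r ^ 2) ^ a := by gcongr; linarith
    _ ≤ 1 + r ^ 2 := Real.rpow_le_self_of_one_le (by linarith [sq_nonneg r]) ha₁

/-- The multiplier `r`. -/
def Multiplier.radius (M : Model) : Multiplier M where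
  fn r := r
  continuous := continuous_id
  bound := by
    cases M with
    | bounded r₀ =>
      refine ⟨r₀ ^ 2, sq_nonneg r₀, fun r hr => ?_⟩
      simpa [Model.weight] using pow_le_pow_left₀ hr.1.le hr.2.le 2
    | unbounded => exact ⟨1, one_pos.le, fun r _ => by simp [Model.weight]⟩

/-- The multiplier `r ^ a`. -/
def Multiplier.rpow (M : Model) (a : ℝ) (ha₀ : 0 ≤ a) (ha₁ : a ≤ 1) : Multiplier M where
  fn r := r ^ a
  continuous := Real.continuous_rpow_const ha₀
  bound := by
    obtain ⟨C, hC, hradius⟩ := (Multiplier.radius M).bound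
    refine ⟨1 + C, by positivity, fun r hr => ?_⟩
    have hr₀ : r ^ 2 ≤ C * (1 + M.weight * r ^ 2) := hradius r hr
    have hw := mul_nonneg M.weight_nonneg (sq_nonneg r)
    linarith [rpow_sq_le (M.interval_subset hr).le ha₀ ha₁]

lemma Multiplier.isNegligible_bounded {r₀ : ℝ} (hr₀ : 0 < r₀) (p : Multiplier (.bounded r₀)) :
    p.IsNegligible :=
  fun _ _ => ⟨r₀, hr₀, fun _ hr hlt => absurd hr.2 hlt.not_gt⟩

lemma Multiplier.isNegligible_rpow_unbounded {a : ℝ} (ha₀ : 0 ≤ a) (ha₁ : a < 1) :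
    (Multiplier.rpow .unbounded a ha₀ ha₁.le).IsNegligible := by
  intro ε hε
  have hlim : Tendsto (fun r : ℝ => (r ^ (-(1 - a))) ^ 2) atTop (𝓝 0) := by
    simpa only [zero_pow two_ne_zero] using (tendsto_rpow_neg_atTop (sub_pos.mpr ha₁)).pow 2
  obtain ⟨R, hR⟩ := (hlim.eventually_le_const hε).exists_forall_of_atTop
  refine ⟨max R 1, by positivity, fun r (hr : 0 < r) hlt => ?_⟩
  have hfactor : r ^ a = r ^ (-(1 - a)) * r := by
    rw [← Real.rpow_add_one hr.ne']
    ring_nf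
  calc (r ^ a) ^ 2 = (r ^ (-(1 - a))) ^ 2 * r ^ 2 := by rw [hfactor, mul_pow]
    _ ≤ ε * r ^ 2 := by
        gcongr
        exact hR r ((le_max_left _ _).trans hlt.le)
    _ = ε * (Model.unbounded.weight * r ^ 2) := by rw [Model.weight, one_mul]

/-! ## Interpolation -/

lemma neg_sq_mul_re_inner_deriv_le (φ : TestSpace T M) {ε : ℝ} (hε : 0 < ε) {r : ℝ} (hr : 0 ≤ r) :
    -(r ^ 2 * (inner ℂ (φ.fn r) (deriv φ.fn r)).re)
      ≤ ε * (r * ‖deriv φ.fn r‖ ^ 2) + 1 / (4 * ε) * (r * r ^ 2 * ‖φ.fn r‖ ^ 2) := by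
  have hcross := mul_le_mul_of_nonneg_left (abs_le.mp (abs_re_inner_deriv_le φ r)).1
    (sq_nonneg r)
  have hsquare : 0 ≤ r / ε * (ε * ‖deriv φ.fn r‖ - r * ‖φ.fn r‖ / 2) ^ 2 := by positivity
  have hexpand : r / ε * (ε * ‖deriv φ.fn r‖ - r * ‖φ.fn r‖ / 2) ^ 2
      = ε * (r * ‖deriv φ.fn r‖ ^ 2) + 1 / (4 * ε) * (r * r ^ 2 * ‖φ.fn r‖ ^ 2)
        - r ^ 2 * (‖φ.fn r‖ * ‖deriv φ.fn r‖) := by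
    field_simp
    ring
  linarith

lemma norm_sq_testIncl_le (φ : TestSpace T M) {ε : ℝ} (hε : 0 < ε) :
    ‖testIncl T M φ‖ ^ 2
      ≤ ε * ‖φ‖ ^ 2 + 1 / (4 * ε) * ‖mulTest T M (.radius M) φ‖ ^ 2 := by
  have hone := (integrable_weight φ (fun r => r) continuous_id).integrableOn (s := M.interval)
  have hcube := ((integrable_weight φ (fun r => r * r ^ 2) (by fun_prop)).const_mul
    (1 / (4 * ε))).integrableOn (s := M.interval)
  have hderiv := ((integrable_deriv φ).const_mul ε).integrableOn (s := M.interval)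
  have hinner : IntegrableOn (fun r => r ^ 2 * (inner ℂ (φ.fn r) (deriv φ.fn r)).re)
      M.interval :=
    (integrable_of_support φ _ ((continuous_pow 2).mul (continuous_re_inner_deriv φ)).continuousOn
      fun r hr => by
        rw [Pi.mul_apply, φ.fn_zero_of hr, inner_zero_left, Complex.zero_re, mul_zero]).integrableOn
  have hparts : ∫ r in M.interval, r * ‖φ.fn r‖ ^ 2
      = ∫ r in M.interval, -(r ^ 2 * (inner ℂ (φ.fn r) (deriv φ.fn r)).re) := by
    rw [integral_neg, eq_neg_iff_add_eq_zero, ← integral_add hone hinner, integral_by_parts]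
  rw [norm_sq_testIncl, hparts, norm_sq_mulTest]
  refine (setIntegral_mono_on hinner.neg (hderiv.add hcube) M.measurableSet_interval
    fun r hr => neg_sq_mul_re_inner_deriv_le φ hε (M.interval_subset hr).le).trans ?_
  rw [integral_add' hderiv hcube, integral_const_mul, integral_const_mul]
  exact add_le_add (mul_le_mul_of_nonneg_left (integral_deriv_le φ) hε.le) le_rfl

lemma norm_sq_mulTest_rpow_le (φ : TestSpace T M) {a : ℝ} (ha₀ : 0 ≤ a) (ha₁ : a ≤ 1) :
    ‖mulTest T M (.rpow M a ha₀ ha₁) φ‖ ^ 2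
      ≤ ‖testIncl T M φ‖ ^ 2 + ‖mulTest T M (.radius M) φ‖ ^ 2 := by
  have hrpow : Continuous fun r : ℝ => r ^ a := Real.continuous_rpow_const ha₀
  rw [norm_sq_testIncl, norm_sq_mulTest, norm_sq_mulTest]
  simp only [Multiplier.rpow, Multiplier.radius]
  rw [← integral_add (integrable_weight φ (fun r => r) continuous_id).integrableOn
    (integrable_weight φ (fun r => r * r ^ 2) (by fun_prop)).integrableOn]
  simp only [← add_mul]
  refine setIntegral_mul_norm_sq_mono φ (by fun_prop) (by fun_prop) fun r hr => ?_
  have hr₀ : 0 ≤ r := (M.interval_subset hr).le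
  linarith [mul_le_mul_of_nonneg_left (rpow_sq_le hr₀ ha₀ ha₁) hr₀]

lemma exists_coercive_shift (T : AngularOp F) (M : Model) {a : ℝ} (ha₀ : 0 ≤ a) (ha₁ : a ≤ 1)
    (α β : ℝ) {γ : ℝ} (hγ : γ ≠ 0) : ∃ b : ℝ, ∀ φ : TestSpace T M, 1 / 2 * ‖φ‖ ^ 2
      ≤ ‖φ‖ ^ 2 + (α + b * γ) * ‖mulTest T M (.radius M) φ‖ ^ 2
        + β * ‖mulTest T M (.rpow M a ha₀ ha₁) φ‖ ^ 2 := by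
  set ε : ℝ := 1 / (2 * (|β| + 1)) with hε
  have hε₀ : 0 < ε := by positivity
  have hβε : |β| * ε ≤ 1 / 2 := by
    rw [hε, mul_one_div, div_le_div_iff₀ (by positivity) two_pos]
    linarith
  refine ⟨(|β| * (1 / (4 * ε) + 1) - α) / γ, fun φ => ?_⟩
  have hrpow := mul_le_mul_of_nonneg_left (norm_sq_mulTest_rpow_le φ ha₀ ha₁) (abs_nonneg β)
  have hincl := mul_le_mul_of_nonneg_left (norm_sq_testIncl_le φ hε₀) (abs_nonneg β)
  have habs := mul_le_mul_of_nonneg_right (neg_abs_le β)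
    (sq_nonneg ‖mulTest T M (.rpow M a ha₀ ha₁) φ‖)
  have hhalf := mul_le_mul_of_nonneg_right hβε (sq_nonneg ‖φ‖)
  rw [div_mul_cancel₀ _ hγ]
  linarith

lemma norm_sq_mulTest_radius_le (φ : TestSpace T .unbounded) :
    ‖mulTest T .unbounded (.radius .unbounded) φ‖ ^ 2 ≤ ‖φ‖ ^ 2 := by
  rw [norm_sq_mulTest]
  refine (setIntegral_mul_norm_sq_mono φ (by fun_prop) (by fun_prop) fun r _ => le_of_eq ?_).trans
    (integral_weight_le φ)
  simp only [Multiplier.radius, Model.weight]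
  ring

lemma min_one_mul_norm_sq_le (φ : TestSpace T .unbounded) (h : ℝ) : min 1 h * ‖φ‖ ^ 2
    ≤ ‖φ‖ ^ 2 + (h - 1) * ‖mulTest T .unbounded (.radius .unbounded) φ‖ ^ 2 := by
  have hle := norm_sq_mulTest_radius_le φ
  rcases le_total 1 h with h₁ | h₁
  · rw [min_eq_left h₁]
    nlinarith [sq_nonneg ‖mulTest T .unbounded (.radius .unbounded) φ‖]
  · rw [min_eq_right h₁]
    nlinarith [sq_nonneg ‖mulTest T .unbounded (.radius .unbounded) φ‖]

end Radial

namespace Cosmo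

open Radial

/-- The exponent `(n - 2) / n`. -/
def Params.exponent (P : Params) : ℝ := ((P.n : ℝ) - 2) / P.n

lemma Params.exponent_nonneg (P : Params) : 0 ≤ P.exponent :=
  div_nonneg (sub_nonneg.mpr (Nat.ofNat_le_cast.mpr P.two_le_n)) (Nat.cast_nonneg _)

lemma Params.exponent_lt_one (P : Params) : P.exponent < 1 := by
  rw [exponent, div_lt_one (Nat.cast_pos.mpr (two_pos.trans_le P.two_le_n))]
  linarith

lemma Params.sixteen_div_sq_pos (P : Params) : 0 < 16 / (P.n : ℝ) ^ 2 :=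
  div_pos (by norm_num) (pow_pos (Nat.cast_pos.mpr (two_pos.trans_le P.two_le_n)) 2)

/-- The multiplier `r ^ ((n - 2) / n)`. -/
abbrev Params.power (P : Params) (M : Model) : Multiplier M :=
  .rpow M P.exponent P.exponent_nonneg P.exponent_lt_one.le

lemma Params.power_sq (P : Params) (M : Model) {r : ℝ} (hr : 0 ≤ r) :
    (P.power M).fn r ^ 2 = r ^ (2 * ((P.n : ℝ) - 2) / P.n) := by
  change (r ^ P.exponent) ^ 2 = _
  rw [← Real.rpow_mul_natCast hr, exponent, Nat.cast_ofNat, div_mul_eq_mul_div, mul_comm 2]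

variable {F : Type*} [NormedAddCommGroup F] [InnerProductSpace ℂ F] [CompleteSpace F]
  [FiniteDimensional ℂ F] [Nontrivial F]

theorem exists_isCompleteEigensystem_bounded (P : Params) (T : AngularOp F) {r₀ : ℝ}
    (hr₀ : 0 < r₀) : ∃ (Λ : ℕ → ℝ) (ψ : ℕ → FormSpace T (.bounded r₀)),
      IsCompleteEigensystem ℂ (IsEigenpair P.q1 P.w1) Λ ψ := by
  have hγ := P.sixteen_div_sq_pos
  obtain ⟨b, hb⟩ := exists_coercive_shift T (.bounded r₀) P.exponent_nonneg P.exponent_lt_one.le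
    (-(16 / (P.n : ℝ) ^ 2 * P.Vbar)) (16 / (P.n : ℝ) ^ 2 * P.κ) hγ.ne'
  refine exists_isCompleteEigensystem (M := .bounded r₀) (nonempty_Ioo.mpr hr₀) (fun r hr => ?_)
    (fun _ _ => rfl) hγ (fun _ hr => hr.ne') (Multiplier.isNegligible_bounded hr₀ (.radius _))
    one_half_pos hb
  rw [P.power_sq _ hr.1.le]
  simp only [Params.q1, Model.weight, Multiplier.radius]
  ring

theorem exists_isCompleteEigensystem_unbounded (P : Params) (hκ : P.κ < 0) (T : AngularOp F) :
    ∃ (Λ : ℕ → ℝ) (ψ : ℕ → FormSpace T .unbounded),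
      IsCompleteEigensystem ℂ (IsEigenpair P.q2 P.w2) Λ ψ := by
  have h16 := P.sixteen_div_sq_pos
  refine exists_isCompleteEigensystem (M := .unbounded) (p := P.power _) (s := .radius _) (α := 0)
    (β := 16 / (P.n : ℝ) ^ 2 - 1) (b := 0) nonempty_Ioi (fun r _ => ?_)
    (fun r hr => by rw [P.power_sq _ (le_of_lt hr), Params.w2])
    (mul_pos (neg_pos.mpr hκ) h16) (fun r hr => (Real.rpow_pos_of_pos hr _).ne')
    (Multiplier.isNegligible_rpow_unbounded P.exponent_nonneg P.exponent_lt_one)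
    (lt_min one_pos h16) fun φ => ?_
  · simp only [Params.q2, Model.weight, Multiplier.radius]
    ring
  · simpa only [zero_mul, add_zero] using min_one_mul_norm_sq_le φ _

end Cosmo

end

theorem theorem7p2p1 (P : Cosmo.Params) (m : ℕ) (hm : 1 ≤ m)
    (S : Type*) [TopologicalSpace S] [T2Space S] [CompactSpace S] [Nonempty S]
    [ChartedSpace (EuclideanSpace ℝ (Fin m)) S] [IsManifold (𝓡 m) ∞ S]
    [MeasurableSpace S] [BorelSpace S] (g : RiemGeom.Metric m S) :
    -- the bounded model
    (∀ r₀ : ℝ, 0 < r₀ →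
      ∃ (Λ : ℕ → ℝ) (ψ : ℕ → Radial.FormSpace (Cosmo.angularOp P g) (.bounded r₀)),
        (∀ j, ψ j ≠ 0 ∧ Radial.IsEigenpair P.q1 P.w1 (Λ j) (ψ j)) ∧
        LinearIndependent ℂ ψ ∧
        (∀ (l : ℝ) (χ : Radial.FormSpace (Cosmo.angularOp P g) (.bounded r₀)),
          Radial.IsEigenpair P.q1 P.w1 l χ → χ ∈ Submodule.span ℂ (ψ '' {j | Λ j = l})) ∧
        (∀ j, Λ j ≤ Λ (j + 1)) ∧
        Tendsto Λ atTop atTop ∧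
        (Submodule.span ℂ (Set.range ψ)).topologicalClosure = ⊤ ∧
        (Submodule.span ℂ (Set.range fun j =>
          Radial.embed (Cosmo.angularOp P g) (.bounded r₀) (ψ j))).topologicalClosure = ⊤) ∧
    -- the unbounded model
    (P.κ < 0 →
      ∃ (lam : ℕ → ℝ) (ψ : ℕ → Radial.FormSpace (Cosmo.angularOp P g) .unbounded),
        (∀ j, ψ j ≠ 0 ∧ Radial.IsEigenpair P.q2 P.w2 (lam j) (ψ j)) ∧
        LinearIndependent ℂ ψ ∧
        (∀ (l : ℝ) (χ : Radial.FormSpace (Cosmo.angularOp P g) .unbounded),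
          Radial.IsEigenpair P.q2 P.w2 l χ → χ ∈ Submodule.span ℂ (ψ '' {j | lam j = l})) ∧
        (∀ j, lam j ≤ lam (j + 1)) ∧
        Tendsto lam atTop atTop ∧
        (Submodule.span ℂ (Set.range ψ)).topologicalClosure = ⊤ ∧
        (Submodule.span ℂ (Set.range fun j =>
          Radial.embed (Cosmo.angularOp P g) .unbounded (ψ j))).topologicalClosure = ⊤) := by
  have := Cosmo.finiteDimensional_H0 P g
  have := Cosmo.nontrivial_H0 P g
  have := FiniteDimensional.complete ℂ (Cosmo.H0 P g)
  refine ⟨fun r₀ hr₀ => ?_, fun hκ => ?_⟩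
  · obtain ⟨Λ, ψ, h⟩ :=
      Cosmo.exists_isCompleteEigensystem_bounded P (Cosmo.angularOp P g) hr₀
    exact ⟨Λ, ψ, fun j => ⟨h.linearIndependent.ne_zero j, h.isSol j⟩, h.linearIndependent,
      h.mem_span, fun j => h.monotone j.le_succ, h.tendsto, h.dense,
      Radial.topologicalClosure_span_range_embed h.dense⟩
  · obtain ⟨lam, ψ, h⟩ :=
      Cosmo.exists_isCompleteEigensystem_unbounded P hκ (Cosmo.angularOp P g)
    exact ⟨lam, ψ, fun j => ⟨h.linearIndependent.ne_zero j, h.isSol j⟩, h.linearIndependent,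
      h.mem_span, fun j => h.monotone j.le_succ, h.tendsto, h.dense,
      Radial.topologicalClosure_span_range_embed h.dense⟩
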